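/- Let $1<\gamma<2$, $\gamma_0=(\gamma-1)/2\in(0,1/2)$, $T>0$ and $m,n\in\mathbb N_{>0}$. There is a constant $C>0$, depending only on $\gamma,T,m,n$, such that the following holds for all data below. **Data.** Let $d\in\{2,3\}$, and let $\Omega\subset\mathbb R^d$ be non-empty and open, with a finite conforming triangulation $\mathcal K_h$ into closed $d$-simplices (their union is $\overline\Omega$ and their interiors lie in $\Omega$). Let $\|v\|_{H^1_0(\Omega)}=\|\nabla v\|_{L^2(\Omega)}$, $\sigma\ge1$, $J\in\mathbb N_{>0}$, $t_j=(j/J)^\sigma T$ for $0\le j\le J$, and $I_j=(t_{j-1},t_j)$ for $1\le j\le J$. **Spaces in time.** Fix an orthonormal basis $\{e_k\}_{k\in\mathbb N}$ of $L^2(\Omega)$. For $0<b\le T$, let $H^{\gamma_0}(0,b;L^2(\Omega))$ be the space of all $v\in L^2(0,b;L^2(\Omega))$ with $$|v|_{H^{\gamma_0}(0,b;L^2(\Omega))}^2:=\sum_{k}\int_{\mathbb R}|\xi|^{2\gamma_0}\,\bigl|\mathcal F\bigl((v,e_k)_{L^2(\Omega)}\chi_{(0,b)}\bigr)(\xi)\bigr|^2\,d\xi<\infty,$$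 where $\mathcal F$ is the unitary Fourier transform on $L^2(\mathbb R)$ (kernel $e^{-i\xi t}/\sqrt{2\pi}$). Let $H^{-\gamma_0}(0,b;L^2(\Omega))$ be its dual with respect to $|\cdot|_{H^{\gamma_0}(0,b;L^2(\Omega))}$, with the dual norm. A functional on $H^{\gamma_0}(0,T;L^2(\Omega))$ is restricted to $(0,b)$ by means of extension by zero. Let $D_{0+}^\gamma w=D^2 I_{0+}^{2-\gamma}w$, where $I_{0+}^{\beta}w(t)=\frac1{\Gamma(\beta)}\int_0^t(t-s)^{\beta-1}w(s)\,ds$ and $D$ is the distributional derivative on $(0,T)$. **Discrete spaces.** Let $$S_h=\{v\in H_0^1(\Omega): v|_K\in P_n(K)\ \forall K\in\mathcal K_h\},\qquad \Sigma_h=\{v\in H^1(\Omega): v|_K\in P_n(K)\ \forall K\in\mathcal K_h\}.$$ Let $M_{h,\tau}$ be the space of continuous functions $[0,T]\to S_h$ that are on each $I_j$ polynomials in $t$ of degree $\le m$ with coefficients in $S_h$, and let $W_{h,\tau}$ be the space of (in general discontinuous) functions that are on each $I_j$ polynomials in $t$ of degree $\le m-1$ with coefficients in $S_h$. Let $\Pi_h$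 be the $L^2(\Omega)$-orthogonal projection onto $\Sigma_h$, and let $R_h:H_0^1(\Omega)\to S_h$ be defined by $(\nabla(v-R_hv),\nabla v_h)_{L^2(\Omega)}=0$ for all $v_h\in S_h$. **Discrete problem.** Given $u_0\in H_0^1(\Omega)$, $u_1\in L^2(\Omega)$ and $f\in H^{-\gamma_0}(0,T;L^2(\Omega))$, find $U\in M_{h,\tau}$ with $U(0)=R_hu_0$ such that $D_{0+}^\gamma(U-U(0)-t\Pi_hu_1)\in H^{-\gamma_0}(0,T;L^2(\Omega))$ and $$\langle D_{0+}^\gamma(U-U(0)-t\,\Pi_hu_1),V\rangle+\int_0^T(\nabla U,\nabla V)_{L^2(\Omega)}\,dt=\langle f,V\rangle\qquad\text{for all }V\in W_{h,\tau},$$ where $\langle\cdot,\cdot\rangle$ is the duality pairing between $H^{-\gamma_0}(0,T;L^2(\Omega))$ and $H^{\gamma_0}(0,T;L^2(\Omega))$. **Conclusion.** The discrete problem has exactly one solution $U$ (as a function on $[0,T]$). For every $1\le j\le J$, $U'\in H^{\gamma_0}(0,t_j;L^2(\Omega))$ and $$|U'|_{H^{\gamma_0}(0,t_j;L^2(\Omega))}+\|U(t_j)\|_{H_0^1(\Omega)}\le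 C\Bigl(\|u_0\|_{H_0^1(\Omega)}+t_j^{1/2-\gamma_0}\|u_1\|_{L^2(\Omega)}+\|f\|_{H^{-\gamma_0}(0,t_j;L^2(\Omega))}\Bigr).$$ -/

import Mathlib

open MeasureTheory Set

open scoped FourierTransform Gradient ContDiff

noncomputable section

namespace FracWave

/-! ### Fractional Sobolev spaces in time and their duals -/

section Time

variable {X : Type*} [NormedAddCommGroup X] [InnerProductSpace ℝ X]

/-- The `j`-th coordinate `(v, e_j)_X` of a function `v` on `(a, b)`, extended by zero to `ℝ`. -/
def coordFun (e : HilbertBasis ℕ ℝ X) (a b : ℝ) (v : ℝ → X) (j : ℕ) : ℝ → ℂ :=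
  (Ioo a b).indicator fun t => ((inner ℝ (e j) (v t) : ℝ) : ℂ)

/-- The square `∑_j ∫_ℝ |ξ|^{2α} |F((v, e_j)_X χ_{(a,b)})(ξ)|² dξ` of the seminorm
`|v|_{H^α(a,b;X)}`, where `F` is the unitary Fourier transform with kernel `e^{-iξt} / √(2π)`.
It is written with Mathlib's Fourier transform (kernel `e^{-2πiξt}`), the two being related by
the substitution `ξ ↦ 2πξ`. -/
def fracEnergy (e : HilbertBasis ℕ ℝ X) (α a b : ℝ) (v : ℝ → X) : ENNReal :=
  ∑' j, ∫⁻ ξ : ℝ, ENNReal.ofReal (|2 * Real.pi * ξ| ^ (2 * α)) * ‖𝓕 (coordFun e a b v j) ξ‖ₑ ^ 2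

/-- The norm `|v|_{H^α(a,b;X)}`. -/
def fracNorm (e : HilbertBasis ℕ ℝ X) (α a b : ℝ) (v : ℝ → X) : ℝ :=
  Real.sqrt (fracEnergy e α a b v).toReal

lemma coord_integrable (e : HilbertBasis ℕ ℝ X) {a b : ℝ} {v : ℝ → X}
    (hv : MemLp v 2 (volume.restrict (Ioo a b))) (j : ℕ) :
    Integrable (coordFun e a b v j) := by
  unfold coordFun
  rw [integrable_indicator_iff measurableSet_Ioo]
  have h1 : Integrable v (volume.restrict (Ioo a b)) := hv.integrable (by norm_num)
  exact (h1.const_inner (e j)).ofReal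

lemma fourier_continuous {f : ℝ → ℂ} (hf : Integrable f) : Continuous (𝓕 f) :=
  VectorFourier.fourierIntegral_continuous Real.continuous_fourierChar
    (by fun_prop) hf

lemma fourier_add' {f g : ℝ → ℂ} (hf : Integrable f) (hg : Integrable g) :
    𝓕 (f + g) = 𝓕 f + 𝓕 g :=
  VectorFourier.fourierIntegral_add Real.continuous_fourierChar
    (by fun_prop) hf hg

lemma fourier_smul' (c : ℂ) (f : ℝ → ℂ) : 𝓕 (c • f) = c • 𝓕 f :=
  VectorFourier.fourierIntegral_const_smul _ _ _ f c

lemma coordFun_add (e : HilbertBasis ℕ ℝ X) (a b : ℝ) (v w : ℝ → X) (j : ℕ) :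
    coordFun e a b (v + w) j = coordFun e a b v j + coordFun e a b w j := by
  funext t
  by_cases h : t ∈ Ioo a b <;> simp [coordFun, h, inner_add_right]

lemma coordFun_smul (e : HilbertBasis ℕ ℝ X) (a b c : ℝ) (v : ℝ → X) (j : ℕ) :
    coordFun e a b (c • v) j = (c : ℂ) • coordFun e a b v j := by
  funext t
  by_cases h : t ∈ Ioo a b <;> simp [coordFun, h, inner_smul_right]

lemma enorm_add_sq_le (x y : ℂ) : ‖x + y‖ₑ ^ 2 ≤ 2 * ‖x‖ₑ ^ 2 + 2 * ‖y‖ₑ ^ 2 := by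
  have h : ‖x + y‖ ^ 2 ≤ 2 * ‖x‖ ^ 2 + 2 * ‖y‖ ^ 2 := by
    have h1 := norm_add_le x y
    have h2 : ‖x + y‖ ^ 2 ≤ (‖x‖ + ‖y‖) ^ 2 := by gcongr
    nlinarith [sq_nonneg (‖x‖ - ‖y‖)]
  have h3 := ENNReal.ofReal_le_ofReal h
  rw [ENNReal.ofReal_add (by positivity) (by positivity), ENNReal.ofReal_mul (by norm_num),
    ENNReal.ofReal_mul (by norm_num), ENNReal.ofReal_pow (norm_nonneg _),
    ENNReal.ofReal_pow (norm_nonneg _), ENNReal.ofReal_pow (norm_nonneg _)] at h3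
  simpa [ofReal_norm] using h3

/-- For `0 < α < 1/2` this is the Sobolev space `H^α(a,b;X)`: all `v ∈ L²(a,b;X)` with
`∑_j ‖(v, e_j)_X‖²_{H^α(a,b)} < ∞`. (For these `α` extension by zero is bounded from `H^α(a,b)`
to `H^α(ℝ)`, so `H^α(a,b)` consists of the `v ∈ L²(a,b)` whose zero extension lies in `H^α(ℝ)`.)
Elements are functions on `ℝ`, of which only the restriction to `(a, b)`, up to null sets,
matters. -/
def FracSpace (e : HilbertBasis ℕ ℝ X) (α a b : ℝ) : Submodule ℝ (ℝ → X) where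
  carrier := {v | MemLp v 2 (volume.restrict (Ioo a b)) ∧ fracEnergy e α a b v < ⊤}
  zero_mem' := by
    refine ⟨MemLp.zero, ?_⟩
    have h : ∀ j, coordFun e a b (0 : ℝ → X) j = (0 : ℂ) • (0 : ℝ → ℂ) := by
      intro j; funext t; simp [coordFun]
    simp only [fracEnergy, h, fourier_smul']
    simp
  add_mem' := by
    rintro v w ⟨hv, hv'⟩ ⟨hw, hw'⟩
    refine ⟨hv.add hw, ?_⟩
    have key : fracEnergy e α a b (v + w)
        ≤ 2 * fracEnergy e α a b v + 2 * fracEnergy e α a b w := by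
      unfold fracEnergy
      rw [← ENNReal.tsum_mul_left, ← ENNReal.tsum_mul_left, ← ENNReal.tsum_add]
      refine ENNReal.tsum_le_tsum fun j => ?_
      have hm : ∀ u : ℝ → X, MemLp u 2 (volume.restrict (Ioo a b)) → Measurable fun ξ : ℝ =>
          ENNReal.ofReal (|2 * Real.pi * ξ| ^ (2 * α)) * ‖𝓕 (coordFun e a b u j) ξ‖ₑ ^ 2 := by
        intro u hu
        have := (fourier_continuous (coord_integrable e hu j)).measurable
        fun_prop
      rw [← lintegral_const_mul _ (hm v hv), ← lintegral_const_mul _ (hm w hw),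
        ← lintegral_add_left ((hm v hv).const_mul 2)]
      refine lintegral_mono fun ξ => ?_
      rw [coordFun_add, fourier_add' (coord_integrable e hv j) (coord_integrable e hw j)]
      calc _ ≤ ENNReal.ofReal (|2 * Real.pi * ξ| ^ (2 * α)) *
            (2 * ‖𝓕 (coordFun e a b v j) ξ‖ₑ ^ 2 + 2 * ‖𝓕 (coordFun e a b w j) ξ‖ₑ ^ 2) := by
              gcongr; exact enorm_add_sq_le _ _
        _ = _ := by ring
    exact key.trans_lt (ENNReal.add_lt_top.2
      ⟨ENNReal.mul_lt_top (by simp) hv', ENNReal.mul_lt_top (by simp) hw'⟩)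
  smul_mem' := by
    rintro c v ⟨hv, hv'⟩
    refine ⟨hv.const_smul c, ?_⟩
    have key : fracEnergy e α a b (c • v) = ‖(c : ℂ)‖ₑ ^ 2 * fracEnergy e α a b v := by
      unfold fracEnergy
      rw [← ENNReal.tsum_mul_left]
      refine tsum_congr fun j => ?_
      rw [← lintegral_const_mul' _ _ (by simp)]
      refine lintegral_congr fun ξ => ?_
      rw [coordFun_smul, fourier_smul', Pi.smul_apply, smul_eq_mul, enorm_mul]
      ring
    show fracEnergy e α a b (c • v) < ⊤
    rw [key]
    exact ENNReal.mul_lt_top (by simp) hv'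

/-- The space `H^{-α}(a,b;X)`: linear functionals on `H^α(a,b;X)` that are bounded with respect to
the norm `|·|_{H^α(a,b;X)}`. -/
def FracDual (e : HilbertBasis ℕ ℝ X) (α a b : ℝ) :
    Submodule ℝ (Module.Dual ℝ (FracSpace e α a b)) where
  carrier := {F | ∃ C, ∀ v : FracSpace e α a b, |F v| ≤ C * fracNorm e α a b v}
  zero_mem' := ⟨0, by simp⟩
  add_mem' := by
    rintro F G ⟨C, hC⟩ ⟨D, hD⟩
    refine ⟨C + D, fun v => ?_⟩
    rw [LinearMap.add_apply, add_mul]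
    exact (abs_add_le _ _).trans (add_le_add (hC v) (hD v))
  smul_mem' := by
    rintro c F ⟨C, hC⟩
    refine ⟨|c| * C, fun v => ?_⟩
    rw [LinearMap.smul_apply, smul_eq_mul, abs_mul, mul_assoc]
    exact mul_le_mul_of_nonneg_left (hC v) (abs_nonneg c)

/-- The dual norm `‖F‖_{H^{-α}(a,b;X)}`. -/
def fracDualNorm {e : HilbertBasis ℕ ℝ X} {α a b : ℝ} (F : FracDual e α a b) : ℝ :=
  sInf {C | 0 ≤ C ∧ ∀ v : FracSpace e α a b, |F.1 v| ≤ C * fracNorm e α a b v}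

lemma coordFun_indicator (e : HilbertBasis ℕ ℝ X) {a b c d : ℝ} (h : Ioo c d ⊆ Ioo a b)
    (v : ℝ → X) (j : ℕ) :
    coordFun e a b ((Ioo c d).indicator v) j = coordFun e c d v j := by
  funext t
  by_cases h1 : t ∈ Ioo c d
  · have := h h1
    simp [coordFun, h1, this]
  · have h2 : (Ioo c d).indicator v t = 0 := indicator_of_notMem h1 v
    simp only [coordFun, indicator_of_notMem h1]
    by_cases h3 : t ∈ Ioo a b <;> simp [h2, h3]

lemma fracEnergy_indicator (e : HilbertBasis ℕ ℝ X) (α : ℝ) {a b c d : ℝ}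
    (h : Ioo c d ⊆ Ioo a b) (v : ℝ → X) :
    fracEnergy e α a b ((Ioo c d).indicator v) = fracEnergy e α c d v := by
  simp only [fracEnergy, coordFun_indicator e h]

lemma indicator_mem (e : HilbertBasis ℕ ℝ X) {α a b c d : ℝ} (h : Ioo c d ⊆ Ioo a b)
    {v : ℝ → X} (hv : v ∈ FracSpace e α c d) :
    (Ioo c d).indicator v ∈ FracSpace e α a b := by
  refine ⟨?_, ?_⟩
  · rw [memLp_indicator_iff_restrict measurableSet_Ioo, Measure.restrict_restrict measurableSet_Ioo,
      inter_eq_self_of_subset_left h]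
    exact hv.1
  · rw [fracEnergy_indicator e α h]
    exact hv.2

/-- Extension by zero, from `H^α(a,b';X)` to `H^α(a,b;X)`. -/
def zeroExt (e : HilbertBasis ℕ ℝ X) (α a : ℝ) {b' b : ℝ} (h : b' ≤ b) :
    FracSpace e α a b' →ₗ[ℝ] FracSpace e α a b where
  toFun v := ⟨(Ioo a b').indicator v.1, indicator_mem e (Ioo_subset_Ioo_right h) v.2⟩
  map_add' v w := Subtype.ext (indicator_add (Ioo a b') v.1 w.1)
  map_smul' c v := Subtype.ext (indicator_const_smul (Ioo a b') c v.1)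

/-- The restriction of a functional in `H^{-α}(a,b;X)` to the smaller interval `(a, b')`. -/
def restrictDual {e : HilbertBasis ℕ ℝ X} {α a b' b : ℝ} (h : b' ≤ b) (F : FracDual e α a b) :
    FracDual e α a b' :=
  ⟨F.1 ∘ₗ zeroExt e α a h, by
    obtain ⟨C, hC⟩ := F.2
    refine ⟨C, fun v => (hC _).trans_eq ?_⟩
    simp only [fracNorm, zeroExt, LinearMap.coe_mk, AddHom.coe_mk,
      fracEnergy_indicator e α (Ioo_subset_Ioo_right h)]⟩

lemma mem_congr (e : HilbertBasis ℕ ℝ X) {α a b : ℝ} {v w : ℝ → X}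
    (h : v =ᵐ[volume.restrict (Ioo a b)] w) (hv : v ∈ FracSpace e α a b) :
    w ∈ FracSpace e α a b := by
  refine ⟨(memLp_congr_ae h).1 hv.1, ?_⟩
  have : fracEnergy e α a b w = fracEnergy e α a b v := by
    unfold fracEnergy
    refine tsum_congr fun j => lintegral_congr fun ξ => ?_
    rw [Real.fourier_congr_ae]
    have h' := (ae_restrict_iff' measurableSet_Ioo).1 h
    filter_upwards [h'] with t ht
    by_cases h1 : t ∈ Ioo a b
    · simp [coordFun, h1, ht h1]
    · simp only [coordFun, indicator_of_notMem h1]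
  rw [this]
  exact hv.2

lemma fourier_decay {g : ℝ → ℝ} (hg : ContDiff ℝ 1 g) {c d : ℝ} (hcd : c ≤ d) :
    ∃ D : ℝ, 0 ≤ D ∧ ∀ ξ : ℝ,
      (1 + |ξ|) * ‖𝓕 ((Ioo c d).indicator fun t => (g t : ℂ)) ξ‖ ≤ D := by
  have hg' : Continuous (deriv g) := hg.continuous_deriv le_rfl
  have hgc : Continuous g := hg.continuous
  set A : ℝ := ∫ t in c..d, |g t|
  set B : ℝ := |g c| + |g d| + ∫ t in c..d, |deriv g t|
  have hform : ∀ ξ : ℝ, 𝓕 ((Ioo c d).indicator fun t => (g t : ℂ)) ξ =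
      ∫ t in c..d, Complex.exp ((-2 * Real.pi * ξ * Complex.I : ℂ) * t) * (g t : ℂ) := by
    intro ξ
    rw [Real.fourier_real_eq_integral_exp_smul, intervalIntegral.integral_of_le hcd,
      integral_Ioc_eq_integral_Ioo, ← integral_indicator measurableSet_Ioo]
    congr 1
    funext t
    by_cases h : t ∈ Ioo c d
    · simp only [h, indicator_of_mem, smul_eq_mul]
      congr 2
      push_cast
      ring
    · simp [h]
  have hexp : ∀ ξ t : ℝ, ‖Complex.exp ((-2 * Real.pi * ξ * Complex.I : ℂ) * t)‖ = 1 := by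
    intro ξ t
    rw [Complex.norm_exp]
    simp
  have hA : ∀ ξ : ℝ, ‖𝓕 ((Ioo c d).indicator fun t => (g t : ℂ)) ξ‖ ≤ A := by
    intro ξ
    rw [hform]
    refine (intervalIntegral.norm_integral_le_integral_norm hcd).trans_eq ?_
    refine intervalIntegral.integral_congr fun t _ => ?_
    simp only [norm_mul, hexp, one_mul, Complex.norm_real, Real.norm_eq_abs]
  have hB : ∀ ξ : ℝ, |ξ| * ‖𝓕 ((Ioo c d).indicator fun t => (g t : ℂ)) ξ‖ ≤ B := by
    intro ξ
    set z : ℂ := -2 * Real.pi * ξ * Complex.I with hz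
    have hpart : z * ∫ t in c..d, Complex.exp (z * t) * (g t : ℂ) =
        Complex.exp (z * d) * g d - Complex.exp (z * c) * g c
          - ∫ t in c..d, Complex.exp (z * t) * ((deriv g t : ℝ) : ℂ) := by
      rw [intervalIntegral.integral_mul_deriv_eq_deriv_mul
        (u := fun t : ℝ => Complex.exp (z * t)) (v := fun t : ℝ => (g t : ℂ))
        (u' := fun t : ℝ => z * Complex.exp (z * t)) (v' := fun t : ℝ => ((deriv g t : ℝ) : ℂ))]
      · rw [← intervalIntegral.integral_const_mul]
        simp only [mul_assoc]
        ring
      · intro t _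
        have h1 : HasDerivAt (fun t : ℝ => z * (t : ℂ)) z t := by
          simpa using (Complex.ofRealCLM.hasDerivAt (x := t)).const_mul z
        simpa [mul_comm] using h1.cexp
      · intro t _
        exact (hg.differentiable one_ne_zero t).hasDerivAt.ofReal_comp
      · exact Continuous.intervalIntegrable (by fun_prop) _ _
      · exact Continuous.intervalIntegrable (by fun_prop) _ _
    have hnz : ‖z‖ = 2 * Real.pi * |ξ| := by
      simp [hz, abs_of_pos Real.pi_pos]
    have h1 : ‖z‖ * ‖𝓕 ((Ioo c d).indicator fun t => (g t : ℂ)) ξ‖ ≤ B := by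
      rw [hform, ← norm_mul, hpart]
      refine (norm_sub_le _ _).trans (add_le_add ((norm_sub_le _ _).trans_eq ?_) ?_)
      · rw [norm_mul, norm_mul, hexp, hexp]
        simp [add_comm]
      · refine (intervalIntegral.norm_integral_le_integral_norm hcd).trans_eq ?_
        refine intervalIntegral.integral_congr fun t _ => ?_
        simp only [norm_mul, hz, hexp, one_mul, Complex.norm_real, Real.norm_eq_abs]
    refine le_trans ?_ h1
    gcongr
    rw [hnz]
    have := Real.pi_gt_three
    nlinarith [abs_nonneg ξ]
  refine ⟨A + B, ?_, fun ξ => ?_⟩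
  · exact add_nonneg ((norm_nonneg _).trans (hA 0)) (le_trans (by positivity) (hB 0))
  · rw [add_mul, one_mul]
    exact add_le_add (hA ξ) (hB ξ)

lemma scalar_energy {g : ℝ → ℝ} (hg : ContDiff ℝ 1 g) {c d : ℝ} (hcd : c ≤ d) {α : ℝ}
    (h0 : 0 < α) (h1 : α < 1 / 2) :
    ∫⁻ ξ : ℝ, ENNReal.ofReal (|2 * Real.pi * ξ| ^ (2 * α)) *
      ‖𝓕 ((Ioo c d).indicator fun t => (g t : ℂ)) ξ‖ₑ ^ 2 < ⊤ := by
  obtain ⟨D, hD0, hD⟩ := fourier_decay hg hcd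
  have hfin : ∫⁻ ξ : ℝ, ENNReal.ofReal ((1 + ‖ξ‖) ^ (-(2 - 2 * α))) < ⊤ :=
    finite_integral_one_add_norm (by simp; linarith)
  have hle : ∀ ξ : ℝ, ENNReal.ofReal (|2 * Real.pi * ξ| ^ (2 * α)) *
      ‖𝓕 ((Ioo c d).indicator fun t => (g t : ℂ)) ξ‖ₑ ^ 2 ≤
      ENNReal.ofReal ((2 * Real.pi) ^ (2 * α) * D ^ 2) *
        ENNReal.ofReal ((1 + ‖ξ‖) ^ (-(2 - 2 * α))) := by
    intro ξ
    set y := ‖𝓕 ((Ioo c d).indicator fun t => (g t : ℂ)) ξ‖ with hy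
    rw [← ofReal_norm, ← hy, ← ENNReal.ofReal_pow (norm_nonneg _),
      ← ENNReal.ofReal_mul (by positivity), ← ENNReal.ofReal_mul (by positivity)]
    refine ENNReal.ofReal_le_ofReal ?_
    have hp : (0 : ℝ) < 1 + ‖ξ‖ := by positivity
    have e1 : |2 * Real.pi * ξ| ^ (2 * α) ≤ (2 * Real.pi) ^ (2 * α) * (1 + ‖ξ‖) ^ (2 * α) := by
      rw [← Real.mul_rpow (by positivity) hp.le]
      refine Real.rpow_le_rpow (abs_nonneg _) ?_ (by linarith)
      rw [abs_mul, abs_of_pos (by positivity : (0 : ℝ) < 2 * Real.pi)]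
      gcongr
      simp
    have e2 : y ^ 2 ≤ D ^ 2 * (1 + ‖ξ‖) ^ (-2 : ℝ) := by
      have h2 : (1 + ‖ξ‖) * y ≤ D := hD ξ
      have h3 : ((1 + ‖ξ‖) * y) ^ 2 ≤ D ^ 2 := by gcongr
      rw [Real.rpow_neg hp.le, ← div_eq_mul_inv, le_div_iff₀ (by positivity)]
      norm_cast
      calc _ = ((1 + ‖ξ‖) * y) ^ 2 := by ring
        _ ≤ _ := h3
    calc _ ≤ ((2 * Real.pi) ^ (2 * α) * (1 + ‖ξ‖) ^ (2 * α)) *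
          (D ^ 2 * (1 + ‖ξ‖) ^ (-2 : ℝ)) := by gcongr
      _ = (2 * Real.pi) ^ (2 * α) * D ^ 2 * ((1 + ‖ξ‖) ^ (2 * α) * (1 + ‖ξ‖) ^ (-2 : ℝ)) := by ring
      _ = _ := by
        rw [← Real.rpow_add hp]
        congr 2
        ring
  refine (lintegral_mono hle).trans_lt ?_
  rw [lintegral_const_mul' _ _ ENNReal.ofReal_ne_top]
  exact ENNReal.mul_lt_top ENNReal.ofReal_lt_top hfin

/-- Functions `t ↦ g(t) x` with `g` continuously differentiable lie in `H^α(c,d;X)`. -/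
lemma smooth_smul_mem (e : HilbertBasis ℕ ℝ X) {g : ℝ → ℝ} (hg : ContDiff ℝ 1 g) (x : X)
    {c d : ℝ} (hcd : c ≤ d) {α : ℝ} (h0 : 0 < α) (h1 : α < 1 / 2) :
    (fun t => g t • x) ∈ FracSpace e α c d := by
  have hgc : Continuous g := hg.continuous
  refine ⟨?_, ?_⟩
  · refine MemLp.mono_measure (Measure.restrict_mono Ioo_subset_Icc_self le_rfl) ?_
    obtain ⟨B, hB⟩ := isCompact_Icc.exists_bound_of_continuousOn
      ((hgc.smul (continuous_const (y := x))).continuousOn (s := Icc c d))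
    refine MemLp.of_bound (hgc.smul continuous_const).aestronglyMeasurable B ?_
    exact (ae_restrict_iff' measurableSet_Icc).2 (Filter.Eventually.of_forall hB)
  · have hcoord : ∀ j, coordFun e c d (fun t => g t • x) j =
        ((inner ℝ (e j) x : ℝ) : ℂ) • ((Ioo c d).indicator fun t => (g t : ℂ)) := by
      intro j
      funext t
      by_cases h : t ∈ Ioo c d
      · simp [coordFun, h, inner_smul_right, mul_comm]
      · simp [coordFun, h]
    have hE : fracEnergy e α c d (fun t => g t • x) =
        (∑' j, ‖((inner ℝ (e j) x : ℝ) : ℂ)‖ₑ ^ 2) *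
          ∫⁻ ξ : ℝ, ENNReal.ofReal (|2 * Real.pi * ξ| ^ (2 * α)) *
            ‖𝓕 ((Ioo c d).indicator fun t => (g t : ℂ)) ξ‖ₑ ^ 2 := by
      unfold fracEnergy
      rw [← ENNReal.tsum_mul_right]
      refine tsum_congr fun j => ?_
      rw [← lintegral_const_mul' _ _ (by simp)]
      refine lintegral_congr fun ξ => ?_
      rw [hcoord, fourier_smul', Pi.smul_apply, smul_eq_mul, enorm_mul]
      ring
    rw [hE]
    refine ENNReal.mul_lt_top ?_ (scalar_energy hg hcd h0 h1)
    have hs : Summable fun j => ‖(inner ℝ (e j) x : ℝ)‖ ^ 2 := by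
      have := e.summable_inner_mul_inner x x
      refine this.congr fun j => ?_
      rw [real_inner_comm x (e j), Real.norm_eq_abs, sq_abs, sq]
    have h2 := hs.tsum_ofReal_lt_top
    refine lt_of_eq_of_lt (tsum_congr fun j => ?_) h2
    rw [ENNReal.ofReal_pow (norm_nonneg _), ← ofReal_norm, Complex.norm_real]

/-- `V` is, on each of the `J` open intervals of the grid `t`, a polynomial with values in `Y` of
degree less than `q`. -/
def IsPiecewisePoly {Y : Type*} [AddCommGroup Y] [Module ℝ Y] (t : ℕ → ℝ) (J q : ℕ)
    (V : ℝ → Y) : Prop :=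
  ∀ j < J, ∃ c : ℕ → Y, ∀ s ∈ Ioo (t j) (t (j + 1)), V s = ∑ k ∈ Finset.range q, s ^ k • c k

lemma IsPiecewisePoly.map {Y Z : Type*} [AddCommGroup Y] [Module ℝ Y] [AddCommGroup Z]
    [Module ℝ Z] {t : ℕ → ℝ} {J q : ℕ} {V : ℝ → Y} (hV : IsPiecewisePoly t J q V)
    (L : Y →ₗ[ℝ] Z) : IsPiecewisePoly t J q fun s => L (V s) := by
  intro j hj
  obtain ⟨c, hc⟩ := hV j hj
  exact ⟨fun k => L (c k), fun s hs => by simp [hc s hs, map_sum]⟩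

lemma mem_of_piecewisePoly (e : HilbertBasis ℕ ℝ X) {t : ℕ → ℝ} (ht : Monotone t) {J q : ℕ}
    {V : ℝ → X} (hV : IsPiecewisePoly t J q V) {α : ℝ} (h0 : 0 < α) (h1 : α < 1 / 2) :
    V ∈ FracSpace e α (t 0) (t J) := by
  choose! c hc using hV
  have hmem : (∑ j ∈ Finset.range J, (Ioo (t j) (t (j + 1))).indicator
      (∑ k ∈ Finset.range q, fun s : ℝ => s ^ k • c j k)) ∈ FracSpace e α (t 0) (t J) := by
    refine Submodule.sum_mem _ fun j hj => ?_
    refine indicator_mem e (Ioo_subset_Ioo (ht (Nat.zero_le j))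
      (ht (Finset.mem_range.1 hj))) ?_
    exact Submodule.sum_mem _ fun k _ =>
      smooth_smul_mem e (contDiff_id.pow k) (c j k) (ht (Nat.le_succ j)) h0 h1
  refine mem_congr e ?_ hmem
  have hnodes : ∀ᵐ s ∂(volume : Measure ℝ), s ∉ range t :=
    measure_eq_zero_iff_ae_notMem.1 ((countable_range t).measure_zero volume)
  refine (ae_restrict_iff' measurableSet_Ioo).2 ?_
  filter_upwards [hnodes] with s hs hsI
  have hex : ∀ N, s < t N → ∃ i < N, s ∈ Ioo (t i) (t (i + 1)) := by
    intro N
    induction N with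
    | zero => intro h; exact absurd hsI.1 h.le.not_gt
    | succ N ih =>
      intro h
      rcases lt_trichotomy s (t N) with h2 | h2 | h2
      · obtain ⟨i, hi, hi'⟩ := ih h2
        exact ⟨i, hi.trans (Nat.lt_succ_self N), hi'⟩
      · exact absurd ⟨N, h2.symm⟩ hs
      · exact ⟨N, Nat.lt_succ_self N, h2, h⟩
  obtain ⟨i, hi, hi'⟩ := hex J hsI.2
  rw [Finset.sum_apply, Finset.sum_eq_single i]
  · rw [indicator_of_mem hi', hc i hi s hi', Finset.sum_apply]
  · intro j _ hji
    refine indicator_of_notMem (fun hj => ?_) _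
    rcases lt_or_gt_of_ne hji with h | h
    · exact absurd (hj.2.trans_le (ht h)) hi'.1.not_gt
    · exact absurd (hi'.2.trans_le (ht h)) hj.1.not_gt
  · intro h
    exact absurd (Finset.mem_range.2 hi) h

/-- The grid points `t_j = (j / J)^σ T`. -/
def gridPoint (T σ : ℝ) (J j : ℕ) : ℝ := ((j : ℝ) / J) ^ σ * T

lemma gridPoint_mono {T σ : ℝ} (hT : 0 < T) (hσ : 1 ≤ σ) (J : ℕ) :
    Monotone (gridPoint T σ J) := by
  intro i j h
  unfold gridPoint
  have : 0 ≤ σ := by linarith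
  gcongr

lemma gridPoint_zero {T σ : ℝ} (hσ : 1 ≤ σ) (J : ℕ) : gridPoint T σ J 0 = 0 := by
  have : σ ≠ 0 := by linarith
  simp [gridPoint, Real.zero_rpow this]

lemma gridPoint_last {T σ : ℝ} {J : ℕ} (hJ : 1 ≤ J) : gridPoint T σ J J = T := by
  have : (J : ℝ) ≠ 0 := by positivity
  simp [gridPoint, this]

lemma gridPoint_le {T σ : ℝ} (hT : 0 < T) (hσ : 1 ≤ σ) {J j : ℕ} (hJ : 1 ≤ J) (hj : j ≤ J) :
    gridPoint T σ J j ≤ T :=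
  (gridPoint_mono hT hσ J hj).trans_eq (gridPoint_last hJ)

/-- A smooth function with compact support contained in `D`. -/
def IsTestFun {E : Type*} [NormedAddCommGroup E] [NormedSpace ℝ E] (D : Set E) (φ : E → ℝ) :
    Prop :=
  ContDiff ℝ ∞ φ ∧ HasCompactSupport φ ∧ tsupport φ ⊆ D

/-- The Riemann-Liouville fractional integral `I_{0+}^β w`. -/
def rlIntegral (β : ℝ) (w : ℝ → X) (t : ℝ) : X :=
  (Real.Gamma β)⁻¹ • ∫ s in (0 : ℝ)..t, (t - s) ^ (β - 1) • w s

/-- For `1 < γ < 2`, the Riemann-Liouville derivative `D_{0+}^γ w = D² I_{0+}^{2-γ} w` as an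
`X`-valued distribution on `(0, T)`, applied to the test function `φ`. -/
def rlDeriv (γ T : ℝ) (w : ℝ → X) (φ : ℝ → ℝ) : X :=
  ∫ t in (0 : ℝ)..T, iteratedDeriv 2 φ t • rlIntegral (2 - γ) w t

/-- The functional `F ∈ H^{-α}(0,T;X)` is the distribution `D_{0+}^γ w`, that is,
`⟨F, φ x⟩ = (⟨D_{0+}^γ w, φ⟩, x)_X` for all `φ ∈ C_0^∞(0,T)` and `x ∈ X`. As the products `φ x`
span a dense subspace of `H^α(0,T;X)` for `0 < α < 1/2`, there is at most one such `F`. -/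
def EqRLDeriv {e : HilbertBasis ℕ ℝ X} {α T : ℝ} (h0 : 0 < α) (h1 : α < 1 / 2) (hT : 0 < T)
    (F : FracDual e α 0 T) (γ : ℝ) (w : ℝ → X) : Prop :=
  ∀ (φ : ℝ → ℝ) (hφ : IsTestFun (Ioo 0 T) φ) (x : X),
    F.1 ⟨fun t => φ t • x,
      smooth_smul_mem e (hφ.1.of_le (by exact_mod_cast le_top)) x hT.le h0 h1⟩ =
      inner ℝ (rlDeriv γ T w φ) x

end Time

/-! ### Sobolev and finite element spaces on the domain -/

section Space

variable {d : ℕ}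

/-- The space `L²(Ω)`. -/
abbrev L2 (Ω : Set (EuclideanSpace ℝ (Fin d))) := Lp ℝ 2 (volume.restrict Ω)

/-- The space `L²(Ω; ℝ^d)`. -/
abbrev L2Vec (Ω : Set (EuclideanSpace ℝ (Fin d))) :=
  Lp (EuclideanSpace ℝ (Fin d)) 2 (volume.restrict Ω)

/-- The space `H_0^1(Ω)`, the closure of `C_0^∞(Ω)` in the `H^1` norm. An element is represented
by the pair `(v, ∇v)`; the second component is the weak gradient of the first one, and so is
determined by it. -/
def H01 (Ω : Set (EuclideanSpace ℝ (Fin d))) : Submodule ℝ (L2 Ω × L2Vec Ω) :=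
  (Submodule.span ℝ {p | ∃ φ : EuclideanSpace ℝ (Fin d) → ℝ, IsTestFun Ω φ ∧
    p.1 =ᵐ[volume.restrict Ω] φ ∧ p.2 =ᵐ[volume.restrict Ω] ∇ φ}).topologicalClosure

/-- `g` is the weak gradient of `v` in `Ω`. -/
def HasWeakGrad {Ω : Set (EuclideanSpace ℝ (Fin d))} (v : L2 Ω) (g : L2Vec Ω) : Prop :=
  ∀ φ : EuclideanSpace ℝ (Fin d) → ℝ, IsTestFun Ω φ →
    ∫ x in Ω, v x • ∇ φ x = -∫ x in Ω, φ x • g x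

/-- `𝒦` is a (conforming) triangulation of `Ω` into finitely many closed `d`-simplices, each of
which is given by its set of vertices. -/
structure IsTriangulation (Ω : Set (EuclideanSpace ℝ (Fin d)))
    (𝒦 : Finset (Finset (EuclideanSpace ℝ (Fin d)))) : Prop where
  card_eq : ∀ K ∈ 𝒦, K.card = d + 1
  affineIndependent : ∀ K ∈ 𝒦,
    AffineIndependent ℝ ((↑) : K → EuclideanSpace ℝ (Fin d))
  inter_eq : ∀ K ∈ 𝒦, ∀ L ∈ 𝒦,
    convexHull ℝ (K : Set (EuclideanSpace ℝ (Fin d))) ∩ convexHull ℝ (L : Set _) =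
      convexHull ℝ ((K : Set _) ∩ (L : Set _))
  interior_subset : ∀ K ∈ 𝒦,
    interior (convexHull ℝ (K : Set (EuclideanSpace ℝ (Fin d)))) ⊆ Ω
  cover : ⋃ K ∈ 𝒦, convexHull ℝ (K : Set (EuclideanSpace ℝ (Fin d))) = closure Ω

/-- The functions in `L²(Ω)` whose restriction to each `K ∈ 𝒦` is a polynomial of degree `≤ n`. -/
def piecewisePoly (Ω : Set (EuclideanSpace ℝ (Fin d)))
    (𝒦 : Finset (Finset (EuclideanSpace ℝ (Fin d)))) (n : ℕ) : Submodule ℝ (L2 Ω) where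
  carrier := {v | ∀ K ∈ 𝒦, ∃ p : MvPolynomial (Fin d) ℝ, p.totalDegree ≤ n ∧
    ∀ᵐ x ∂(volume.restrict Ω), x ∈ convexHull ℝ (K : Set (EuclideanSpace ℝ (Fin d))) →
      v x = MvPolynomial.eval (fun i => x i) p}
  zero_mem' := fun K _ => ⟨0, by simp, by
    filter_upwards [Lp.coeFn_zero ℝ 2 (volume.restrict Ω)] with x hx _
    rw [map_zero]
    exact hx⟩
  add_mem' := fun {v w} hv hw K hK => by
    obtain ⟨p, hp, hp'⟩ := hv K hK
    obtain ⟨q, hq, hq'⟩ := hw K hK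
    refine ⟨p + q, (MvPolynomial.totalDegree_add p q).trans (max_le hp hq), ?_⟩
    filter_upwards [hp', hq', Lp.coeFn_add v w] with x h1 h2 h3 hx
    rw [map_add, ← h1 hx, ← h2 hx]
    exact h3
  smul_mem' := fun c v hv K hK => by
    obtain ⟨p, hp, hp'⟩ := hv K hK
    refine ⟨c • p, (MvPolynomial.totalDegree_smul_le c p).trans hp, ?_⟩
    filter_upwards [hp', Lp.coeFn_smul c v] with x h1 h3 hx
    rw [MvPolynomial.smul_eval, ← h1 hx]
    exact h3

variable (Ω : Set (EuclideanSpace ℝ (Fin d)))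
  (𝒦 : Finset (Finset (EuclideanSpace ℝ (Fin d)))) (n : ℕ)

/-- The finite element space `S_h ⊆ H_0^1(Ω)`. -/
def Sh : Submodule ℝ (L2 Ω × L2Vec Ω) :=
  H01 Ω ⊓ (piecewisePoly Ω 𝒦 n).comap (LinearMap.fst ℝ (L2 Ω) (L2Vec Ω))

/-- The finite element space `Σ_h ⊆ H^1(Ω)`, as a set of functions in `L²(Ω)`. -/
def SigmaH : Set (L2 Ω) := {v | (∃ g, HasWeakGrad v g) ∧ v ∈ piecewisePoly Ω 𝒦 n}

variable {Ω 𝒦 n}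

/-- The underlying function in `L²(Ω)` of an element of `S_h`. -/
def fn : Sh Ω 𝒦 n →ₗ[ℝ] L2 Ω := LinearMap.fst ℝ (L2 Ω) (L2Vec Ω) ∘ₗ (Sh Ω 𝒦 n).subtype

/-- The gradient of an element of `S_h`. -/
def grad : Sh Ω 𝒦 n →ₗ[ℝ] L2Vec Ω := LinearMap.snd ℝ (L2 Ω) (L2Vec Ω) ∘ₗ (Sh Ω 𝒦 n).subtype

/-- `r = R_h v`. -/
def IsRitzProj (v : H01 Ω) (r : Sh Ω 𝒦 n) : Prop :=
  ∀ w : Sh Ω 𝒦 n, inner ℝ (v.1.2 - grad r) (grad w) = 0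

variable (𝒦 n) in
/-- `p = Π_h v`, the `L²(Ω)`-orthogonal projection of `v` onto `Σ_h`. -/
def IsL2Proj (v p : L2 Ω) : Prop :=
  p ∈ SigmaH Ω 𝒦 n ∧ ∀ w ∈ SigmaH Ω 𝒦 n, inner ℝ (v - p) w = 0

/-! ### The discrete problem -/

/-- `U ∈ M_{h,τ}`: the function `U` is continuous on `[0,T]` with values in `S_h`, and a polynomial
of degree `≤ m` on each interval of the grid. -/
def IsTrial (T σ : ℝ) (J m : ℕ) (U : ℝ → Sh Ω 𝒦 n) : Prop :=
  ContinuousOn U (Icc 0 T) ∧ IsPiecewisePoly (gridPoint T σ J) J (m + 1) U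

/-- `V ∈ W_{h,τ}`: the function `V` takes values in `S_h` and is a polynomial of degree `≤ m - 1` on
each interval of the grid. -/
def IsTest (T σ : ℝ) (J m : ℕ) (V : ℝ → Sh Ω 𝒦 n) : Prop :=
  IsPiecewisePoly (gridPoint T σ J) J m V

lemma IsTest.mem {T σ : ℝ} {J m : ℕ} {V : ℝ → Sh Ω 𝒦 n} (hV : IsTest T σ J m V)
    (e : HilbertBasis ℕ ℝ (L2 Ω)) {α : ℝ} (h0 : 0 < α) (h1 : α < 1 / 2) (hT : 0 < T)
    (hσ : 1 ≤ σ) (hJ : 1 ≤ J) : (fun t => fn (V t)) ∈ FracSpace e α 0 T := by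
  have h := mem_of_piecewisePoly e (gridPoint_mono hT hσ J)
    (IsPiecewisePoly.map (show IsPiecewisePoly (gridPoint T σ J) J m V from hV) fn) h0 h1
  rwa [gridPoint_zero hσ, gridPoint_last hJ] at h

lemma gamma0_pos {γ : ℝ} (hγ : 1 < γ) : 0 < (γ - 1) / 2 := by linarith

lemma gamma0_lt {γ : ℝ} (hγ : γ < 2) : (γ - 1) / 2 < 1 / 2 := by linarith

/-- `U` is a solution of the discrete problem: `U ∈ M_{h,τ}`, `U(0) = R_h u₀`, and
`⟨D_{0+}^γ (U - U(0) - t Π_h u₁), V⟩ + ∫_0^T (∇U, ∇V)_{L²(Ω)} dt = ⟨f, V⟩` for all `V ∈ W_{h,τ}`,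
with the duality pairing between `H^{-γ₀}(0,T;L²(Ω))` and `H^{γ₀}(0,T;L²(Ω))`,
`γ₀ = (γ - 1) / 2`. -/
def IsDiscreteSolution {e : HilbertBasis ℕ ℝ (L2 Ω)} {γ T σ : ℝ} {J : ℕ} (hγ : 1 < γ)
    (hγ' : γ < 2) (hT : 0 < T) (hσ : 1 ≤ σ) (hJ : 1 ≤ J) (m : ℕ) (u₀ : H01 Ω) (u₁ : L2 Ω)
    (f : FracDual e ((γ - 1) / 2) 0 T) (U : ℝ → Sh Ω 𝒦 n) : Prop :=
  IsTrial T σ J m U ∧ IsRitzProj u₀ (U 0) ∧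
  ∃ (p : L2 Ω) (F : FracDual e ((γ - 1) / 2) 0 T), IsL2Proj 𝒦 n u₁ p ∧
    EqRLDeriv (gamma0_pos hγ) (gamma0_lt hγ') hT F γ (fun t => fn (U t) - fn (U 0) - t • p) ∧
    ∀ (V : ℝ → Sh Ω 𝒦 n) (hV : IsTest T σ J m V),
      F.1 ⟨_, hV.mem e (gamma0_pos hγ) (gamma0_lt hγ') hT hσ hJ⟩ +
        ∫ t in (0 : ℝ)..T, inner ℝ (grad (U t)) (grad (V t)) =
      f.1 ⟨_, hV.mem e (gamma0_pos hγ) (gamma0_lt hγ') hT hσ hJ⟩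

end Space

end FracWave

end

noncomputable section

namespace FracWave

/-! The estimate is an energy estimate. Since `U'` has degree at most `m - 1` in time and test
functions may jump at the nodes, `χ_{(0,t_j)} U'` is an admissible test function. The gradient term
then integrates exactly to `½‖∇U(t_j)‖² - ½‖∇U(0)‖²`, and it remains to see that the fractional term
controls `|U'|²`.

On the Fourier side, the derivative `D_{0+}^γ` of the primitive of `g` is multiplication of `ĝ` by
`(2πiξ)^{γ-1}` (`rlDeriv_primitive`): after damping by `e^{-εt}` both the primitive and the
fractional integral are convolutions with integrable kernels, and `ε → 0` at the end. Giving half of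
the symbol to each argument yields a bilinear form `fracForm` on `H^{γ₀}` that is bounded by the
product of the two norms (`abs_fracForm_le`) and has diagonal `cos(πγ₀)|v|²` (`fracForm_self`),
where the cosine is positive because `γ₀ < 1/2`. Causality (`fracForm_eq_zero_of_support`) allows
`U' - Π_h u₁` to be replaced by its truncation to `(0, t_j)`, which makes the estimate local in time
(`IsWeakSolution.energy_le`).

The fractional derivative of a discrete solution is known only through its values on smooth test
functions, whereas the scheme pairs it with discontinuous piecewise polynomials. This gap is closed
by density: for exponents below `1/2` a truncated smooth function is a limit of smooth cutoffs of it
(`tendsto_scalarEnergy_cutoff`), so all functionals representing the same distribution agree with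
`fracForm` on the test space (`EqRLDeriv.eq_on_piecewisePoly`).

The truncated constant `Π_h u₁` has a norm proportional to `t_j^{1/2-γ₀}` by scaling
(`exists_fracNorm_const_eq`), and Young's inequality (`add_le_of_energy`) finishes the bound. With
zero data the same estimate gives uniqueness. Written for the unknown `u = U'`, the scheme is a
square linear system, so uniqueness gives existence (`exists_isWeakSolution`). From the spatial
discretization only a few facts enter: `S_h` is finite-dimensional, its elements are determined by
the function alone (`fn_injective`) and by the gradient alone (`grad_injective`), and both
projections exist and are contractions. -/

/-! ### The Laplace transform of powers and the damped kernel -/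

open Filter Topology in
/-- The Laplace transform of `t ↦ t ^ (β - 1)` in the right half-plane. -/
lemma integral_rpow_mul_cexp_neg_mul {β : ℝ} (hβ : 0 < β) {r : ℂ} (hr : 0 < r.re) :
    ∫ t in Ioi (0 : ℝ), ((t ^ (β - 1) : ℝ) : ℂ) * Complex.exp (-(r * t)) =
      r ^ (-β : ℂ) * (Real.Gamma β : ℂ) := by
  set H : Set ℂ := {z | 0 < z.re} with hH
  have hHo : IsOpen H := isOpen_lt continuous_const Complex.continuous_re
  have hHc : Convex ℝ H := convex_halfSpace_re_gt 0
  have hnorm : ∀ (z : ℂ) (s t : ℝ), 0 < t → ‖((t ^ s : ℝ) : ℂ) * Complex.exp (-(z * t))‖ =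
      t ^ s * Real.exp (-z.re * t ^ (1 : ℝ)) := by
    intro z s t ht
    rw [norm_mul, Complex.norm_real, Complex.norm_exp, Real.norm_of_nonneg (by positivity)]
    simp
  have hmeas : ∀ (z : ℂ) (s : ℝ), AEStronglyMeasurable
      (fun t : ℝ => ((t ^ s : ℝ) : ℂ) * Complex.exp (-(z * t))) (volume.restrict (Ioi 0)) := by
    intro z s
    exact Measurable.aestronglyMeasurable (by fun_prop)
  have hint : ∀ (z : ℂ) (s : ℝ), 0 < z.re → -1 < s → IntegrableOn
      (fun t : ℝ => ((t ^ s : ℝ) : ℂ) * Complex.exp (-(z * t))) (Ioi 0) := by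
    intro z s hz hs
    refine (integrableOn_rpow_mul_exp_neg_mul_rpow hs one_pos hz).mono' (hmeas z s) ?_
    exact (ae_restrict_iff' measurableSet_Ioi).2 (Eventually.of_forall fun t ht =>
      (hnorm z s t ht).le)
  have hdiff : DifferentiableOn ℂ (fun z : ℂ => ∫ t in Ioi (0 : ℝ),
      ((t ^ (β - 1) : ℝ) : ℂ) * Complex.exp (-(z * t))) H := by
    intro z hz
    have hz' : 0 < z.re := hz
    refine DifferentiableAt.differentiableWithinAt ?_
    have hs : {w : ℂ | z.re / 2 < w.re} ∈ 𝓝 z :=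
      (isOpen_lt continuous_const Complex.continuous_re).mem_nhds
        (show z.re / 2 < z.re by linarith)
    -- Differentiating in `z` brings down a factor `t`; on the half-plane `Re w > Re z / 2` the
    -- derivative is dominated by `t^β e^{-(Re z / 2) t}`.
    refine (hasDerivAt_integral_of_dominated_loc_of_deriv_le
      (F := fun (w : ℂ) (t : ℝ) => ((t ^ (β - 1) : ℝ) : ℂ) * Complex.exp (-(w * t)))
      (F' := fun (w : ℂ) (t : ℝ) => ((t ^ (β - 1) : ℝ) : ℂ) * (Complex.exp (-(w * t)) * (-t)))
      (bound := fun t => t ^ β * Real.exp (-(z.re / 2) * t ^ (1 : ℝ))) hs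
      (Eventually.of_forall fun w => hmeas w _) (hint z _ hz (by linarith)) ?_ ?_
      (integrableOn_rpow_mul_exp_neg_mul_rpow (by linarith) one_pos (by linarith)) ?_).2
      |>.differentiableAt
    · exact Measurable.aestronglyMeasurable (by fun_prop)
    · refine (ae_restrict_iff' measurableSet_Ioi).2 (Eventually.of_forall fun t ht w hw => ?_)
      have ht' : (0 : ℝ) < t := ht
      have hw' : z.re / 2 < w.re := hw
      rw [← mul_assoc, norm_mul, hnorm w _ t ht', norm_neg, Complex.norm_real,
        Real.norm_of_nonneg ht'.le]
      have : t ^ β = t ^ (β - 1) * t := by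
        rw [← Real.rpow_add_one ht'.ne']; ring_nf
      rw [this]
      simp only [Real.rpow_one]
      have h2 : Real.exp (-w.re * t) ≤ Real.exp (-(z.re / 2) * t) := by
        apply Real.exp_le_exp.2; nlinarith
      calc t ^ (β - 1) * Real.exp (-w.re * t) * t
          ≤ t ^ (β - 1) * Real.exp (-(z.re / 2) * t) * t := by gcongr
        _ = _ := by ring
    · refine Eventually.of_forall fun t w _ => ?_
      have h1 : HasDerivAt (fun w : ℂ => -(w * (t : ℂ))) (-(t : ℂ)) w := by
        exact ((hasDerivAt_mul_const (t : ℂ)).neg :)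
      exact h1.cexp.const_mul _
  have hdiff2 : DifferentiableOn ℂ (fun z : ℂ => z ^ (-β : ℂ) * (Real.Gamma β : ℂ)) H := by
    intro z hz
    refine DifferentiableAt.differentiableWithinAt ?_
    exact ((differentiableAt_id).cpow_const (Or.inl hz)).mul_const _
  have hone : (1 : ℂ) ∈ H := by simp [hH]
  -- Identity theorem: both sides are holomorphic on the half-plane and agree, by the real Gamma
  -- integral, on the positive reals, which accumulate at `1`.
  refine (hdiff.analyticOnNhd hHo).eqOn_of_preconnected_of_frequently_eq
    (hdiff2.analyticOnNhd hHo) hHc.isPreconnected hone ?_ hr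
  have htend : Tendsto (fun t : ℝ => (t : ℂ)) (𝓝[≠] (1 : ℝ)) (𝓝[≠] (1 : ℂ)) := by
    refine tendsto_nhdsWithin_of_tendsto_nhds_of_eventually_within _ ?_ ?_
    · exact (Complex.continuous_ofReal.tendsto' 1 1 (by simp)).mono_left nhdsWithin_le_nhds
    · filter_upwards [self_mem_nhdsWithin] with t ht
      simpa using ht
  refine htend.frequently (Eventually.frequently ?_)
  have : Ioi (0 : ℝ) ∈ 𝓝[≠] (1 : ℝ) := mem_nhdsWithin_of_mem_nhds (Ioi_mem_nhds one_pos)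
  filter_upwards [this] with x hx
  have hx' : (0 : ℝ) < x := hx
  have h := Real.integral_rpow_mul_exp_neg_mul_Ioi hβ hx'
  have h2 := congrArg (fun y : ℝ => (y : ℂ)) h
  simp only [← integral_complex_ofReal] at h2
  push_cast at h2
  rw [← Complex.ofReal_neg, ← Complex.ofReal_cpow hx'.le, Real.rpow_neg hx'.le,
    ← Real.inv_rpow hx'.le, ← one_div, ← Complex.ofReal_mul, ← h, ← integral_complex_ofReal]
  push_cast
  rfl

/-- The kernel `e^{-εt} t^{β-1} / Γ(β)` of the damped fractional integral. -/
def rlKernel (ε β : ℝ) : ℝ → ℂ :=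
  (Ioi 0).indicator fun t => (((Real.Gamma β)⁻¹ * t ^ (β - 1) * Real.exp (-(ε * t)) : ℝ) : ℂ)

lemma rlKernel_integrable {ε β : ℝ} (hε : 0 < ε) (hβ : 0 < β) : Integrable (rlKernel ε β) := by
  unfold rlKernel
  rw [integrable_indicator_iff measurableSet_Ioi]
  have h := integrableOn_rpow_mul_exp_neg_mul_rpow (by linarith : -1 < β - 1) one_pos hε
  have h' := h.const_mul (Real.Gamma β)⁻¹
  simp only [Real.rpow_one, ← mul_assoc, neg_mul] at h'
  exact h'.ofReal

/-- The Fourier integral is the Laplace transform at `r = ε + 2πiξ`, and the damping is what puts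
this point in the open right half-plane. -/
lemma fourier_rlKernel {ε β : ℝ} (hε : 0 < ε) (hβ : 0 < β) (ξ : ℝ) :
    𝓕 (rlKernel ε β) ξ = (ε + 2 * Real.pi * ξ * Complex.I : ℂ) ^ (-β : ℂ) := by
  have hre : 0 < (ε + 2 * Real.pi * ξ * Complex.I : ℂ).re := by simpa using hε
  have h := integral_rpow_mul_cexp_neg_mul hβ hre
  have hG : (Real.Gamma β : ℂ) ≠ 0 := by exact_mod_cast (Real.Gamma_pos_of_pos hβ).ne'
  rw [eq_comm, ← eq_mul_inv_iff_mul_eq₀ hG] at h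
  rw [h, Real.fourier_real_eq_integral_exp_smul, ← integral_mul_const,
    ← integral_indicator measurableSet_Ioi]
  refine integral_congr_ae (Filter.Eventually.of_forall fun t => ?_)
  by_cases ht : t ∈ Ioi (0 : ℝ)
  · simp only [rlKernel, indicator_of_mem ht, smul_eq_mul]
    push_cast
    have : Complex.exp (-((ε + 2 * Real.pi * ξ * Complex.I) * t)) =
        Complex.exp (-2 * Real.pi * t * ξ * Complex.I) * Complex.exp (-(ε * t)) := by
      rw [← Complex.exp_add]; ring_nf
    rw [this]
    ring
  · simp [rlKernel, indicator_of_notMem ht]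

/-! ### Riemann-Liouville integrals of continuous functions -/

section RL

variable {X : Type*} [NormedAddCommGroup X] [InnerProductSpace ℝ X]

lemma intervalIntegrable_rlIntegrand {β : ℝ} (hβ : 0 < β) {w : ℝ → X} {t : ℝ} (ht : 0 ≤ t)
    (hw : ContinuousOn w (Icc 0 t)) :
    IntervalIntegrable (fun s => (t - s) ^ (β - 1) • w s) volume 0 t := by
  have h1 : IntervalIntegrable (fun s : ℝ => (t - s) ^ (β - 1)) volume 0 t := by
    have := (intervalIntegral.intervalIntegrable_rpow' (a := 0) (b := t)
      (by linarith : -1 < β - 1)).comp_sub_left t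
    simpa using this.symm
  exact h1.smul_continuousOn (by rwa [uIcc_of_le ht])

/-- Substituting `s = t r` fixes the domain and the singular kernel, so that `t` enters only through
`t^β` and the argument of `w`. Continuity in `t` then follows by dominated convergence. -/
lemma rlIntegral_eq_scaled {β : ℝ} (hβ : 0 < β) (w : ℝ → X) {t : ℝ} (ht : 0 ≤ t) :
    rlIntegral β w t =
      (Real.Gamma β)⁻¹ • t ^ β • ∫ r in (0 : ℝ)..1, (1 - r) ^ (β - 1) • w (t * r) := by
  unfold rlIntegral
  rcases ht.eq_or_lt with rfl | ht
  · simp [Real.zero_rpow hβ.ne']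
  congr 1
  have h := intervalIntegral.integral_comp_mul_left (a := 0) (b := 1)
    (fun s => (t - s) ^ (β - 1) • w s) ht.ne'
  rw [mul_zero, mul_one, eq_inv_smul_iff₀ ht.ne'] at h
  rw [← h, ← intervalIntegral.integral_smul, ← intervalIntegral.integral_smul]
  refine intervalIntegral.integral_congr fun r hr => ?_
  rw [uIcc_of_le zero_le_one] at hr
  rw [show t - t * r = t * (1 - r) by ring, Real.mul_rpow ht.le (by linarith [hr.2]),
    smul_smul, smul_smul]
  congr 1
  rw [Real.rpow_sub_one ht.ne']
  field_simp

lemma rlIntegral_congr (β : ℝ) {v w : ℝ → X} {t : ℝ} (ht : 0 ≤ t)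
    (h : ∀ s ∈ Icc 0 t, v s = w s) : rlIntegral β v t = rlIntegral β w t := by
  unfold rlIntegral
  congr 1
  refine intervalIntegral.integral_congr fun s hs => ?_
  rw [uIcc_of_le ht] at hs
  simp only [h s hs]

lemma rlDeriv_congr (γ : ℝ) {T : ℝ} (hT : 0 ≤ T) {v w : ℝ → X} (φ : ℝ → ℝ)
    (h : ∀ s ∈ Icc 0 T, v s = w s) : rlDeriv γ T v φ = rlDeriv γ T w φ := by
  unfold rlDeriv
  refine intervalIntegral.integral_congr fun t ht => ?_
  rw [uIcc_of_le hT] at ht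
  rw [rlIntegral_congr _ ht.1 fun s hs => h s ⟨hs.1, hs.2.trans ht.2⟩]

lemma continuousOn_rlIntegral {β T : ℝ} (hβ : 0 < β) (hT : 0 ≤ T) {w : ℝ → X}
    (hw : ContinuousOn w (Icc 0 T)) : ContinuousOn (rlIntegral β w) (Icc 0 T) := by
  -- The extension by constants is continuous and bounded on all of `ℝ`, so the dominated
  -- convergence argument needs no case distinctions in `t`.
  set v : ℝ → X := IccExtend hT ((Icc 0 T).domRestrict w) with hv
  have hvc : Continuous v := (continuousOn_iff_continuous_domRestrict.1 hw).Icc_extend'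
  have hvw : ∀ s ∈ Icc 0 T, w s = v s := fun s hs => by
    rw [hv, IccExtend_of_mem hT _ hs]; rfl
  obtain ⟨B, hB⟩ := isCompact_Icc.exists_bound_of_continuousOn hw
  have hvB : ∀ s, ‖v s‖ ≤ B := fun s => hB _ (projIcc 0 T hT s).2
  have key : Continuous fun t : ℝ =>
      (Real.Gamma β)⁻¹ • t ^ β • ∫ r in (0 : ℝ)..1, (1 - r) ^ (β - 1) • v (t * r) := by
    refine Continuous.const_smul (Continuous.smul
      (continuous_id.rpow_const fun _ => Or.inr hβ.le) ?_) _
    refine intervalIntegral.continuous_of_dominated_interval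
      (bound := fun r => |(1 - r) ^ (β - 1)| * B) ?_ ?_ ?_ ?_
    · intro t
      refine AEStronglyMeasurable.smul ?_ ?_
      · exact Measurable.aestronglyMeasurable (by fun_prop)
      · exact (hvc.comp (continuous_const.mul continuous_id)).aestronglyMeasurable
    · intro t
      refine Filter.Eventually.of_forall fun r _ => ?_
      rw [norm_smul, Real.norm_eq_abs]
      gcongr
      exact hvB _
    · have h1 : IntervalIntegrable (fun s : ℝ => (1 - s) ^ (β - 1)) volume 0 1 := by
        have := (intervalIntegral.intervalIntegrable_rpow' (a := 0) (b := 1)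
          (by linarith : -1 < β - 1)).comp_sub_left 1
        simpa using this.symm
      exact h1.abs.mul_const B
    · refine Filter.Eventually.of_forall fun r _ => ?_
      exact (hvc.comp (continuous_id.mul continuous_const)).const_smul _
  refine key.continuousOn.congr fun t ht => ?_
  rw [rlIntegral_congr β ht.1 fun s hs => hvw s ⟨hs.1, hs.2.trans ht.2⟩,
    rlIntegral_eq_scaled hβ v ht.1]

lemma map_rlIntegral {Y : Type*} [NormedAddCommGroup Y] [InnerProductSpace ℝ Y] [CompleteSpace X]
    [CompleteSpace Y] (L : X →L[ℝ] Y) {β : ℝ} (hβ : 0 < β) {w : ℝ → X} {t : ℝ} (ht : 0 ≤ t)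
    (hw : ContinuousOn w (Icc 0 t)) :
    L (rlIntegral β w t) = rlIntegral β (fun s => L (w s)) t := by
  unfold rlIntegral
  rw [map_smul, ← L.intervalIntegral_comp_comm (intervalIntegrable_rlIntegrand hβ ht hw)]
  simp

lemma IsTestFun.continuous_iteratedDeriv {D : Set ℝ} {φ : ℝ → ℝ} (hφ : IsTestFun D φ) (k : ℕ) :
    Continuous (iteratedDeriv k φ) :=
  hφ.1.continuous_iteratedDeriv k (by exact_mod_cast le_top)

/-- Bounded linear maps commute with both integrals. Taking coordinates in this way reduces the
`X`-valued derivative to scalar ones. -/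
lemma map_rlDeriv {Y : Type*} [NormedAddCommGroup Y] [InnerProductSpace ℝ Y] [CompleteSpace X]
    [CompleteSpace Y] (L : X →L[ℝ] Y) {γ T : ℝ} (hγ : γ < 2) (hT : 0 ≤ T) {w : ℝ → X}
    (hw : ContinuousOn w (Icc 0 T)) {D : Set ℝ} {φ : ℝ → ℝ} (hφ : IsTestFun D φ) :
    L (rlDeriv γ T w φ) = rlDeriv γ T (fun s => L (w s)) φ := by
  unfold rlDeriv
  have hi : IntervalIntegrable (fun t => iteratedDeriv 2 φ t • rlIntegral (2 - γ) w t)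
      volume 0 T := by
    refine ContinuousOn.intervalIntegrable ?_
    rw [uIcc_of_le hT]
    exact (hφ.continuous_iteratedDeriv 2).continuousOn.smul
      (continuousOn_rlIntegral (by linarith) hT hw)
  rw [← L.intervalIntegral_comp_comm hi]
  refine intervalIntegral.integral_congr fun t ht => ?_
  rw [uIcc_of_le hT] at ht
  rw [map_smul, map_rlIntegral L (by linarith) ht.1 (hw.mono (Icc_subset_Icc_right ht.2))]

end RL

/-! ### The Fourier transform of test functions -/

section TestFun

variable {D : Set ℝ} {φ : ℝ → ℝ}

lemma IsTestFun.ofReal_contDiff (hφ : IsTestFun D φ) : ContDiff ℝ ∞ fun t => (φ t : ℂ) :=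
  Complex.ofRealCLM.contDiff.comp hφ.1

lemma IsTestFun.ofReal_compactSupport (hφ : IsTestFun D φ) :
    HasCompactSupport fun t => (φ t : ℂ) :=
  hφ.2.1.comp_left (g := fun x : ℝ => (x : ℂ)) Complex.ofReal_zero

lemma IsTestFun.eq_zero (hφ : IsTestFun D φ) {t : ℝ} (ht : t ∉ D) : φ t = 0 :=
  image_eq_zero_of_notMem_tsupport fun h => ht (hφ.2.2 h)

lemma IsTestFun.deriv (hφ : IsTestFun D φ) : IsTestFun D (deriv φ) := by
  refine ⟨?_, hφ.2.1.deriv, tsupport_deriv_subset.trans hφ.2.2⟩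
  exact (contDiff_infty_iff_deriv.1 hφ.1).2

/-- A test function is a Schwartz function, and hence so is its transform. -/
lemma IsTestFun.integrable_pow_mul_fourier (hφ : IsTestFun D φ) (k : ℕ) :
    Integrable fun ξ : ℝ => ‖ξ‖ ^ k * ‖𝓕 (fun t => (φ t : ℂ)) ξ‖ := by
  set S : SchwartzMap ℝ ℂ := hφ.ofReal_compactSupport.toSchwartzMap hφ.ofReal_contDiff
  have h := (𝓕 S).integrable_pow_mul volume k
  rw [SchwartzMap.fourier_coe] at h
  exact h

lemma IsTestFun.continuous_fourier (hφ : IsTestFun D φ) :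
    Continuous (𝓕 fun t => (φ t : ℂ)) :=
  fourier_continuous (hφ.ofReal_contDiff.continuous.integrable_of_hasCompactSupport
    hφ.ofReal_compactSupport)

lemma IsTestFun.integrable_fourier (hφ : IsTestFun D φ) :
    Integrable (𝓕 fun t => (φ t : ℂ)) := by
  have h := hφ.integrable_pow_mul_fourier 0
  simp only [pow_zero, one_mul] at h
  exact (integrable_norm_iff hφ.continuous_fourier.aestronglyMeasurable).1 h

lemma IsTestFun.fourier_deriv (hφ : IsTestFun D φ) (ξ : ℝ) :
    𝓕 (fun t => ((_root_.deriv φ t : ℝ) : ℂ)) ξ =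
      (2 * Real.pi * Complex.I * ξ) * 𝓕 (fun t => (φ t : ℂ)) ξ := by
  have hd : _root_.deriv (fun t => (φ t : ℂ)) = fun t => ((_root_.deriv φ t : ℝ) : ℂ) := by
    funext t
    exact ((hφ.1.differentiable (by simp)) t).hasDerivAt.ofReal_comp.deriv
  rw [← hd, Real.fourier_deriv]
  · rfl
  · exact hφ.ofReal_contDiff.continuous.integrable_of_hasCompactSupport hφ.ofReal_compactSupport
  · exact hφ.ofReal_contDiff.differentiable (by simp)
  · rw [hd]
    exact hφ.deriv.ofReal_contDiff.continuous.integrable_of_hasCompactSupport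
      hφ.deriv.ofReal_compactSupport

lemma IsTestFun.fourier_iteratedDeriv_two (hφ : IsTestFun D φ) (ξ : ℝ) :
    𝓕 (fun t => ((iteratedDeriv 2 φ t : ℝ) : ℂ)) ξ =
      (2 * Real.pi * ξ * Complex.I) ^ 2 * 𝓕 (fun t => (φ t : ℂ)) ξ := by
  have : iteratedDeriv 2 φ = _root_.deriv (_root_.deriv φ) := by
    rw [iteratedDeriv_succ, iteratedDeriv_one]
  rw [this, hφ.deriv.fourier_deriv, hφ.fourier_deriv]
  ring

lemma IsTestFun.iteratedDeriv_two (hφ : IsTestFun D φ) : IsTestFun D (iteratedDeriv 2 φ) := by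
  rw [iteratedDeriv_succ, iteratedDeriv_one]
  exact hφ.deriv.deriv

lemma conj_fourier_ofReal (f : ℝ → ℝ) (ξ : ℝ) :
    (starRingEnd ℂ) (𝓕 (fun t => (f t : ℂ)) ξ) = 𝓕⁻ (fun t => (f t : ℂ)) ξ := by
  rw [Real.fourierInv_eq_fourier_neg, Real.fourier_real_eq_integral_exp_smul,
    Real.fourier_real_eq_integral_exp_smul, ← integral_conj]
  congr 1
  funext t
  simp only [smul_eq_mul, map_mul, Complex.conj_ofReal, ← Complex.exp_conj]
  congr 2
  simp

/-- Parseval's formula for an integrable function and a test function. -/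
lemma integral_mul_testFun_eq (hφ : IsTestFun D φ) {f : ℝ → ℂ} (hf : Integrable f) :
    ∫ t, f t * φ t = ∫ ξ, 𝓕 f ξ * (starRingEnd ℂ) (𝓕 (fun t => (φ t : ℂ)) ξ) := by
  simp only [conj_fourier_ofReal]
  have hc : Continuous fun t => (φ t : ℂ) := hφ.ofReal_contDiff.continuous
  have hi : Integrable fun t => (φ t : ℂ) :=
    hc.integrable_of_hasCompactSupport hφ.ofReal_compactSupport
  have hinv : Integrable (𝓕⁻ fun t => (φ t : ℂ)) := by
    have : (𝓕⁻ fun t => (φ t : ℂ)) = fun ξ => 𝓕 (fun t => (φ t : ℂ)) (-ξ) :=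
      funext fun ξ => Real.fourierInv_eq_fourier_neg _ _
    rw [this]
    exact hφ.integrable_fourier.comp_neg
  -- The multiplication formula `∫ (𝓕 f) g = ∫ f (𝓕 g)` with `g = 𝓕⁻ φ`; it requires only
  -- integrability of `f` and `g`, not `f ∈ L²`.
  have h := VectorFourier.integral_fourierIntegral_smul_eq_flip (L := innerₗ ℝ)
    Real.continuous_fourierChar (by fun_prop) hf hinv
  have h2 : 𝓕 (𝓕⁻ fun t => (φ t : ℂ)) = fun t => (φ t : ℂ) :=
    hc.fourier_fourierInv_eq hi hφ.integrable_fourier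
  simp only [smul_eq_mul, flip_innerₗ] at h
  change ∫ ξ, 𝓕 f ξ * 𝓕⁻ (fun t => (φ t : ℂ)) ξ = ∫ x, f x * 𝓕 (𝓕⁻ fun t => (φ t : ℂ)) x at h
  rw [h, h2]

end TestFun

/-! ### The fractional derivative on the Fourier side -/

section Scalar

open Filter Topology

/-- The function `e^{-εt} a(t)`. -/
def damp (ε : ℝ) (a : ℝ → ℂ) (t : ℝ) : ℂ := (Real.exp (-(ε * t)) : ℂ) * a t

variable {a : ℝ → ℂ}

lemma norm_damp_le {ε : ℝ} (hε : 0 ≤ ε) (h0 : ∀ t ≤ 0, a t = 0) (t : ℝ) :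
    ‖damp ε a t‖ ≤ ‖a t‖ := by
  unfold damp
  rcases le_or_gt t 0 with ht | ht
  · simp [h0 t ht]
  · rw [norm_mul, Complex.norm_real, Real.norm_of_nonneg (Real.exp_pos _).le]
    refine mul_le_of_le_one_left (norm_nonneg _) (Real.exp_le_one_iff.2 ?_)
    have := mul_nonneg hε ht.le
    linarith

lemma damp_integrable {ε : ℝ} (hε : 0 ≤ ε) (ha : Integrable a) (h0 : ∀ t ≤ 0, a t = 0) :
    Integrable (damp ε a) := by
  refine ha.mono (AEStronglyMeasurable.mul ?_ ha.1) (Eventually.of_forall (norm_damp_le hε h0))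
  exact Continuous.aestronglyMeasurable (by fun_prop)

lemma norm_fourier_le (f : ℝ → ℂ) (ξ : ℝ) : ‖𝓕 f ξ‖ ≤ ∫ t, ‖f t‖ :=
  VectorFourier.norm_fourierIntegral_le_integral_norm _ _ _ _ _

lemma tendsto_fourier_damp (ha : Integrable a) (h0 : ∀ t ≤ 0, a t = 0) (ξ : ℝ) :
    Tendsto (fun ε => 𝓕 (damp ε a) ξ) (𝓝[>] 0) (𝓝 (𝓕 a ξ)) := by
  simp only [Real.fourier_real_eq_integral_exp_smul]
  refine tendsto_integral_filter_of_dominated_convergence (fun t => ‖a t‖) ?_ ?_ ha.norm ?_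
  · filter_upwards [self_mem_nhdsWithin] with ε hε
    simp only [smul_eq_mul]
    refine AEStronglyMeasurable.mul ?_ (damp_integrable (le_of_lt hε) ha h0).1
    exact Continuous.aestronglyMeasurable (by fun_prop)
  · filter_upwards [self_mem_nhdsWithin] with ε hε
    refine Eventually.of_forall fun t => ?_
    rw [norm_smul, Complex.norm_exp_ofReal_mul_I, one_mul]
    exact norm_damp_le (le_of_lt hε) h0 t
  · refine Eventually.of_forall fun t => ?_
    refine Tendsto.mono_left ?_ nhdsWithin_le_nhds
    simp only [smul_eq_mul]
    refine Tendsto.const_mul _ ?_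
    refine Continuous.tendsto' (f := fun ε => damp ε a t) ?_ 0 _ (by simp [damp])
    unfold damp
    fun_prop

-- For `β = 1` the kernel is `e^{-εt}` on the half-line, and the factors `e^{-εr}` and `e^{-ε(s-r)}`
-- multiply to `e^{-εs}`. So damping turns the plain primitive into a convolution with an integrable
-- kernel.
open ContinuousLinearMap in
lemma convolution_rlKernel_one (ε : ℝ) (h0 : ∀ t ≤ 0, a t = 0) :
    convolution (damp ε a) (rlKernel ε 1) (mul ℂ ℂ) volume =
      (Ioi 0).indicator fun s => (Real.exp (-(ε * s)) : ℂ) * ∫ r in (0 : ℝ)..s, a r := by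
  funext s
  rw [convolution_def]
  have h1 : ∀ r, (mul ℂ ℂ) (damp ε a r) (rlKernel ε 1 (s - r)) =
      (Real.exp (-(ε * s)) : ℂ) * (Ioo 0 s).indicator a r := by
    intro r
    simp only [mul_apply', damp, rlKernel]
    rcases le_or_gt r 0 with hr | hr
    · simp [h0 r hr, hr.not_gt]
    · by_cases hrs : r < s
      · rw [indicator_of_mem (show s - r ∈ Ioi (0 : ℝ) from sub_pos.2 hrs),
          indicator_of_mem (show r ∈ Ioo 0 s from ⟨hr, hrs⟩)]
        have : Real.exp (-(ε * s)) = Real.exp (-(ε * r)) * Real.exp (-(ε * (s - r))) := by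
          rw [← Real.exp_add]; ring_nf
        rw [this]
        simp
        ring
      · rw [indicator_of_notMem (show s - r ∉ Ioi (0 : ℝ) from fun h => hrs (sub_pos.1 h)),
          indicator_of_notMem (show r ∉ Ioo 0 s from fun h => hrs h.2)]
        simp
  simp only [h1]
  rw [integral_const_mul, integral_indicator measurableSet_Ioo]
  rcases le_or_gt s 0 with hs | hs
  · rw [Ioo_eq_empty hs.not_gt, indicator_of_notMem (show s ∉ Ioi (0 : ℝ) from hs.not_gt)]
    simp
  · rw [indicator_of_mem (show s ∈ Ioi (0 : ℝ) from hs), intervalIntegral.integral_of_le hs.le,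
      integral_Ioc_eq_integral_Ioo]

-- The same multiplication of exponentials for general `β`: damping commutes with the fractional
-- integral, up to passing to the damped kernel.
open ContinuousLinearMap in
lemma convolution_rlKernel (ε β : ℝ) (w : ℝ → ℂ) {t : ℝ} (ht : 0 ≤ t) :
    convolution ((Ioi 0).indicator fun s => (Real.exp (-(ε * s)) : ℂ) * w s) (rlKernel ε β)
      (mul ℂ ℂ) volume t = (Real.exp (-(ε * t)) : ℂ) * rlIntegral β w t := by
  rw [convolution_def]
  have h1 : ∀ r, (mul ℂ ℂ) ((Ioi 0).indicator (fun s => (Real.exp (-(ε * s)) : ℂ) * w s) r)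
      (rlKernel ε β (t - r)) = (Ioo 0 t).indicator
        (fun r => ((Real.exp (-(ε * t)) : ℂ) * ((Real.Gamma β)⁻¹ : ℝ)) •
          (t - r) ^ (β - 1) • w r) r := by
    intro r
    simp only [mul_apply', rlKernel]
    rcases le_or_gt r 0 with hr | hr
    · rw [indicator_of_notMem (show r ∉ Ioi (0 : ℝ) from hr.not_gt),
        indicator_of_notMem (show r ∉ Ioo 0 t from fun h => hr.not_gt h.1), zero_mul]
    · rw [indicator_of_mem (show r ∈ Ioi (0 : ℝ) from hr)]
      by_cases hrs : r < t
      · rw [indicator_of_mem (show t - r ∈ Ioi (0 : ℝ) from sub_pos.2 hrs),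
          indicator_of_mem (show r ∈ Ioo 0 t from ⟨hr, hrs⟩)]
        have : Real.exp (-(ε * t)) = Real.exp (-(ε * r)) * Real.exp (-(ε * (t - r))) := by
          rw [← Real.exp_add]; ring_nf
        rw [this]
        simp only [Complex.real_smul, smul_eq_mul]
        push_cast
        ring
      · rw [indicator_of_notMem (show t - r ∉ Ioi (0 : ℝ) from fun h => hrs (sub_pos.1 h)),
          indicator_of_notMem (show r ∉ Ioo 0 t from fun h => hrs h.2), mul_zero]
  simp only [h1]
  rw [integral_indicator measurableSet_Ioo, integral_smul, ← integral_Ioc_eq_integral_Ioo,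
    ← intervalIntegral.integral_of_le ht, rlIntegral, Complex.real_smul, smul_eq_mul, mul_assoc]

/-- The modulus of `ε + 2πiξ` is at least that of its imaginary part. The resulting bound does not
involve `ε`, as the limit `ε → 0` requires. -/
lemma norm_cpow_neg_le {ε β ξ : ℝ} (hβ : 0 ≤ β) (hξ : ξ ≠ 0) :
    ‖(ε + 2 * Real.pi * ξ * Complex.I : ℂ) ^ (-β : ℂ)‖ ≤ |2 * Real.pi * ξ| ^ (-β) := by
  rw [← Complex.ofReal_neg, Complex.norm_cpow_real]
  refine Real.rpow_le_rpow_of_nonpos (by positivity) ?_ (by linarith)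
  have := Complex.abs_im_le_norm (ε + 2 * Real.pi * ξ * Complex.I : ℂ)
  simpa using this

/-- The Fourier multiplier `(2πiξ)^s`. -/
def symbol (s ξ : ℝ) : ℂ := (2 * Real.pi * ξ * Complex.I : ℂ) ^ (s : ℂ)

lemma two_pi_mul_I_ne_zero {ξ : ℝ} (hξ : ξ ≠ 0) : (2 * Real.pi * ξ * Complex.I : ℂ) ≠ 0 := by
  simp [hξ, Real.pi_ne_zero]

lemma two_pi_mul_I_mem_slitPlane {ξ : ℝ} (hξ : ξ ≠ 0) :
    (2 * Real.pi * ξ * Complex.I : ℂ) ∈ Complex.slitPlane :=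
  Or.inr (by simp [hξ, Real.pi_ne_zero])

/-- The damped iterated integral is `damp ε a` convolved first with the kernel for `1` and then with
the kernel for `β`. Parseval's formula and the convolution theorem turn these into the factors `(ε +
2πiξ)^{-1}` and `(ε + 2πiξ)^{-β}`. -/
lemma damped_identity {β T ε : ℝ} (hβ : 0 < β) (hT : 0 ≤ T) (hε : 0 < ε) (ha : Integrable a)
    (h0 : ∀ t ≤ 0, a t = 0) {ψ : ℝ → ℝ} (hψ : IsTestFun (Ioo 0 T) ψ) :
    ∫ t in (0 : ℝ)..T, (Real.exp (-(ε * t)) : ℂ) *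
        (ψ t • rlIntegral β (fun s => ∫ r in (0 : ℝ)..s, a r) t) =
      ∫ ξ, 𝓕 (damp ε a) ξ * (ε + 2 * Real.pi * ξ * Complex.I : ℂ) ^ (-1 : ℂ) *
        (ε + 2 * Real.pi * ξ * Complex.I : ℂ) ^ (-β : ℂ) *
          (starRingEnd ℂ) (𝓕 (fun t => (ψ t : ℂ)) ξ) := by
  have hd := damp_integrable hε.le ha h0
  have hk1 := rlKernel_integrable hε one_pos
  have hkβ := rlKernel_integrable hε hβ
  have hc1 := hd.integrable_convolution (ContinuousLinearMap.mul ℂ ℂ) hk1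
  have hc2 := hc1.integrable_convolution (ContinuousLinearMap.mul ℂ ℂ) hkβ
  have h := integral_mul_testFun_eq hψ hc2
  simp only [Real.fourier_mul_convolution_eq hc1 hkβ, Real.fourier_mul_convolution_eq hd hk1,
    fourier_rlKernel hε hβ, fourier_rlKernel hε one_pos, Complex.ofReal_one] at h
  rw [← h, intervalIntegral.integral_of_le hT, ← integral_indicator measurableSet_Ioc]
  congr 1
  funext t
  by_cases ht : t ∈ Ioc 0 T
  · rw [indicator_of_mem ht, convolution_rlKernel_one ε h0, convolution_rlKernel ε β _ ht.1.le,
      Complex.real_smul]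
    ring
  · rw [indicator_of_notMem ht, hψ.eq_zero fun h => ht ⟨h.1, h.2.le⟩]
    simp

/-- For the primitive `w` of `a`, the fractional derivative `D_{0+}^γ w` has the Fourier
representation `(2πiξ)^{γ-1} F a`. -/
theorem rlDeriv_primitive {γ T : ℝ} (hγ : 1 < γ) (hγ' : γ < 2) (hT : 0 ≤ T) (ha : Integrable a)
    (h0 : ∀ t ≤ 0, a t = 0) {φ : ℝ → ℝ} (hφ : IsTestFun (Ioo 0 T) φ) :
    rlDeriv γ T (fun s => ∫ r in (0 : ℝ)..s, a r) φ =
      ∫ ξ, symbol (γ - 1) ξ * 𝓕 a ξ * (starRingEnd ℂ) (𝓕 (fun t => (φ t : ℂ)) ξ) := by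
  set w : ℝ → ℂ := fun s => ∫ r in (0 : ℝ)..s, a r with hw
  have hβ : 0 < 2 - γ := by linarith
  have hwc : ContinuousOn w (Icc 0 T) :=
    (intervalIntegral.continuous_primitive (fun _ _ => ha.intervalIntegrable) 0).continuousOn
  set ψ := iteratedDeriv 2 φ with hψ
  have hψt : IsTestFun (Ioo 0 T) ψ := hφ.iteratedDeriv_two
  have hcont : ContinuousOn (fun t => ψ t • rlIntegral (2 - γ) w t) (Icc 0 T) :=
    hψt.1.continuous.continuousOn.smul (continuousOn_rlIntegral hβ hT hwc)
  have hint : IntervalIntegrable (fun t => ψ t • rlIntegral (2 - γ) w t) volume 0 T :=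
    ContinuousOn.intervalIntegrable (by rwa [uIcc_of_le hT])
  have hlim1 : Tendsto (fun ε : ℝ => ∫ t in (0 : ℝ)..T, (Real.exp (-(ε * t)) : ℂ) *
      (ψ t • rlIntegral (2 - γ) w t)) (𝓝[>] 0) (𝓝 (rlDeriv γ T w φ)) := by
    refine intervalIntegral.tendsto_integral_filter_of_dominated_convergence
      (fun t => ‖ψ t • rlIntegral (2 - γ) w t‖) ?_ ?_ hint.norm ?_
    · refine Eventually.of_forall fun ε => ?_
      refine AEStronglyMeasurable.mul (Continuous.aestronglyMeasurable (by fun_prop)) ?_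
      exact hint.def'.1
    · filter_upwards [self_mem_nhdsWithin] with ε hε
      refine Eventually.of_forall fun t ht => ?_
      rw [uIoc_of_le hT] at ht
      rw [norm_mul, Complex.norm_real, Real.norm_of_nonneg (Real.exp_pos _).le]
      refine mul_le_of_le_one_left (norm_nonneg _) (Real.exp_le_one_iff.2 ?_)
      have := mul_nonneg (le_of_lt hε) ht.1.le
      linarith
    · refine Eventually.of_forall fun t _ => ?_
      refine Tendsto.mono_left ?_ nhdsWithin_le_nhds
      refine Continuous.tendsto' ?_ 0 _ (by simp [hψ])
      fun_prop
  have hlim2 : Tendsto (fun ε : ℝ => ∫ ξ, 𝓕 (damp ε a) ξ *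
      (ε + 2 * Real.pi * ξ * Complex.I : ℂ) ^ (-1 : ℂ) *
        (ε + 2 * Real.pi * ξ * Complex.I : ℂ) ^ (-(2 - γ : ℝ) : ℂ) *
          (starRingEnd ℂ) (𝓕 (fun t => (ψ t : ℂ)) ξ)) (𝓝[>] 0)
      (𝓝 (∫ ξ, symbol (γ - 1) ξ * 𝓕 a ξ * (starRingEnd ℂ) (𝓕 (fun t => (φ t : ℂ)) ξ))) := by
    have hne : ∀ᵐ ξ : ℝ, ξ ≠ 0 := by simp [ae_iff, measure_singleton]
    refine tendsto_integral_filter_of_dominated_convergence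
      (fun ξ => (∫ t, ‖a t‖) * ((2 * Real.pi) ^ (γ - 1) * (‖𝓕 (fun t => (φ t : ℂ)) ξ‖ +
        ‖ξ‖ * ‖𝓕 (fun t => (φ t : ℂ)) ξ‖))) ?_ ?_ ?_ ?_
    · filter_upwards [self_mem_nhdsWithin] with ε hε
      have c1 := (fourier_continuous (damp_integrable (le_of_lt hε) ha h0)).measurable
      have c2 := hψt.continuous_fourier.measurable
      have c3 : Measurable fun ξ : ℝ => (starRingEnd ℂ) (𝓕 (fun t => (ψ t : ℂ)) ξ) :=
        Complex.continuous_conj.measurable.comp c2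
      exact Measurable.aestronglyMeasurable (by fun_prop)
    · filter_upwards [self_mem_nhdsWithin] with ε hε
      filter_upwards [hne] with ξ hξ
      have hp : 0 < |2 * Real.pi * ξ| := by simp [hξ, Real.pi_ne_zero]
      have b1 : ‖𝓕 (damp ε a) ξ‖ ≤ ∫ t, ‖a t‖ :=
        (norm_fourier_le _ _).trans (integral_mono (damp_integrable (le_of_lt hε) ha h0).norm
          ha.norm (norm_damp_le (le_of_lt hε) h0))
      have b2 := norm_cpow_neg_le (ε := ε) zero_le_one hξ
      have b3 := norm_cpow_neg_le (ε := ε) hβ.le hξ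
      rw [hψ, hφ.fourier_iteratedDeriv_two, map_mul, norm_mul, norm_mul, norm_mul, norm_mul,
        RCLike.norm_conj, RCLike.norm_conj]
      have e1 : ‖(2 * Real.pi * ξ * Complex.I : ℂ) ^ 2‖ = |2 * Real.pi * ξ| ^ (2 : ℝ) := by
        rw [norm_pow, Real.rpow_two]
        congr 1
        simp [abs_mul]
      -- The two derivatives on `φ` supply `|2πξ|²`, which outweighs the singularity of order `1 +
      -- (2 - γ)` at `ξ = 0`.
      have e2 : |2 * Real.pi * ξ| ^ (-1 : ℝ) * |2 * Real.pi * ξ| ^ (-(2 - γ)) *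
          |2 * Real.pi * ξ| ^ (2 : ℝ) = |2 * Real.pi * ξ| ^ (γ - 1) := by
        rw [← Real.rpow_add hp, ← Real.rpow_add hp]
        congr 1
        ring
      -- As `0 < γ - 1 < 1`, linear growth is enough, and the transform of `φ` absorbs it.
      have e3 : |2 * Real.pi * ξ| ^ (γ - 1) ≤ (2 * Real.pi) ^ (γ - 1) * (1 + ‖ξ‖) := by
        rw [abs_mul, abs_of_pos (by positivity : (0 : ℝ) < 2 * Real.pi),
          Real.mul_rpow (by positivity) (by positivity)]
        gcongr
        calc |ξ| ^ (γ - 1) ≤ (1 + |ξ|) ^ (γ - 1) :=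
              Real.rpow_le_rpow (abs_nonneg _) (by linarith) (by linarith)
          _ ≤ (1 + |ξ|) ^ (1 : ℝ) :=
              Real.rpow_le_rpow_of_exponent_le (by linarith [abs_nonneg ξ]) (by linarith)
          _ = _ := by rw [Real.rpow_one, Real.norm_eq_abs]
      have b2' : ‖(ε + 2 * Real.pi * ξ * Complex.I : ℂ) ^ (-1 : ℂ)‖ ≤
          |2 * Real.pi * ξ| ^ (-1 : ℝ) := by simpa using b2
      rw [e1]
      calc _ ≤ (∫ t, ‖a t‖) * |2 * Real.pi * ξ| ^ (-1 : ℝ) * |2 * Real.pi * ξ| ^ (-(2 - γ)) *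
            (|2 * Real.pi * ξ| ^ (2 : ℝ) * ‖𝓕 (fun t => (φ t : ℂ)) ξ‖) := by gcongr
        _ = (∫ t, ‖a t‖) * ((|2 * Real.pi * ξ| ^ (-1 : ℝ) * |2 * Real.pi * ξ| ^ (-(2 - γ)) *
            |2 * Real.pi * ξ| ^ (2 : ℝ)) * ‖𝓕 (fun t => (φ t : ℂ)) ξ‖) := by ring
        _ ≤ (∫ t, ‖a t‖) * (((2 * Real.pi) ^ (γ - 1) * (1 + ‖ξ‖)) *
            ‖𝓕 (fun t => (φ t : ℂ)) ξ‖) := by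
          rw [e2]
          have : 0 ≤ ∫ t, ‖a t‖ := integral_nonneg fun _ => norm_nonneg _
          gcongr
        _ = _ := by ring
    · refine Integrable.const_mul (Integrable.const_mul (Integrable.add ?_ ?_) _) _
      · exact hφ.integrable_fourier.norm
      · simpa using hφ.integrable_pow_mul_fourier 1
    · filter_upwards [hne] with ξ hξ
      have hz := two_pi_mul_I_ne_zero hξ
      have hlz : Tendsto (fun ε : ℝ => (ε + 2 * Real.pi * ξ * Complex.I : ℂ)) (𝓝[>] 0)
          (𝓝 (2 * Real.pi * ξ * Complex.I)) := by
        refine Tendsto.mono_left (Continuous.tendsto' (by fun_prop) _ _ (by simp))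
          nhdsWithin_le_nhds
      have hl : ∀ s : ℂ, Tendsto (fun ε : ℝ => (ε + 2 * Real.pi * ξ * Complex.I : ℂ) ^ s)
          (𝓝[>] 0) (𝓝 ((2 * Real.pi * ξ * Complex.I) ^ s)) := fun s =>
        hlz.cpow tendsto_const_nhds (two_pi_mul_I_mem_slitPlane hξ)
      have e : symbol (γ - 1) ξ * 𝓕 a ξ * (starRingEnd ℂ) (𝓕 (fun t => (φ t : ℂ)) ξ) =
          𝓕 a ξ * (2 * Real.pi * ξ * Complex.I : ℂ) ^ (-1 : ℂ) *
            (2 * Real.pi * ξ * Complex.I : ℂ) ^ (-(2 - γ : ℝ) : ℂ) *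
              (starRingEnd ℂ) (𝓕 (fun t => (ψ t : ℂ)) ξ) := by
        rw [hψ, hφ.fourier_iteratedDeriv_two, map_mul]
        -- `(2πiξ)²` is real, so the conjugation in Parseval's formula does not affect it and the
        -- exponents can be added.
        have e1 : (starRingEnd ℂ) ((2 * Real.pi * ξ * Complex.I : ℂ) ^ 2) =
            (2 * Real.pi * ξ * Complex.I : ℂ) ^ (2 : ℂ) := by
          rw [Complex.cpow_ofNat]
          have : (2 * Real.pi * ξ * Complex.I : ℂ) = ((2 * Real.pi * ξ : ℝ) : ℂ) * Complex.I := by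
            push_cast; rfl
          rw [this, map_pow, map_mul, Complex.conj_ofReal, Complex.conj_I]
          ring
        have e2 : symbol (γ - 1) ξ = (2 * Real.pi * ξ * Complex.I : ℂ) ^ (-1 : ℂ) *
            (2 * Real.pi * ξ * Complex.I : ℂ) ^ (-(2 - γ : ℝ) : ℂ) *
              (2 * Real.pi * ξ * Complex.I : ℂ) ^ (2 : ℂ) := by
          rw [symbol, ← Complex.cpow_add _ _ hz, ← Complex.cpow_add _ _ hz]
          congr 1
          push_cast
          ring
        rw [e1, e2]
        ring
      rw [e]
      exact (((tendsto_fourier_damp ha h0 ξ).mul (hl _)).mul (hl _)).mul_const _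
  refine tendsto_nhds_unique_of_eventuallyEq hlim1 hlim2 ?_
  filter_upwards [self_mem_nhdsWithin] with ε hε
  exact damped_identity hβ hT hε ha h0 hψt

end Scalar

/-! ### The bilinear form of the fractional derivative -/

section Form

variable {X : Type*} [NormedAddCommGroup X] [InnerProductSpace ℝ X]

/-- The measure on the pairs of an index of a coordinate and a frequency. -/
abbrev freqMeasure : Measure (ℕ × ℝ) := Measure.count.prod volume

/-- The coordinatewise Fourier transform of `v χ_{(a,b)}`, times the multiplier `μ`. -/
def freqFun (e : HilbertBasis ℕ ℝ X) (a b : ℝ) (μ : ℝ → ℂ) (v : ℝ → X) (p : ℕ × ℝ) : ℂ :=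
  μ p.2 * 𝓕 (coordFun e a b v p.1) p.2

variable {e : HilbertBasis ℕ ℝ X} {α a b : ℝ} {μ : ℝ → ℂ}

lemma freqFun_measurable (hμ : Measurable μ) {v : ℝ → X}
    (hv : MemLp v 2 (volume.restrict (Ioo a b))) : Measurable (freqFun e a b μ v) := by
  refine measurable_from_prod_countable_right fun j => ?_
  exact hμ.mul (fourier_continuous (coord_integrable e hv j)).measurable

lemma lintegral_freqFun (hμ : Measurable μ) (hμα : ∀ ξ, ‖μ ξ‖ = |2 * Real.pi * ξ| ^ α)
    {v : ℝ → X} (hv : MemLp v 2 (volume.restrict (Ioo a b))) :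
    ∫⁻ p, ‖freqFun e a b μ v p‖ₑ ^ (2 : ℝ) ∂freqMeasure = fracEnergy e α a b v := by
  rw [lintegral_prod, lintegral_count, fracEnergy]
  · refine tsum_congr fun j => lintegral_congr fun ξ => ?_
    rw [freqFun, enorm_mul, ENNReal.rpow_two, mul_pow]
    congr 1
    rw [← ofReal_norm, hμα, ← ENNReal.ofReal_pow (by positivity), mul_comm 2 α,
      Real.rpow_mul (abs_nonneg _), Real.rpow_two]
  · exact ((freqFun_measurable hμ hv).enorm.pow_const _).aemeasurable

lemma eLpNorm_freqFun (hμ : Measurable μ) (hμα : ∀ ξ, ‖μ ξ‖ = |2 * Real.pi * ξ| ^ α)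
    {v : ℝ → X} (hv : MemLp v 2 (volume.restrict (Ioo a b))) :
    eLpNorm (freqFun e a b μ v) 2 freqMeasure = fracEnergy e α a b v ^ (1 / 2 : ℝ) := by
  rw [eLpNorm_eq_lintegral_rpow_enorm_toReal (by norm_num) (by norm_num), ENNReal.toReal_ofNat,
    lintegral_freqFun hμ hμα hv]

lemma freqFun_memLp (hμ : Measurable μ) (hμα : ∀ ξ, ‖μ ξ‖ = |2 * Real.pi * ξ| ^ α)
    (v : FracSpace e α a b) : MemLp (freqFun e a b μ v) 2 freqMeasure := by
  refine ⟨(freqFun_measurable hμ v.2.1).aestronglyMeasurable, ?_⟩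
  rw [eLpNorm_freqFun hμ hμα v.2.1]
  exact ENNReal.rpow_lt_top_of_nonneg (by norm_num) v.2.2.ne

/-- `freqFun` as a linear map from `H^α(a,b;X)` to an `L²` space. -/
def freqLp (hμ : Measurable μ) (hμα : ∀ ξ, ‖μ ξ‖ = |2 * Real.pi * ξ| ^ α) :
    FracSpace e α a b →ₗ[ℝ] Lp ℂ 2 freqMeasure where
  toFun v := (freqFun_memLp hμ hμα v).toLp _
  map_add' v w := by
    rw [← MemLp.toLp_add]
    congr 1
    funext p
    simp only [freqFun, Submodule.coe_add, coordFun_add, Pi.add_apply,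
      fourier_add' (coord_integrable e v.2.1 p.1) (coord_integrable e w.2.1 p.1), mul_add]
  map_smul' c v := by
    rw [RingHom.id_apply, ← MemLp.toLp_const_smul]
    congr 1
    funext p
    simp only [freqFun, Submodule.coe_smul, coordFun_smul, fourier_smul', Pi.smul_apply,
      smul_eq_mul, Complex.real_smul]
    ring

lemma norm_freqLp (hμ : Measurable μ) (hμα : ∀ ξ, ‖μ ξ‖ = |2 * Real.pi * ξ| ^ α)
    (v : FracSpace e α a b) : ‖freqLp hμ hμα v‖ = fracNorm e α a b v := by
  change ‖(freqFun_memLp hμ hμα v).toLp _‖ = _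
  rw [Lp.norm_toLp, eLpNorm_freqFun hμ hμα v.2.1, fracNorm, Real.sqrt_eq_rpow,
    ENNReal.toReal_rpow]

lemma freqLp_coeFn (hμ : Measurable μ) (hμα : ∀ ξ, ‖μ ξ‖ = |2 * Real.pi * ξ| ^ α)
    (v : FracSpace e α a b) : freqLp hμ hμα v =ᵐ[freqMeasure] freqFun e a b μ v :=
  (freqFun_memLp hμ hμα v).coeFn_toLp

lemma symbol_measurable (s : ℝ) : Measurable (symbol s) := by
  unfold symbol
  fun_prop

lemma norm_symbol (s ξ : ℝ) : ‖symbol s ξ‖ = |2 * Real.pi * ξ| ^ s := by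
  rw [symbol, Complex.norm_cpow_real]
  congr 1
  simp [abs_mul]

lemma symbol_add {s r ξ : ℝ} (hξ : ξ ≠ 0) : symbol (s + r) ξ = symbol s ξ * symbol r ξ := by
  rw [symbol, Complex.ofReal_add, Complex.cpow_add _ _ (two_pi_mul_I_ne_zero hξ)]
  rfl

/-- The argument of `2πiξ` is `π/2` or `-π/2` according to the sign of `ξ`, and the cosine is even.
The real part therefore has the same sign at all frequencies, which is the source of coercivity. -/
lemma re_symbol {s ξ : ℝ} (hξ : ξ ≠ 0) :
    (symbol s ξ).re = |2 * Real.pi * ξ| ^ s * Real.cos (Real.pi / 2 * s) := by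
  have hn : ‖(2 * Real.pi * ξ * Complex.I : ℂ)‖ = |2 * Real.pi * ξ| := by simp [abs_mul]
  rw [symbol, Complex.cpow_ofReal_re, hn]
  congr 1
  have e : (2 * Real.pi * ξ * Complex.I : ℂ) = ((2 * Real.pi * ξ : ℝ) : ℂ) * Complex.I := by
    push_cast; rfl
  rcases lt_or_gt_of_ne hξ with h | h
  · have h2 : 0 < -(2 * Real.pi * ξ) := by nlinarith [Real.pi_pos]
    have e2 : (2 * Real.pi * ξ * Complex.I : ℂ) =
        ((-(2 * Real.pi * ξ) : ℝ) : ℂ) * (-Complex.I) := by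
      rw [e]; push_cast; ring
    rw [e2, Complex.arg_real_mul _ h2, Complex.arg_neg_I, ← Real.cos_neg]
    ring_nf
  · rw [e, Complex.arg_real_mul _ (by positivity), Complex.arg_I]

lemma conj_symbol_measurable (s : ℝ) : Measurable fun ξ => (starRingEnd ℂ) (symbol s ξ) :=
  Complex.continuous_conj.measurable.comp (symbol_measurable s)

lemma norm_conj_symbol (s ξ : ℝ) :
    ‖(starRingEnd ℂ) (symbol s ξ)‖ = |2 * Real.pi * ξ| ^ s := by
  rw [RCLike.norm_conj, norm_symbol]

lemma ae_freq_ne_zero : ∀ᵐ p : ℕ × ℝ ∂freqMeasure, p.2 ≠ 0 := by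
  have hne : ∀ᵐ ξ : ℝ, ξ ≠ 0 := by simp [ae_iff, measure_singleton]
  exact Measure.quasiMeasurePreserving_snd.ae hne

variable (e α a b) in
/-- The bilinear form `∑_j ∫ (2πiξ)^{2α} ĝ_j(ξ) conj(v̂_j(ξ)) dξ` that represents
`⟨D_{0+}^{2α} g, v⟩`. -/
def fracForm : FracSpace e α a b →ₗ[ℝ] FracSpace e α a b →ₗ[ℝ] ℝ :=
  LinearMap.mk₂ ℝ
    (fun g v => (inner ℂ (freqLp (conj_symbol_measurable α) (norm_conj_symbol α) v)
      (freqLp (symbol_measurable α) (norm_symbol α) g)).re)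
    (fun g₁ g₂ v => by rw [map_add, inner_add_right, Complex.add_re])
    (fun c g v => by
      rw [map_smul, RCLike.real_smul_eq_coe_smul (K := ℂ), inner_smul_right]
      exact Complex.re_ofReal_mul _ _)
    (fun g v₁ v₂ => by rw [map_add, inner_add_left, Complex.add_re])
    (fun c g v => by
      rw [map_smul, RCLike.real_smul_eq_coe_smul (K := ℂ), inner_smul_left, RCLike.conj_ofReal]
      exact Complex.re_ofReal_mul _ _)

/-- One half `(2πiξ)^α` of the symbol goes to `g`; the other goes to `v` in conjugated form, so that
the conjugation in the inner product restores it. -/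
lemma inner_freqLp (g v : FracSpace e α a b) :
    inner ℂ (freqLp (conj_symbol_measurable α) (norm_conj_symbol α) v)
      (freqLp (symbol_measurable α) (norm_symbol α) g) =
    ∫ p, symbol (2 * α) p.2 * 𝓕 (coordFun e a b g p.1) p.2 *
      (starRingEnd ℂ) (𝓕 (coordFun e a b v p.1) p.2) ∂freqMeasure := by
  rw [L2.inner_def]
  refine integral_congr_ae ?_
  filter_upwards [freqLp_coeFn (conj_symbol_measurable α) (norm_conj_symbol α) v,
    freqLp_coeFn (symbol_measurable α) (norm_symbol α) g, ae_freq_ne_zero]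
    with p h1 h2 h3
  rw [h1, h2, RCLike.inner_apply, freqFun, freqFun, map_mul, Complex.conj_conj, two_mul,
    symbol_add h3]
  ring

lemma integrable_fracForm (g v : FracSpace e α a b) :
    Integrable (fun p => symbol (2 * α) p.2 * 𝓕 (coordFun e a b g p.1) p.2 *
      (starRingEnd ℂ) (𝓕 (coordFun e a b v p.1) p.2)) freqMeasure := by
  refine (L2.integrable_inner (𝕜 := ℂ)
    (freqLp (conj_symbol_measurable α) (norm_conj_symbol α) v)
    (freqLp (symbol_measurable α) (norm_symbol α) g)).congr ?_
  filter_upwards [freqLp_coeFn (conj_symbol_measurable α) (norm_conj_symbol α) v,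
    freqLp_coeFn (symbol_measurable α) (norm_symbol α) g, ae_freq_ne_zero]
    with p h1 h2 h3
  rw [h1, h2, RCLike.inner_apply, freqFun, freqFun, map_mul, Complex.conj_conj, two_mul,
    symbol_add h3]
  ring

lemma fracForm_apply (g v : FracSpace e α a b) : fracForm e α a b g v =
    (∫ p, symbol (2 * α) p.2 * 𝓕 (coordFun e a b g p.1) p.2 *
      (starRingEnd ℂ) (𝓕 (coordFun e a b v p.1) p.2) ∂freqMeasure).re := by
  rw [← inner_freqLp]
  rfl

/-- Cauchy-Schwarz: each argument carries half of the symbol, and both halves have modulus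
`|2πξ|^α`. -/
lemma abs_fracForm_le (g v : FracSpace e α a b) :
    |fracForm e α a b g v| ≤ fracNorm e α a b g * fracNorm e α a b v := by
  refine (Complex.abs_re_le_norm _).trans ((norm_inner_le_norm _ _).trans_eq ?_)
  rw [norm_freqLp, norm_freqLp, mul_comm]

/-- On the diagonal the integrand is `(2πiξ)^{2α} |v̂|²`, whose real part is `cos(πα) |2πξ|^{2α}
|v̂|²` for `ξ ≠ 0`. -/
lemma fracForm_self (v : FracSpace e α a b) :
    fracForm e α a b v v = Real.cos (Real.pi * α) * fracNorm e α a b v ^ 2 := by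
  rw [fracForm_apply, ← norm_freqLp (symbol_measurable α) (norm_symbol α) v,
    ← RCLike.re_to_complex, ← integral_re (integrable_fracForm v v)]
  rw [← inner_self_eq_norm_sq (𝕜 := ℂ), L2.inner_def, ← integral_re (L2.integrable_inner _ _), ←
      integral_const_mul]
  refine integral_congr_ae ?_
  filter_upwards [freqLp_coeFn (symbol_measurable α) (norm_symbol α) v,
    ae_freq_ne_zero] with p h2 h3
  rw [h2, inner_self_eq_norm_sq, freqFun, norm_mul, norm_symbol, mul_assoc, Complex.mul_conj,
    RCLike.re_to_complex, Complex.re_mul_ofReal, re_symbol h3, Complex.normSq_eq_norm_sq, mul_pow,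
    ← Real.rpow_two (|2 * Real.pi * p.2| ^ α), ← Real.rpow_mul (abs_nonneg _)]
  ring_nf

/-- The functional `⟨D_{0+}^{2α} g, ·⟩` in `H^{-α}(a,b;X)`. -/
def fracFunctional (g : FracSpace e α a b) : FracDual e α a b :=
  ⟨fracForm e α a b g, fracNorm e α a b g, fun v => abs_fracForm_le g v⟩

end Form

/-! ### The form as the Riemann-Liouville derivative of a primitive -/

section RLForm

variable {X : Type*} [NormedAddCommGroup X] [InnerProductSpace ℝ X] {e : HilbertBasis ℕ ℝ X}

lemma integral_eq_integral_indicator {Y : Type*} [NormedAddCommGroup Y] [NormedSpace ℝ Y]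
    (f : ℝ → Y) {t T : ℝ} (ht : t ∈ Icc 0 T) :
    ∫ s in (0 : ℝ)..t, f s = ∫ s in (0 : ℝ)..t, (Ioo 0 T).indicator f s := by
  rw [intervalIntegral.integral_of_le ht.1, intervalIntegral.integral_of_le ht.1,
    integral_Ioc_eq_integral_Ioo, integral_Ioc_eq_integral_Ioo]
  refine setIntegral_congr_fun measurableSet_Ioo fun s hs => ?_
  rw [indicator_of_mem (show s ∈ Ioo 0 T from ⟨hs.1, hs.2.trans_le ht.2⟩)]

lemma continuousOn_primitive_of_eq {T : ℝ} {g w : ℝ → X} (hg : IntegrableOn g (Ioo 0 T))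
    (hw : ∀ t ∈ Icc 0 T, w t = ∫ s in (0 : ℝ)..t, g s) : ContinuousOn w (Icc 0 T) := by
  have hi : Integrable ((Ioo 0 T).indicator g) := (integrable_indicator_iff measurableSet_Ioo).2 hg
  refine (intervalIntegral.continuous_primitive (fun _ _ => hi.intervalIntegrable)
    0).continuousOn.congr fun t ht => ?_
  rw [hw t ht, integral_eq_integral_indicator g ht]

lemma coordFun_testFun {T : ℝ} {φ : ℝ → ℝ} (hφ : IsTestFun (Ioo 0 T) φ) (x : X) (j : ℕ) :
    coordFun e 0 T (fun t => φ t • x) j = ((inner ℝ (e j) x : ℝ) : ℂ) • fun t => (φ t : ℂ) := by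
  funext t
  by_cases h : t ∈ Ioo 0 T
  · simp [coordFun, h, inner_smul_right, mul_comm]
  · simp [coordFun, h, hφ.eq_zero h]

/-- The form `fracForm` represents the Riemann-Liouville derivative of the primitive. -/
theorem eqRLDeriv_fracFunctional [CompleteSpace X] {γ T : ℝ} (hγ : 1 < γ) (hγ' : γ < 2)
    (hT : 0 < T) (g : FracSpace e ((γ - 1) / 2) 0 T) {w : ℝ → X}
    (hw : ∀ t ∈ Icc 0 T, w t = ∫ s in (0 : ℝ)..t, g.1 s) :
    EqRLDeriv (gamma0_pos hγ) (gamma0_lt hγ') hT (fracFunctional g) γ w := by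
  intro φ hφ x
  have hgi : IntegrableOn g.1 (Ioo 0 T) := g.2.1.integrable (by norm_num)
  have hwc := continuousOn_primitive_of_eq hgi hw
  -- The scalar Fourier representation is applied to the `j`-th coordinate of `g`: the functional
  -- `(e_j, ·)` commutes with the derivative and with the primitive.
  have hcoord : ∀ j, ((inner ℝ (e j) (rlDeriv γ T w φ) : ℝ) : ℂ) =
      ∫ ξ, symbol (γ - 1) ξ * 𝓕 (coordFun e 0 T g j) ξ *
        (starRingEnd ℂ) (𝓕 (fun t => (φ t : ℂ)) ξ) := by
    intro j
    have hL := map_rlDeriv (Complex.ofRealCLM ∘L innerSL ℝ (e j)) hγ' hT.le hwc hφ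
    have h0 : ∀ t ≤ 0, coordFun e 0 T g j t = 0 := fun t ht =>
      indicator_of_notMem (fun h => ht.not_gt h.1) _
    rw [← rlDeriv_primitive hγ hγ' hT.le (coord_integrable e g.2.1 j) h0 hφ]
    refine hL.trans (rlDeriv_congr γ hT.le φ fun t ht => ?_)
    have hgt : IntervalIntegrable g.1 volume 0 t := by
      rw [intervalIntegrable_iff_integrableOn_Ioo_of_le ht.1]
      exact hgi.mono_set (Ioo_subset_Ioo_right ht.2)
    rw [hw t ht, ← ContinuousLinearMap.intervalIntegral_comp_comm _ hgt,
      integral_eq_integral_indicator _ ht]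
    rfl
  change fracForm e _ 0 T g _ = _
  -- Fubini over the pairs (coordinate, frequency) gives a sum over `j`, which is matched term by
  -- term with Parseval's expansion of the inner product in `X`.
  rw [fracForm_apply, integral_prod _ (integrable_fracForm g _), integral_countable
    (integrable_fracForm g _).integral_prod_left, ← e.tsum_inner_mul_inner, ← Complex.ofReal_re (∑'
      _, _),
    Complex.ofReal_tsum]
  congr 2
  funext j
  rw [count_real_singleton, one_smul]
  simp only [coordFun_testFun hφ, fourier_smul', Pi.smul_apply, smul_eq_mul, map_mul,
    Complex.conj_ofReal]
  rw [Complex.ofReal_mul, real_inner_comm (e j) (rlDeriv γ T w φ), hcoord, ← integral_mul_const,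
    mul_div_cancel₀ _ (two_ne_zero)]
  congr 1
  funext ξ
  ring

end RLForm

/-! ### Approximation of truncated functions by test functions -/

section Approx

open Filter Topology

/-- The scalar energy `∫ |2πξ|^{2α} |F f(ξ)|² dξ`. -/
def scalarEnergy (α : ℝ) (f : ℝ → ℂ) : ENNReal :=
  ∫⁻ ξ : ℝ, ENNReal.ofReal (|2 * Real.pi * ξ| ^ (2 * α)) * ‖𝓕 f ξ‖ₑ ^ 2

/-- A smooth cutoff function for the interval `(c, d)`. -/
def cutoff (c d ε t : ℝ) : ℝ :=
  Real.smoothTransition ((t - c) / ε - 1) * Real.smoothTransition ((d - t) / ε - 1)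

variable {c d ε : ℝ}

lemma cutoff_nonneg (c d ε t : ℝ) : 0 ≤ cutoff c d ε t :=
  mul_nonneg (Real.smoothTransition.nonneg _) (Real.smoothTransition.nonneg _)

lemma cutoff_le_one (c d ε t : ℝ) : cutoff c d ε t ≤ 1 :=
  mul_le_one₀ (Real.smoothTransition.le_one _) (Real.smoothTransition.nonneg _)
    (Real.smoothTransition.le_one _)

lemma cutoff_contDiff : ContDiff ℝ ∞ (cutoff c d ε) := by
  unfold cutoff
  refine ContDiff.mul (Real.smoothTransition.contDiff.comp ?_)
    (Real.smoothTransition.contDiff.comp ?_)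
  · exact ((contDiff_id.sub contDiff_const).div_const ε).sub contDiff_const
  · exact ((contDiff_const.sub contDiff_id).div_const ε).sub contDiff_const

lemma cutoff_eq_zero (hε : 0 < ε) {t : ℝ} (ht : t ∉ Icc (c + ε) (d - ε)) :
    cutoff c d ε t = 0 := by
  unfold cutoff
  rw [mem_Icc, not_and_or, not_le, not_le] at ht
  rcases ht with h | h
  · rw [Real.smoothTransition.zero_of_nonpos, zero_mul]
    rw [sub_nonpos, div_le_one hε]; linarith
  · rw [mul_comm, Real.smoothTransition.zero_of_nonpos, zero_mul]
    rw [sub_nonpos, div_le_one hε]; linarith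

lemma isTestFun_mul_cutoff {g : ℝ → ℝ} (hg : ContDiff ℝ ∞ g) (hε : 0 < ε) :
    IsTestFun (Ioo c d) fun t => g t * cutoff c d ε t := by
  have hsub : tsupport (fun t => g t * cutoff c d ε t) ⊆ Icc (c + ε) (d - ε) := by
    refine closure_minimal (fun t ht => ?_) isClosed_Icc
    by_contra h
    exact ht (by simp only [cutoff_eq_zero hε h, mul_zero])
  exact ⟨hg.mul cutoff_contDiff, isCompact_Icc.of_isClosed_subset (isClosed_tsupport _) hsub,
    hsub.trans fun t ht => ⟨by linarith [ht.1], by linarith [ht.2]⟩⟩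

lemma tendsto_cutoff {t : ℝ} (ht : t ∈ Ioo c d) :
    Tendsto (fun ε => cutoff c d ε t) (𝓝[>] 0) (𝓝 1) := by
  have h1 : Iio ((t - c) / 2) ∈ 𝓝[>] (0 : ℝ) :=
    mem_nhdsWithin_of_mem_nhds (Iio_mem_nhds (by linarith [ht.1]))
  have h2 : Iio ((d - t) / 2) ∈ 𝓝[>] (0 : ℝ) :=
    mem_nhdsWithin_of_mem_nhds (Iio_mem_nhds (by linarith [ht.2]))
  refine tendsto_const_nhds.congr' ?_
  filter_upwards [h1, h2, self_mem_nhdsWithin] with ε e1 e2 e3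
  have e1' : ε < (t - c) / 2 := e1
  have e2' : ε < (d - t) / 2 := e2
  have e3' : 0 < ε := e3
  unfold cutoff
  rw [Real.smoothTransition.one_of_one_le, Real.smoothTransition.one_of_one_le, mul_one]
  · rw [le_sub_iff_add_le, le_div_iff₀ e3']; linarith
  · rw [le_sub_iff_add_le, le_div_iff₀ e3']; linarith

lemma integral_abs_deriv_of_monotone {u : ℝ → ℝ} (hu : ContDiff ℝ 1 u)
    (h : ∀ t, 0 ≤ deriv u t) : ∫ t in c..d, |deriv u t| = u d - u c := by
  simp only [abs_of_nonneg (h _)]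
  exact intervalIntegral.integral_deriv_eq_sub' u rfl
    (fun t _ => hu.differentiable one_ne_zero t) (hu.continuous_deriv le_rfl).continuousOn

/-- The cutoff is an increasing times a decreasing function, both with values in `[0, 1]`, so its
total variation is at most `2` however steep it is. The independence of `ε` is the point. -/
lemma integral_abs_deriv_cutoff (hcd : c ≤ d) (hε : 0 < ε) :
    ∫ t in c..d, |deriv (cutoff c d ε) t| ≤ 2 := by
  set u : ℝ → ℝ := fun t => Real.smoothTransition ((t - c) / ε - 1) with hu
  set v : ℝ → ℝ := fun t => -Real.smoothTransition ((d - t) / ε - 1) with hv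
  have hS : ContDiff ℝ 1 Real.smoothTransition := Real.smoothTransition.contDiff
  have huc : ContDiff ℝ 1 u :=
    hS.comp (((contDiff_id.sub contDiff_const).div_const ε).sub contDiff_const)
  have hvc : ContDiff ℝ 1 v :=
    (hS.comp (((contDiff_const.sub contDiff_id).div_const ε).sub contDiff_const)).neg
  have hum : Monotone u := fun s t hst => Real.smoothTransition.monotone (by gcongr)
  have hvm : Monotone v := fun s t hst => neg_le_neg (Real.smoothTransition.monotone (by gcongr))
  have hderiv : ∀ t, deriv (cutoff c d ε) t = deriv u t * -v t - u t * deriv v t := by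
    intro t
    have h1 := (huc.differentiable one_ne_zero t).hasDerivAt.mul
      (hvc.differentiable one_ne_zero t).hasDerivAt.neg
    have h2 : cutoff c d ε = u * -v := by
      funext t; simp [cutoff, hu, hv]
    rw [h2, h1.deriv]
    simp
    ring
  have hu1 : ∀ t, |u t| ≤ 1 := fun t => by
    rw [abs_of_nonneg (Real.smoothTransition.nonneg _)]; exact Real.smoothTransition.le_one _
  have hv1 : ∀ t, |v t| ≤ 1 := fun t => by
    rw [hv, abs_neg, abs_of_nonneg (Real.smoothTransition.nonneg _)]
    exact Real.smoothTransition.le_one _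
  have cu := huc.continuous_deriv le_rfl
  have cv := hvc.continuous_deriv le_rfl
  have hle : ∫ t in c..d, |deriv (cutoff c d ε) t| ≤
      ∫ t in c..d, (|deriv u t| + |deriv v t|) := by
    refine intervalIntegral.integral_mono_on hcd ?_ ?_ fun t _ => ?_
    · exact ((cutoff_contDiff.continuous_deriv (by simp)).abs).intervalIntegrable _ _
    · exact (cu.abs.add cv.abs).intervalIntegrable _ _
    · rw [hderiv]
      refine (abs_sub _ _).trans ?_
      rw [abs_mul, abs_mul, abs_neg]
      nlinarith [hu1 t, hv1 t, abs_nonneg (deriv u t), abs_nonneg (deriv v t)]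
  refine hle.trans ?_
  rw [intervalIntegral.integral_add (cu.abs.intervalIntegrable _ _)
    (cv.abs.intervalIntegrable _ _),
    integral_abs_deriv_of_monotone huc fun t => hum.deriv_nonneg,
    integral_abs_deriv_of_monotone hvc fun t => hvm.deriv_nonneg]
  have a1 := Real.smoothTransition.le_one ((d - c) / ε - 1)
  have a2 := Real.smoothTransition.nonneg ((c - c) / ε - 1)
  have a3 := Real.smoothTransition.nonneg ((d - d) / ε - 1)
  simp only [hu, hv]
  linarith

lemma IsTestFun.integral_norm_eq {φ : ℝ → ℝ} (hφ : IsTestFun (Ioo c d) φ) (hcd : c ≤ d) :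
    ∫ t, ‖(φ t : ℂ)‖ = ∫ t in c..d, |φ t| := by
  rw [intervalIntegral.integral_of_le hcd, ← integral_indicator measurableSet_Ioc]
  congr 1
  funext t
  by_cases ht : t ∈ Ioc c d
  · simp [ht]
  · rw [indicator_of_notMem ht, hφ.eq_zero fun h => ht ⟨h.1, h.2.le⟩]
    simp

/-- The transform is bounded by the `L¹` norm, applied to `φ` and to `φ'`; the factor `2π` in the
transform of `φ'` is discarded because it exceeds `1`. -/
lemma IsTestFun.fourier_le {φ : ℝ → ℝ} (hφ : IsTestFun (Ioo c d) φ) (hcd : c ≤ d) (ξ : ℝ) :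
    (1 + |ξ|) * ‖𝓕 (fun t => (φ t : ℂ)) ξ‖ ≤
      (∫ t in c..d, |φ t|) + ∫ t in c..d, |_root_.deriv φ t| := by
  have h1 := norm_fourier_le (fun t => (φ t : ℂ)) ξ
  have h2 := norm_fourier_le (fun t => ((_root_.deriv φ t : ℝ) : ℂ)) ξ
  rw [hφ.integral_norm_eq hcd] at h1
  rw [hφ.deriv.integral_norm_eq hcd, hφ.fourier_deriv, norm_mul] at h2
  have h3 : ‖(2 * Real.pi * Complex.I * ξ : ℂ)‖ = 2 * Real.pi * |ξ| := by
    simp [abs_of_pos Real.pi_pos]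
  rw [h3] at h2
  rw [add_mul, one_mul]
  refine add_le_add h1 (le_trans ?_ h2)
  gcongr
  nlinarith [Real.pi_gt_three, abs_nonneg ξ]

/-- The derivative of the product has `L¹` norm bounded uniformly in `ε`, by the variation bound for
the cutoff. This supplies the majorant for the convergence in `H^α`. -/
lemma fourier_mul_cutoff_le {g : ℝ → ℝ} (hg : ContDiff ℝ ∞ g) (hcd : c ≤ d) :
    ∃ D : ℝ, 0 ≤ D ∧ ∀ ε, 0 < ε → ∀ ξ : ℝ,
      (1 + |ξ|) * ‖𝓕 (fun t => ((g t * cutoff c d ε t : ℝ) : ℂ)) ξ‖ ≤ D := by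
  obtain ⟨G, hG⟩ := isCompact_Icc.exists_bound_of_continuousOn
    (hg.continuous.continuousOn (s := Icc c d))
  have cg := hg.continuous
  have cg' : Continuous (deriv g) := hg.continuous_deriv (by simp)
  have hG0 : 0 ≤ G := (norm_nonneg _).trans (hG c (left_mem_Icc.2 hcd))
  refine ⟨(∫ t in c..d, |g t|) + ((∫ t in c..d, |deriv g t|) + G * 2), ?_, fun ε hε ξ => ?_⟩
  · have h1 := intervalIntegral.integral_nonneg hcd (μ := volume) fun t _ => abs_nonneg (g t)
    have h2 := intervalIntegral.integral_nonneg hcd (μ := volume) fun t _ => abs_nonneg (deriv g t)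
    positivity
  have cχ : Continuous (cutoff c d ε) := cutoff_contDiff.continuous
  have cχ' : Continuous (deriv (cutoff c d ε)) := cutoff_contDiff.continuous_deriv (by simp)
  have hd : deriv (fun t => g t * cutoff c d ε t) =
      fun t => deriv g t * cutoff c d ε t + g t * deriv (cutoff c d ε) t := by
    funext t
    exact ((hg.differentiable (by simp) t).hasDerivAt.mul
      (cutoff_contDiff.differentiable (by simp) t).hasDerivAt).deriv
  refine ((isTestFun_mul_cutoff hg hε).fourier_le hcd ξ).trans (add_le_add ?_ ?_)
  · refine intervalIntegral.integral_mono_on hcd ((cg.mul cχ).abs.intervalIntegrable _ _)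
      (cg.abs.intervalIntegrable _ _) fun t _ => ?_
    rw [abs_mul, abs_of_nonneg (cutoff_nonneg _ _ _ _)]
    exact mul_le_of_le_one_right (abs_nonneg _) (cutoff_le_one _ _ _ _)
  · rw [hd]
    have : ∫ t in c..d, |deriv g t * cutoff c d ε t + g t * deriv (cutoff c d ε) t| ≤
        ∫ t in c..d, (|deriv g t| + G * |deriv (cutoff c d ε) t|) := by
      refine intervalIntegral.integral_mono_on hcd
        (((cg'.mul cχ).add (cg.mul cχ')).abs.intervalIntegrable _ _)
        ((cg'.abs.add (continuous_const.mul cχ'.abs)).intervalIntegrable _ _) fun t ht => ?_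
      refine (abs_add_le _ _).trans (add_le_add ?_ ?_)
      · rw [abs_mul, abs_of_nonneg (cutoff_nonneg _ _ _ _)]
        exact mul_le_of_le_one_right (abs_nonneg _) (cutoff_le_one _ _ _ _)
      · rw [abs_mul]
        exact mul_le_mul_of_nonneg_right (hG t ht) (abs_nonneg _)
    refine this.trans ?_
    rw [intervalIntegral.integral_add (cg'.abs.intervalIntegrable _ _)
      (Continuous.intervalIntegrable (by fun_prop) _ _), intervalIntegral.integral_const_mul]
    gcongr
    exact integral_abs_deriv_cutoff hcd hε

lemma integrable_indicator_Ioo {g : ℝ → ℝ} (hg : Continuous g) :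
    Integrable ((Ioo c d).indicator fun t => (g t : ℂ)) := by
  rw [integrable_indicator_iff measurableSet_Ioo]
  have : Continuous fun t => (g t : ℂ) := by fun_prop
  exact (this.integrableOn_Icc (a := c) (b := d)).mono_set Ioo_subset_Icc_self

/-- The cutoffs converge in `L¹` by dominated convergence, and the transform is bounded by the `L¹`
norm. -/
lemma tendsto_fourier_sub_cutoff {g : ℝ → ℝ} (hg : ContDiff ℝ ∞ g) (ξ : ℝ) :
    Tendsto (fun ε => 𝓕 (((Ioo c d).indicator fun t => (g t : ℂ)) -
      fun t => ((g t * cutoff c d ε t : ℝ) : ℂ)) ξ) (𝓝[>] 0) (𝓝 0) := by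
  have hi := integrable_indicator_Ioo (c := c) (d := d) hg.continuous
  refine squeeze_zero_norm (fun ε => norm_fourier_le _ ξ) ?_
  suffices h : Tendsto (fun ε => ∫ t, ‖(((Ioo c d).indicator fun t => (g t : ℂ)) -
      fun t => ((g t * cutoff c d ε t : ℝ) : ℂ)) t‖) (𝓝[>] 0) (𝓝 (∫ _ : ℝ, (0 : ℝ))) by
    rwa [integral_zero] at h
  refine tendsto_integral_filter_of_dominated_convergence
    (fun t => ‖(Ioo c d).indicator (fun t => (g t : ℂ)) t‖) ?_ ?_ hi.norm ?_
  · filter_upwards [self_mem_nhdsWithin] with ε hε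
    have := (isTestFun_mul_cutoff (c := c) (d := d) hg hε).ofReal_contDiff.continuous
    exact (hi.1.sub this.aestronglyMeasurable).norm
  · filter_upwards [self_mem_nhdsWithin] with ε hε
    refine Eventually.of_forall fun t => ?_
    rw [norm_norm, Pi.sub_apply]
    by_cases ht : t ∈ Ioo c d
    · rw [indicator_of_mem ht, ← Complex.ofReal_sub, Complex.norm_real, Complex.norm_real]
      rw [show g t - g t * cutoff c d ε t = g t * (1 - cutoff c d ε t) by ring, norm_mul]
      refine mul_le_of_le_one_right (norm_nonneg _) ?_
      rw [Real.norm_of_nonneg (by linarith [cutoff_le_one c d ε t])]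
      linarith [cutoff_nonneg c d ε t]
    · rw [indicator_of_notMem ht, (isTestFun_mul_cutoff hg hε).eq_zero ht]
      simp
  · refine Eventually.of_forall fun t => ?_
    by_cases ht : t ∈ Ioo c d
    · have h := ((tendsto_cutoff ht).const_mul (g t)).const_sub (g t)
      simp only [mul_one, sub_self] at h
      have h2 := h.norm
      rw [norm_zero] at h2
      refine h2.congr fun ε => ?_
      rw [Pi.sub_apply, indicator_of_mem ht, ← Complex.ofReal_sub, Complex.norm_real]
    · refine tendsto_const_nhds.congr' ?_
      filter_upwards [self_mem_nhdsWithin] with ε hε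
      rw [Pi.sub_apply, indicator_of_notMem ht, (isTestFun_mul_cutoff hg hε).eq_zero ht]
      simp

/-- Truncated smooth functions are limits of test functions in `H^α` for `α < 1/2`. -/
theorem tendsto_scalarEnergy_cutoff {g : ℝ → ℝ} (hg : ContDiff ℝ ∞ g) (hcd : c ≤ d) {α : ℝ}
    (h0 : 0 < α) (h1 : α < 1 / 2) :
    Tendsto (fun ε => scalarEnergy α (((Ioo c d).indicator fun t => (g t : ℂ)) -
      fun t => ((g t * cutoff c d ε t : ℝ) : ℂ))) (𝓝[>] 0) (𝓝 0) := by
  obtain ⟨D₁, hD₁, hb₁⟩ := fourier_decay (hg.of_le (by simp)) hcd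
  obtain ⟨D₂, hD₂, hb₂⟩ := fourier_mul_cutoff_le hg hcd
  have hi := integrable_indicator_Ioo (c := c) (d := d) hg.continuous
  have hi₂ : ∀ ε, 0 < ε → Integrable fun t => ((g t * cutoff c d ε t : ℝ) : ℂ) := fun ε hε =>
    (isTestFun_mul_cutoff hg hε).ofReal_contDiff.continuous.integrable_of_hasCompactSupport
      (isTestFun_mul_cutoff hg hε).ofReal_compactSupport
  unfold scalarEnergy
  have hz : (0 : ENNReal) = ∫⁻ ξ : ℝ, 0 := by simp
  rw [hz]
  -- Both transforms decay like `1/(1+|ξ|)` uniformly in `ε`, so the integrand is at most a constant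
  -- times `(1+|ξ|)^{2α-2}`. This is integrable precisely because `α < 1/2`.
  refine tendsto_lintegral_filter_of_dominated_convergence
    (fun ξ => ENNReal.ofReal ((2 * Real.pi) ^ (2 * α) * (D₁ + D₂) ^ 2) *
        ENNReal.ofReal ((1 + ‖ξ‖) ^ (-(2 - 2 * α)))) ?_ ?_ ?_ ?_
  · filter_upwards [self_mem_nhdsWithin] with ε hε
    have := (fourier_continuous (hi.sub (hi₂ ε hε))).measurable
    fun_prop
  · filter_upwards [self_mem_nhdsWithin] with ε hε
    refine Eventually.of_forall fun ξ => ?_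
    have hsub : 𝓕 (((Ioo c d).indicator fun t => (g t : ℂ)) -
        fun t => ((g t * cutoff c d ε t : ℝ) : ℂ)) ξ =
        𝓕 ((Ioo c d).indicator fun t => (g t : ℂ)) ξ -
          𝓕 (fun t => ((g t * cutoff c d ε t : ℝ) : ℂ)) ξ := by
      rw [sub_eq_add_neg, ← neg_one_smul ℂ, fourier_add' hi ((hi₂ ε hε).smul _), fourier_smul']
      simp [sub_eq_add_neg]
    set y := ‖𝓕 (((Ioo c d).indicator fun t => (g t : ℂ)) -
        fun t => ((g t * cutoff c d ε t : ℝ) : ℂ)) ξ‖ with hy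
    have h2 : (1 + ‖ξ‖) * y ≤ D₁ + D₂ := by
      rw [hy, hsub]
      have e1 := hb₁ ξ
      have e2 := hb₂ ε hε ξ
      have e3 := norm_sub_le (𝓕 ((Ioo c d).indicator fun t => (g t : ℂ)) ξ)
        (𝓕 (fun t => ((g t * cutoff c d ε t : ℝ) : ℂ)) ξ)
      calc _ ≤ (1 + |ξ|) * (_ + _) := by
              rw [Real.norm_eq_abs]; gcongr
        _ ≤ _ := by rw [mul_add]; exact add_le_add e1 e2
    rw [← ofReal_norm, ← hy, ← ENNReal.ofReal_pow (norm_nonneg _),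
      ← ENNReal.ofReal_mul (by positivity), ← ENNReal.ofReal_mul (by positivity)]
    refine ENNReal.ofReal_le_ofReal ?_
    have hp : (0 : ℝ) < 1 + ‖ξ‖ := by positivity
    have e1 : |2 * Real.pi * ξ| ^ (2 * α) ≤ (2 * Real.pi) ^ (2 * α) * (1 + ‖ξ‖) ^ (2 * α) := by
      rw [← Real.mul_rpow (by positivity) hp.le]
      refine Real.rpow_le_rpow (abs_nonneg _) ?_ (by linarith)
      rw [abs_mul, abs_of_pos (by positivity : (0 : ℝ) < 2 * Real.pi)]
      gcongr
      simp
    have e2 : y ^ 2 ≤ (D₁ + D₂) ^ 2 * (1 + ‖ξ‖) ^ (-2 : ℝ) := by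
      have h3 : ((1 + ‖ξ‖) * y) ^ 2 ≤ (D₁ + D₂) ^ 2 := by gcongr
      rw [Real.rpow_neg hp.le, ← div_eq_mul_inv, le_div_iff₀ (by positivity)]
      norm_cast
      calc _ = ((1 + ‖ξ‖) * y) ^ 2 := by ring
        _ ≤ _ := h3
    calc _ ≤ ((2 * Real.pi) ^ (2 * α) * (1 + ‖ξ‖) ^ (2 * α)) *
          ((D₁ + D₂) ^ 2 * (1 + ‖ξ‖) ^ (-2 : ℝ)) := by gcongr
      _ = (2 * Real.pi) ^ (2 * α) * (D₁ + D₂) ^ 2 *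
          ((1 + ‖ξ‖) ^ (2 * α) * (1 + ‖ξ‖) ^ (-2 : ℝ)) := by ring
      _ = _ := by
        rw [← Real.rpow_add hp]
        congr 2
        ring
  · rw [lintegral_const_mul' _ _ ENNReal.ofReal_ne_top]
    exact (ENNReal.mul_lt_top ENNReal.ofReal_lt_top
      (finite_integral_one_add_norm (by simp; linarith))).ne
  · refine Eventually.of_forall fun ξ => ?_
    have h := (tendsto_fourier_sub_cutoff (c := c) (d := d) hg ξ).enorm
    have h2 := ENNReal.Tendsto.const_mul (ENNReal.Tendsto.pow (n := 2) h) (Or.inr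
        ENNReal.ofReal_ne_top)
      (a := ENNReal.ofReal (|2 * Real.pi * ξ| ^ (2 * α)))
    simpa using h2

end Approx

/-! ### Functionals on piecewise polynomials -/

section Density

open Filter Topology

variable {X : Type*} [NormedAddCommGroup X] [InnerProductSpace ℝ X] {e : HilbertBasis ℕ ℝ X}
  {α : ℝ}

lemma fracNorm_nonneg (e : HilbertBasis ℕ ℝ X) (α a b : ℝ) (v : ℝ → X) :
    0 ≤ fracNorm e α a b v :=
  Real.sqrt_nonneg _

lemma fracEnergy_congr {a b : ℝ} {v w : ℝ → X} (h : v =ᵐ[volume.restrict (Ioo a b)] w) :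
    fracEnergy e α a b v = fracEnergy e α a b w := by
  unfold fracEnergy
  refine tsum_congr fun j => lintegral_congr fun ξ => ?_
  rw [Real.fourier_congr_ae]
  have h' := (ae_restrict_iff' measurableSet_Ioo).1 h
  filter_upwards [h'] with t ht
  by_cases h1 : t ∈ Ioo a b
  · simp [coordFun, h1, ht h1]
  · simp only [coordFun, indicator_of_notMem h1]

lemma fracNorm_congr {a b : ℝ} {v w : ℝ → X} (h : v =ᵐ[volume.restrict (Ioo a b)] w) :
    fracNorm e α a b v = fracNorm e α a b w := by
  rw [fracNorm, fracNorm, fracEnergy_congr h]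

lemma fracNorm_zero {a b : ℝ} : fracNorm e α a b 0 = 0 := by
  have h : ∀ j, coordFun e a b (0 : ℝ → X) j = (0 : ℂ) • (0 : ℝ → ℂ) := by
    intro j; funext t; simp [coordFun]
  simp only [fracNorm, fracEnergy, h, fourier_smul']
  simp

/-- Bounded functionals do not distinguish functions that are equal almost everywhere. -/
lemma FracDual.congr {a b : ℝ} (F : FracDual e α a b) {v w : FracSpace e α a b}
    (h : v.1 =ᵐ[volume.restrict (Ioo a b)] w.1) : F.1 v = F.1 w := by
  obtain ⟨C, hC⟩ := F.2
  have h1 := hC (v - w)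
  have h2 : fracNorm e α a b (v - w : FracSpace e α a b).1 = 0 := by
    rw [← fracNorm_zero (e := e) (α := α) (a := a) (b := b)]
    refine fracNorm_congr ?_
    filter_upwards [h] with t ht
    simp [ht]
  rw [h2, mul_zero] at h1
  have h3 := abs_nonpos_iff.1 h1
  rwa [map_sub, sub_eq_zero] at h3

lemma tsum_enorm_inner_sq (e : HilbertBasis ℕ ℝ X) (x : X) :
    ∑' j, ‖((inner ℝ (e j) x : ℝ) : ℂ)‖ₑ ^ 2 = ENNReal.ofReal (‖x‖ ^ 2) := by
  have hs := e.summable_inner_mul_inner x x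
  rw [← real_inner_self_eq_norm_sq, ← e.tsum_inner_mul_inner, ENNReal.ofReal_tsum_of_nonneg
    (fun j => by rw [real_inner_comm x]; exact mul_self_nonneg _) hs]
  refine tsum_congr fun j => ?_
  rw [← ofReal_norm, ← ENNReal.ofReal_pow (norm_nonneg _), Complex.norm_real, Real.norm_eq_abs,
    sq_abs, real_inner_comm x, sq]

lemma fracEnergy_smul_const (e : HilbertBasis ℕ ℝ X) (α a b : ℝ) (h : ℝ → ℝ) (x : X) :
    fracEnergy e α a b (fun t => h t • x) =
      ENNReal.ofReal (‖x‖ ^ 2) * scalarEnergy α ((Ioo a b).indicator fun t => (h t : ℂ)) := by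
  have hcoord : ∀ j, coordFun e a b (fun t => h t • x) j =
      ((inner ℝ (e j) x : ℝ) : ℂ) • ((Ioo a b).indicator fun t => (h t : ℂ)) := by
    intro j
    funext t
    by_cases h : t ∈ Ioo a b
    · simp [coordFun, h, inner_smul_right, mul_comm]
    · simp [coordFun, h]
  rw [← tsum_enorm_inner_sq e]
  unfold fracEnergy scalarEnergy
  rw [← ENNReal.tsum_mul_right]
  refine tsum_congr fun j => ?_
  rw [← lintegral_const_mul' _ _ (by simp)]
  refine lintegral_congr fun ξ => ?_
  rw [hcoord, fourier_smul', Pi.smul_apply, smul_eq_mul, enorm_mul]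
  ring

/-- A bounded functional that vanishes on the test functions in `(0, b)` vanishes on the truncated
smooth functions supported in `(0, b)`. -/
lemma FracDual.eq_zero_of_testFun {T b : ℝ} (hbT : b ≤ T) (h0 : 0 < α) (h1 : α < 1 / 2)
    (H : FracDual e α 0 T)
    (hH : ∀ φ, IsTestFun (Ioo 0 b) φ → ∀ (x : X) (hm : (fun t => φ t • x) ∈ FracSpace e α 0 T),
      H.1 ⟨_, hm⟩ = 0)
    {c d : ℝ} (hc : 0 ≤ c) (hcd : c ≤ d) (hd : d ≤ b) {g : ℝ → ℝ} (hg : ContDiff ℝ ∞ g) (x : X)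
    (hm : (Ioo c d).indicator (fun t => g t • x) ∈ FracSpace e α 0 T) : H.1 ⟨_, hm⟩ = 0 := by
  obtain ⟨C, hC⟩ := H.2
  have hsub : Ioo c d ⊆ Ioo 0 T := Ioo_subset_Ioo hc (hd.trans hbT)
  set f : ℝ → ℝ → ℂ := fun ε => ((Ioo c d).indicator fun t => (g t : ℂ)) -
      fun t => ((g t * cutoff c d ε t : ℝ) : ℂ) with hf
  -- `H` vanishes on the cutoff function, so its value on the truncation equals its value on the
  -- difference, which is small in the norm.
  have hbound : ∀ ε, 0 < ε → |H.1 ⟨_, hm⟩| ≤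
      C * Real.sqrt (ENNReal.ofReal (‖x‖ ^ 2) * scalarEnergy α (f ε)).toReal := by
    intro ε hε
    have hφ := isTestFun_mul_cutoff (c := c) (d := d) hg hε
    have hφb : IsTestFun (Ioo 0 b) fun t => g t * cutoff c d ε t :=
      ⟨hφ.1, hφ.2.1, hφ.2.2.trans (Ioo_subset_Ioo hc hd)⟩
    have hmφ : (fun t => (g t * cutoff c d ε t) • x) ∈ FracSpace e α 0 T :=
      smooth_smul_mem e (hφ.1.of_le (by simp)) x (hc.trans (hcd.trans (hd.trans hbT))) h0 h1
    have h := hC (⟨_, hm⟩ - ⟨_, hmφ⟩)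
    rw [map_sub, hH _ hφb x hmφ, sub_zero] at h
    convert h using 2
    change _ = Real.sqrt (fracEnergy e α 0 T ((Ioo c d).indicator (fun t => g t • x) -
      fun t => (g t * cutoff c d ε t) • x)).toReal
    congr 2
    have he : ((Ioo c d).indicator (fun t => g t • x) - fun t => (g t * cutoff c d ε t) • x) =
        fun t => ((Ioo c d).indicator g t - g t * cutoff c d ε t) • x := by
      funext t
      by_cases ht : t ∈ Ioo c d <;> simp [ht, sub_smul]
    rw [he, fracEnergy_smul_const]
    congr 2
    funext t
    by_cases ht : t ∈ Ioo c d
    · have := hsub ht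
      simp [hf, ht, this]
    · have h2 : ((g t * cutoff c d ε t : ℝ) : ℂ) = 0 := by rw [hφ.eq_zero ht, Complex.ofReal_zero]
      simp only [hf, Pi.sub_apply, h2, indicator_of_notMem ht]
      by_cases h3 : t ∈ Ioo 0 T
      · rw [indicator_of_mem h3, indicator_of_notMem ht, Complex.ofReal_sub, h2,
          Complex.ofReal_zero]
      · rw [indicator_of_notMem h3, sub_zero]
  have hlim : Tendsto (fun ε => C * Real.sqrt
      (ENNReal.ofReal (‖x‖ ^ 2) * scalarEnergy α (f ε)).toReal) (𝓝[>] 0) (𝓝 0) := by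
    have h := tendsto_scalarEnergy_cutoff (c := c) (d := d) hg hcd h0 h1
    have h2 := ENNReal.Tendsto.const_mul h (Or.inr ENNReal.ofReal_ne_top)
      (a := ENNReal.ofReal (‖x‖ ^ 2))
    rw [mul_zero] at h2
    have h3 := (ENNReal.tendsto_toReal ENNReal.zero_ne_top).comp h2
    have h4 := ((Real.continuous_sqrt.tendsto _).comp h3).const_mul C
    rw [ENNReal.toReal_zero, Real.sqrt_zero, mul_zero] at h4
    exact h4
  have hle : |H.1 ⟨_, hm⟩| ≤ 0 := ge_of_tendsto hlim (by
    filter_upwards [self_mem_nhdsWithin] with ε hε using hbound ε hε)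
  exact abs_nonpos_iff.1 hle

lemma exists_grid_interval {t : ℕ → ℝ} {s : ℝ} (h0 : t 0 < s) (hs : s ∉ range t) :
    ∀ N, s < t N → ∃ i < N, s ∈ Ioo (t i) (t (i + 1)) := by
  intro N
  induction N with
  | zero => intro h; exact absurd h0 h.le.not_gt
  | succ N ih =>
    intro h
    rcases lt_trichotomy s (t N) with h2 | h2 | h2
    · obtain ⟨i, hi, hi'⟩ := ih h2
      exact ⟨i, hi.trans (Nat.lt_succ_self N), hi'⟩
    · exact absurd ⟨N, h2.symm⟩ hs
    · exact ⟨N, Nat.lt_succ_self N, h2, h⟩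

lemma grid_interval_unique {t : ℕ → ℝ} (ht : Monotone t) {s : ℝ} {i j : ℕ}
    (hi : s ∈ Ioo (t i) (t (i + 1))) (hj : s ∈ Ioo (t j) (t (j + 1))) : i = j := by
  by_contra hij
  rcases lt_or_gt_of_ne hij with h | h
  · exact absurd (hi.2.trans_le (ht h)) hj.1.not_gt
  · exact absurd (hj.2.trans_le (ht h)) hi.1.not_gt

lemma ae_notMem_range (t : ℕ → ℝ) : ∀ᵐ s ∂(volume : Measure ℝ), s ∉ range t :=
  measure_eq_zero_iff_ae_notMem.1 ((countable_range t).measure_zero volume)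

/-- A bounded functional that vanishes on the test functions in `(0, t_N)` vanishes on the
piecewise polynomials supported in `(0, t_N)`. -/
theorem FracDual.eq_zero_of_piecewisePoly {T : ℝ} {t : ℕ → ℝ} (ht : Monotone t) (ht0 : t 0 = 0)
    {N q : ℕ} (htN : t N ≤ T) (h0 : 0 < α) (h1 : α < 1 / 2) (H : FracDual e α 0 T)
    (hH : ∀ φ, IsTestFun (Ioo 0 (t N)) φ → ∀ (x : X)
      (hm : (fun t => φ t • x) ∈ FracSpace e α 0 T), H.1 ⟨_, hm⟩ = 0)
    {V : ℝ → X} (hV : IsPiecewisePoly t N q V) {v : FracSpace e α 0 T}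
    (hv : v.1 =ᵐ[volume.restrict (Ioo 0 T)] (Ioo 0 (t N)).indicator V) : H.1 v = 0 := by
  choose! c hc using hV
  have hT : 0 ≤ T := by rw [← ht0]; exact (ht (Nat.zero_le N)).trans htN
  have hmem : ∀ j ∈ Finset.range N, ∀ k, (Ioo (t j) (t (j + 1))).indicator
      (fun s : ℝ => s ^ k • c j k) ∈ FracSpace e α 0 T := fun j hj k =>
    indicator_mem e (Ioo_subset_Ioo (ht0 ▸ ht (Nat.zero_le j))
      ((ht (Finset.mem_range.1 hj)).trans htN))
      (smooth_smul_mem e (contDiff_id.pow k) (c j k) (ht (Nat.le_succ j)) h0 h1)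
  -- A finite sum of truncated monomials, on each of which `H` vanishes. It equals `v` off the
  -- countably many nodes, and bounded functionals do not see null sets.
  set v' : FracSpace e α 0 T := ∑ j ∈ (Finset.range N).attach, ∑ k ∈ Finset.range q,
    ⟨_, hmem j.1 j.2 k⟩ with hv'
  have hzero : H.1 v' = 0 := by
    rw [hv', map_sum]
    refine Finset.sum_eq_zero fun j _ => ?_
    rw [map_sum]
    refine Finset.sum_eq_zero fun k _ => ?_
    exact FracDual.eq_zero_of_testFun htN h0 h1 H hH (ht0 ▸ ht (Nat.zero_le j.1)) (ht (Nat.le_succ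
        j.1))
      (ht (Finset.mem_range.1 j.2)) (contDiff_id.pow k) (c j.1 k) (hmem j.1 j.2 k)
  refine (FracDual.congr H (hv.trans ?_)).trans hzero
  have hval : ∀ s, v'.1 s = ∑ j ∈ Finset.range N, (Ioo (t j) (t (j + 1))).indicator
      (fun s : ℝ => ∑ k ∈ Finset.range q, s ^ k • c j k) s := by
    intro s
    rw [hv', ← Finset.sum_attach (Finset.range N)]
    simp only [Submodule.coe_sum, Finset.sum_apply]
    refine Finset.sum_congr rfl fun j _ => ?_
    by_cases hs : s ∈ Ioo (t j.1) (t (j.1 + 1)) <;> simp [hs]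
  refine (ae_restrict_iff' measurableSet_Ioo).2 ?_
  filter_upwards [ae_notMem_range t] with s hs hsI
  rw [hval]
  by_cases hsN : s < t N
  · obtain ⟨i, hi, hi'⟩ := exists_grid_interval (by rw [ht0]; exact hsI.1) hs N hsN
    rw [indicator_of_mem (show s ∈ Ioo 0 (t N) from ⟨hsI.1, hsN⟩), hc i hi s hi']
    refine ((Finset.sum_eq_single (M := X) (s := Finset.range N) i ?_ ?_).trans ?_).symm
    rotate_left 2
    · rw [indicator_of_mem hi']
    · intro j _ hji
      exact indicator_of_notMem (fun hj => hji (grid_interval_unique ht hj hi')) _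
    · intro h
      exact absurd (Finset.mem_range.2 hi) h
  · rw [indicator_of_notMem (fun h => hsN h.2), Finset.sum_eq_zero]
    intro j hj
    exact indicator_of_notMem
      (fun h => hsN (h.2.trans_le (ht (Finset.mem_range.1 hj)))) _

/-- Two functionals that represent the same distribution agree on piecewise polynomials. -/
theorem EqRLDeriv.eq_on_piecewisePoly {γ T : ℝ} {h0 : 0 < α} {h1 : α < 1 / 2} {hT : 0 < T}
    {F G : FracDual e α 0 T} {w : ℝ → X} (hF : EqRLDeriv h0 h1 hT F γ w)
    (hG : EqRLDeriv h0 h1 hT G γ w) {t : ℕ → ℝ} (ht : Monotone t) (ht0 : t 0 = 0)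
    {N q : ℕ} (htN : t N = T) {V : ℝ → X} (hV : IsPiecewisePoly t N q V)
    {v : FracSpace e α 0 T} (hv : v.1 =ᵐ[volume.restrict (Ioo 0 T)] V) : F.1 v = G.1 v := by
  have h := FracDual.eq_zero_of_piecewisePoly ht ht0 htN.le h0 h1 (F - G)
    (fun φ hφ x hm => ?_) hV (v := v) ?_
  · exact sub_eq_zero.1 h
  · rw [htN] at hφ
    change F.1 _ - G.1 _ = 0
    rw [hF φ hφ x, hG φ hφ x, sub_self]
  · rw [htN]
    exact hv.trans ((indicator_ae_eq_restrict measurableSet_Ioo).symm)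

/-- Causality: if `g` vanishes on `(0, t_N)`, then the functional of its fractional derivative
vanishes on the piecewise polynomials supported in `(0, t_N)`. -/
theorem fracForm_eq_zero_of_support [CompleteSpace X] {γ T : ℝ} (hγ : 1 < γ) (hγ' : γ < 2)
    (hT : 0 < T) {t : ℕ → ℝ} (ht : Monotone t) (ht0 : t 0 = 0) {N q : ℕ} (htN : t N ≤ T)
    {g : FracSpace e ((γ - 1) / 2) 0 T} (hg : ∀ s ∈ Ioo 0 (t N), g.1 s = 0)
    {V : ℝ → X} (hV : IsPiecewisePoly t N q V) {v : FracSpace e ((γ - 1) / 2) 0 T}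
    (hv : v.1 =ᵐ[volume.restrict (Ioo 0 T)] (Ioo 0 (t N)).indicator V) :
    fracForm e _ 0 T g v = 0 := by
  have hR := eqRLDeriv_fracFunctional hγ hγ' hT g (w := fun t => ∫ s in (0 : ℝ)..t, g.1 s)
    fun _ _ => rfl
  refine FracDual.eq_zero_of_piecewisePoly ht ht0 htN (gamma0_pos hγ) (gamma0_lt hγ')
    (fracFunctional g) (fun φ hφ x hm => ?_) hV hv
  have hφT : IsTestFun (Ioo 0 T) φ := ⟨hφ.1, hφ.2.1, hφ.2.2.trans (Ioo_subset_Ioo_right htN)⟩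
  rw [hR φ hφT x]
  -- Before `t_N` the primitive and its fractional integral vanish, since both look only into the
  -- past; from `t_N` on, the test function vanishes.
  have hz : rlDeriv γ T (fun t => ∫ s in (0 : ℝ)..t, g.1 s) φ = 0 := by
    unfold rlDeriv
    refine intervalIntegral.integral_zero_ae (Eventually.of_forall fun s hs => ?_)
    rw [uIoc_of_le hT.le] at hs
    by_cases hsN : s < t N
    · have h2 : rlIntegral (2 - γ) (fun t => ∫ s in (0 : ℝ)..t, g.1 s) s =
          rlIntegral (2 - γ) (fun _ => (0 : X)) s := by
        refine rlIntegral_congr _ hs.1.le fun r hr => ?_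
        rw [intervalIntegral.integral_of_le hr.1, integral_Ioc_eq_integral_Ioo]
        refine setIntegral_eq_zero_of_forall_eq_zero fun y hy => hg y ⟨hy.1, ?_⟩
        exact hy.2.trans_le (hr.2.trans hsN.le)
      rw [h2]
      simp [rlIntegral]
    · rw [(hφ.iteratedDeriv_two).eq_zero fun h => hsN h.2, zero_smul]
  rw [hz, inner_zero_left]

end Density

/-! ### The norm of constant functions -/

section Const

lemma fourier_indicator_scaled {b : ℝ} (hb : 0 < b) (ξ : ℝ) :
    𝓕 ((Ioo 0 b).indicator fun _ => (1 : ℂ)) ξ =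
      b * 𝓕 ((Ioo (0 : ℝ) 1).indicator fun _ => (1 : ℂ)) (b * ξ) := by
  rw [Real.fourier_real_eq_integral_exp_smul, Real.fourier_real_eq_integral_exp_smul]
  have h := Measure.integral_comp_mul_left (fun t : ℝ => Complex.exp (↑(-2 * Real.pi * t * ξ) *
    Complex.I) • (Ioo 0 b).indicator (fun _ => (1 : ℂ)) t) b
  rw [abs_of_pos (inv_pos.2 hb), eq_inv_smul_iff₀ hb.ne'] at h
  rw [← h, Complex.real_smul]
  congr 2
  funext t
  congr 1
  · ring_nf
  · have : b * t ∈ Ioo 0 b ↔ t ∈ Ioo (0 : ℝ) 1 := by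
      rw [mem_Ioo, mem_Ioo, mul_pos_iff_of_pos_left hb]
      exact and_congr_right fun _ => ⟨fun h => by nlinarith, fun h => by nlinarith⟩
    by_cases ht : t ∈ Ioo (0 : ℝ) 1
    · rw [indicator_of_mem ht, indicator_of_mem (this.2 ht)]
    · rw [indicator_of_notMem ht, indicator_of_notMem (fun h => ht (this.1 h))]

/-- Dilation by `b` contributes `b²` through the squared transform, `b^{-2α}` through the weight and
`b^{-1}` through `dξ`. -/
lemma scalarEnergy_indicator_scaled (α : ℝ) {b : ℝ} (hb : 0 < b) :
    scalarEnergy α ((Ioo 0 b).indicator fun _ => (1 : ℂ)) =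
      ENNReal.ofReal (b ^ (1 - 2 * α)) *
        scalarEnergy α ((Ioo (0 : ℝ) 1).indicator fun _ => (1 : ℂ)) := by
  unfold scalarEnergy
  set G : ℝ → ENNReal := fun ξ => ENNReal.ofReal (|2 * Real.pi * ξ| ^ (2 * α)) *
    ‖𝓕 ((Ioo (0 : ℝ) 1).indicator fun _ => (1 : ℂ)) ξ‖ₑ ^ 2 with hG
  have hi : Integrable ((Ioo (0 : ℝ) 1).indicator fun _ => (1 : ℂ)) := by
    simpa using integrable_indicator_Ioo (c := 0) (d := 1) (g := fun _ => (1 : ℝ)) continuous_const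
  have hGm : Measurable G := by
    have := (fourier_continuous hi).measurable
    fun_prop
  have h1 : ∀ ξ, ENNReal.ofReal (|2 * Real.pi * ξ| ^ (2 * α)) *
      ‖𝓕 ((Ioo (0 : ℝ) b).indicator fun _ => (1 : ℂ)) ξ‖ₑ ^ 2 =
      ENNReal.ofReal (b ^ (2 - 2 * α)) * G (b * ξ) := by
    intro ξ
    rw [fourier_indicator_scaled hb, hG, enorm_mul, mul_pow, ← mul_assoc, ← mul_assoc]
    congr 1
    have e1 : ‖(b : ℂ)‖ₑ ^ 2 = ENNReal.ofReal (b ^ (2 : ℝ)) := by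
      rw [← ofReal_norm, ← ENNReal.ofReal_pow (norm_nonneg _), Complex.norm_real,
        Real.norm_of_nonneg hb.le, Real.rpow_two]
    rw [e1, ← ENNReal.ofReal_mul (by positivity), ← ENNReal.ofReal_mul (by positivity)]
    congr 1
    rw [show 2 * Real.pi * (b * ξ) = b * (2 * Real.pi * ξ) by ring, abs_mul b, abs_of_pos hb,
      Real.mul_rpow hb.le (abs_nonneg _), ← mul_assoc, ← Real.rpow_add hb, mul_comm]
    ring_nf
  simp only [h1]
  rw [lintegral_const_mul' _ _ ENNReal.ofReal_ne_top]
  have h2 : ∫⁻ ξ, G (b * ξ) = ENNReal.ofReal b⁻¹ * ∫⁻ ξ, G ξ := by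
    have h3 := lintegral_map (μ := volume) hGm (measurable_const_mul b)
    rw [← h3, Real.map_volume_mul_left hb.ne', lintegral_smul_measure,
      abs_of_pos (inv_pos.2 hb)]
    rfl
  rw [h2, ← mul_assoc, ← ENNReal.ofReal_mul (by positivity)]
  congr 2
  rw [← Real.rpow_neg_one, ← Real.rpow_add hb]
  congr 1
  ring

/-- `K` is the scalar norm of the indicator of `(0, 1)`. It is chosen before the space and the
basis, so the final constant cannot depend on the domain. -/
lemma exists_fracNorm_const_eq (α : ℝ) : ∃ K : ℝ, 0 ≤ K ∧
    ∀ {X : Type} [NormedAddCommGroup X] [InnerProductSpace ℝ X] (e : HilbertBasis ℕ ℝ X) (b : ℝ),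
      0 < b → ∀ x : X, fracNorm e α 0 b (fun _ => x) = K * b ^ (1 / 2 - α) * ‖x‖ := by
  refine ⟨Real.sqrt (scalarEnergy α ((Ioo (0 : ℝ) 1).indicator fun _ => (1 : ℂ))).toReal,
    Real.sqrt_nonneg _, fun {X} _ _ e b hb x => ?_⟩
  have h := fracEnergy_smul_const e α 0 b (fun _ => 1) x
  simp only [one_smul, Complex.ofReal_one] at h
  rw [fracNorm, h, scalarEnergy_indicator_scaled α hb, ENNReal.toReal_mul, ENNReal.toReal_mul,
    ENNReal.toReal_ofReal (by positivity), ENNReal.toReal_ofReal (by positivity),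
    Real.sqrt_mul (by positivity), Real.sqrt_mul (by positivity), Real.sqrt_sq (norm_nonneg _),
    Real.sqrt_eq_rpow (b ^ _), ← Real.rpow_mul hb.le]
  ring_nf

end Const

/-! ### Weak gradients and the space `H_0^1` -/

section WeakGrad

variable {d : ℕ} {Ω : Set (EuclideanSpace ℝ (Fin d))} {φ : EuclideanSpace ℝ (Fin d) → ℝ}

lemma IsTestFun.continuous_fderiv' (hφ : IsTestFun Ω φ) : Continuous (fderiv ℝ φ) :=
  hφ.1.continuous_fderiv (by simp)

lemma IsTestFun.continuous_gradient (hφ : IsTestFun Ω φ) : Continuous (∇ φ) :=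
  (InnerProductSpace.toDual ℝ (EuclideanSpace ℝ (Fin d))).symm.continuous.comp hφ.continuous_fderiv'

lemma IsTestFun.compactSupport_gradient (hφ : IsTestFun Ω φ) : HasCompactSupport (∇ φ) :=
  (hφ.2.1.fderiv ℝ).comp_left (g := (InnerProductSpace.toDual ℝ (EuclideanSpace ℝ (Fin d))).symm)
    (map_zero _)

lemma IsTestFun.memLp (hφ : IsTestFun Ω φ) : MemLp φ 2 (volume.restrict Ω) :=
  hφ.1.continuous.memLp_of_hasCompactSupport hφ.2.1

lemma IsTestFun.memLp_gradient (hφ : IsTestFun Ω φ) : MemLp (∇ φ) 2 (volume.restrict Ω) :=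
  hφ.continuous_gradient.memLp_of_hasCompactSupport hφ.compactSupport_gradient

lemma IsTestFun.memLp_fderiv (hφ : IsTestFun Ω φ) (y : EuclideanSpace ℝ (Fin d)) :
    MemLp (fun x => fderiv ℝ φ x y) 2 (volume.restrict Ω) := by
  refine Continuous.memLp_of_hasCompactSupport (hφ.continuous_fderiv'.clm_apply continuous_const) ?_
  exact (hφ.2.1.fderiv ℝ).comp_left (g := fun L : EuclideanSpace ℝ (Fin d) →L[ℝ] ℝ => L y) rfl

lemma IsTestFun.memLp_smul (hφ : IsTestFun Ω φ) (y : EuclideanSpace ℝ (Fin d)) :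
    MemLp (fun x => φ x • y) 2 (volume.restrict Ω) := by
  refine Continuous.memLp_of_hasCompactSupport (hφ.1.continuous.smul continuous_const) ?_
  exact hφ.2.1.comp_left (g := fun r : ℝ => r • y) (zero_smul ℝ y)

lemma IsTestFun.eq_zero_of_notMem (hφ : IsTestFun Ω φ) {x : EuclideanSpace ℝ (Fin d)} (hx : x ∉ Ω)
    : φ x = 0 :=
  image_eq_zero_of_notMem_tsupport fun h => hx (hφ.2.2 h)

lemma inner_integral_smul_gradient (hφ : IsTestFun Ω φ) (v : L2 Ω) (y : EuclideanSpace ℝ (Fin d)) :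
    inner ℝ y (∫ x in Ω, v x • ∇ φ x) = inner ℝ ((hφ.memLp_fderiv y).toLp _) v := by
  have hi : Integrable (fun x => v x • ∇ φ x) (volume.restrict Ω) :=
    memLp_one_iff_integrable.1 (hφ.memLp_gradient.smul (Lp.memLp v))
  rw [← integral_inner hi, L2.inner_def]
  refine integral_congr_ae ?_
  filter_upwards [(hφ.memLp_fderiv y).coeFn_toLp] with x hx
  rw [hx, inner_smul_right, real_inner_comm, inner_gradient_left]
  rfl

lemma inner_integral_smul (hφ : IsTestFun Ω φ) (g : L2Vec Ω) (y : EuclideanSpace ℝ (Fin d)) :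
    inner ℝ y (∫ x in Ω, φ x • g x) = inner ℝ ((hφ.memLp_smul y).toLp _) g := by
  have hi : Integrable (fun x => φ x • g x) (volume.restrict Ω) :=
    memLp_one_iff_integrable.1 ((Lp.memLp g).smul hφ.memLp)
  rw [← integral_inner hi, L2.inner_def]
  refine integral_congr_ae ?_
  filter_upwards [(hφ.memLp_smul y).coeFn_toLp] with x hx
  rw [hx, inner_smul_right, real_inner_smul_left]

/-- Pairing the vector identity with each `y` expresses it by inner products with fixed elements of
`L²`. In this form it is visibly linear and closed in `(v, g)`. -/
lemma hasWeakGrad_iff {v : L2 Ω} {g : L2Vec Ω} : HasWeakGrad v g ↔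
    ∀ φ (hφ : IsTestFun Ω φ) (y : EuclideanSpace ℝ (Fin d)),
      inner ℝ ((hφ.memLp_fderiv y).toLp _) v + inner ℝ ((hφ.memLp_smul y).toLp _) g = 0 := by
  unfold HasWeakGrad
  refine forall_congr' fun φ => forall_congr' fun hφ => ?_
  rw [← add_eq_zero_iff_eq_neg]
  refine ⟨fun h y => ?_, fun h => ?_⟩
  · rw [← inner_integral_smul_gradient hφ, ← inner_integral_smul hφ, ← inner_add_right, h,
      inner_zero_right]
  · refine ext_inner_left ℝ fun y => ?_
    rw [inner_add_right, inner_integral_smul_gradient hφ, inner_integral_smul hφ, h,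
      inner_zero_right]

lemma HasWeakGrad.add {v w : L2 Ω} {g k : L2Vec Ω} (h : HasWeakGrad v g) (h' : HasWeakGrad w k) :
    HasWeakGrad (v + w) (g + k) := by
  rw [hasWeakGrad_iff] at *
  intro φ hφ y
  rw [inner_add_right, inner_add_right]
  linear_combination h φ hφ y + h' φ hφ y

lemma HasWeakGrad.smul {v : L2 Ω} {g : L2Vec Ω} (h : HasWeakGrad v g) (c : ℝ) :
    HasWeakGrad (c • v) (c • g) := by
  rw [hasWeakGrad_iff] at *
  intro φ hφ y
  rw [inner_smul_right, inner_smul_right]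
  linear_combination c * h φ hφ y

lemma hasWeakGrad_zero : HasWeakGrad (0 : L2 Ω) 0 := by
  rw [hasWeakGrad_iff]
  intro φ hφ y
  simp

/-- The fundamental lemma of the calculus of variations; it makes the second component of an element
of `H_0^1` a function of the first. -/
lemma HasWeakGrad.eq_zero (hΩ : IsOpen Ω) {g : L2Vec Ω} (h : HasWeakGrad (0 : L2 Ω) g) :
    g = 0 := by
  have h2 := hΩ.ae_eq_zero_of_integral_contDiff_smul_eq_zero (μ := volume) (f := g) ?_ ?_
  · refine Lp.ext ?_
    have h3 := (ae_restrict_iff' hΩ.measurableSet).2 h2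
    filter_upwards [h3, Lp.coeFn_zero (EuclideanSpace ℝ (Fin d)) 2 (volume.restrict Ω)] with x hx
      hx'
    rw [hx, hx']
    rfl
  · have hg : LocallyIntegrable g (volume.restrict Ω) :=
      (Lp.memLp g).locallyIntegrable (by norm_num)
    exact (locallyIntegrableOn_of_locallyIntegrable_restrict hg)
  · intro φ h1 h2 h3
    have hφ : IsTestFun Ω φ := ⟨h1, h2, h3⟩
    have h4 : ∫ x in Ω, φ x • g x = 0 := by
      refine ext_inner_left ℝ fun y => ?_
      rw [inner_integral_smul hφ, inner_zero_right]
      have := hasWeakGrad_iff.1 h φ hφ y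
      rwa [inner_zero_right, zero_add] at this
    rw [← h4, setIntegral_eq_integral_of_forall_compl_eq_zero]
    intro x hx
    rw [hφ.eq_zero_of_notMem hx, zero_smul]

lemma isTestFun_zero : IsTestFun Ω (0 : EuclideanSpace ℝ (Fin d) → ℝ) := by
  refine ⟨contDiff_const, HasCompactSupport.zero, ?_⟩
  rw [tsupport_eq_empty_iff.2 rfl]
  exact empty_subset _

lemma IsTestFun.add {ψ : EuclideanSpace ℝ (Fin d) → ℝ} (hφ : IsTestFun Ω φ) (hψ : IsTestFun Ω ψ) :
    IsTestFun Ω (φ + ψ) :=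
  ⟨hφ.1.add hψ.1, hφ.2.1.add hψ.2.1,
    (tsupport_add φ ψ).trans (union_subset hφ.2.2 hψ.2.2)⟩

lemma IsTestFun.const_smul (hφ : IsTestFun Ω φ) (c : ℝ) : IsTestFun Ω (c • φ) :=
  ⟨hφ.1.const_smul c, hφ.2.1.smul_left (f := fun _ => c),
    (tsupport_smul_subset_right (fun _ => c) φ).trans hφ.2.2⟩

lemma gradient_add' {ψ : EuclideanSpace ℝ (Fin d) → ℝ} (hφ : IsTestFun Ω φ) (hψ : IsTestFun Ω ψ) (x
    : EuclideanSpace ℝ (Fin d)) :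
    ∇ (φ + ψ) x = ∇ φ x + ∇ ψ x := by
  unfold gradient
  rw [fderiv_add (hφ.1.differentiable (by simp) x) (hψ.1.differentiable (by simp) x), map_add]

lemma gradient_smul' (hφ : IsTestFun Ω φ) (c : ℝ) (x : EuclideanSpace ℝ (Fin d)) : ∇ (c • φ) x = c
    • ∇ φ x := by
  unfold gradient
  rw [fderiv_const_smul (hφ.1.differentiable (by simp) x)]
  simp

/-- A closed condition that holds for the test functions holds in `H_0^1(Ω)`. -/
lemma H01.induction {P : L2 Ω × L2Vec Ω → Prop} (hP : IsClosed {p | P p})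
    (h : ∀ (p : L2 Ω × L2Vec Ω) φ, IsTestFun Ω φ → p.1 =ᵐ[volume.restrict Ω] φ →
      p.2 =ᵐ[volume.restrict Ω] ∇ φ → P p) {p : L2 Ω × L2Vec Ω} (hp : p ∈ H01 Ω) : P p := by
  refine closure_minimal ?_ hP hp
  intro q hq
  -- The generating pairs already form a subspace, so every element of the span is again represented
  -- by a single test function.
  have hex : ∃ φ : EuclideanSpace ℝ (Fin d) → ℝ, IsTestFun Ω φ ∧
      q.1 =ᵐ[volume.restrict Ω] φ ∧ q.2 =ᵐ[volume.restrict Ω] ∇ φ := by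
    refine Submodule.span_induction (fun x hx => hx) ?_ ?_ ?_ hq
    · refine ⟨0, isTestFun_zero, Lp.coeFn_zero _ _ _, ?_⟩
      have : ∇ (0 : EuclideanSpace ℝ (Fin d) → ℝ) = 0 := funext fun x => gradient_const x (0 : ℝ)
      rw [this]
      exact Lp.coeFn_zero _ _ _
    · rintro x y _ _ ⟨φ, hφ, h1, h2⟩ ⟨ψ, hψ, h3, h4⟩
      refine ⟨φ + ψ, hφ.add hψ, (Lp.coeFn_add _ _).trans (h1.add h3),
        (Lp.coeFn_add _ _).trans ((h2.add h4).trans (Filter.Eventually.of_forall fun z => ?_))⟩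
      exact (gradient_add' hφ hψ z).symm
    · rintro c x _ ⟨φ, hφ, h1, h2⟩
      refine ⟨c • φ, hφ.const_smul c, (Lp.coeFn_smul _ _).trans (h1.const_smul c),
        (Lp.coeFn_smul _ _).trans
          ((h2.const_smul c).trans (Filter.Eventually.of_forall fun z => ?_))⟩
      exact (gradient_smul' hφ c z).symm
  obtain ⟨φ, hφ, h1, h2⟩ := hex
  exact h q φ hφ h1 h2

lemma IsTestFun.integrable_mul {ψ : EuclideanSpace ℝ (Fin d) → ℝ} (hφ : IsTestFun Ω φ) (hψ :
    Continuous ψ) :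
    Integrable fun x => φ x * ψ x :=
  (hφ.1.continuous.mul hψ).integrable_of_hasCompactSupport hφ.2.1.mul_right

lemma IsTestFun.integrable_fderiv_mul {ψ : EuclideanSpace ℝ (Fin d) → ℝ} (hφ : IsTestFun Ω φ) (hψ :
    Continuous ψ)
    (y : EuclideanSpace ℝ (Fin d)) : Integrable fun x => fderiv ℝ φ x y * ψ x := by
  refine ((hφ.continuous_fderiv'.clm_apply continuous_const).mul
    hψ).integrable_of_hasCompactSupport (HasCompactSupport.mul_right ?_)
  exact (hφ.2.1.fderiv ℝ).comp_left (g := fun L : EuclideanSpace ℝ (Fin d) →L[ℝ] ℝ => L y) rfl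

/-- The condition is closed, so it is enough to integrate by parts with two test functions. -/
lemma H01.hasWeakGrad {p : L2 Ω × L2Vec Ω} (hp : p ∈ H01 Ω) : HasWeakGrad p.1 p.2 := by
  rw [hasWeakGrad_iff]
  intro φ hφ y
  refine H01.induction (P := fun p => inner ℝ ((hφ.memLp_fderiv y).toLp _) p.1 +
    inner ℝ ((hφ.memLp_smul y).toLp _) p.2 = 0) ?_ ?_ hp
  · exact isClosed_eq (by fun_prop) continuous_const
  · intro p ψ hψ h1 h2
    have e1 : inner ℝ ((hφ.memLp_fderiv y).toLp _) p.1 = ∫ x, ψ x * fderiv ℝ φ x y := by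
      rw [L2.inner_def]
      refine Eq.trans ?_ (setIntegral_eq_integral_of_forall_compl_eq_zero (s := Ω)
        fun x hx => by rw [hψ.eq_zero_of_notMem hx, zero_mul])
      refine integral_congr_ae ?_
      filter_upwards [(hφ.memLp_fderiv y).coeFn_toLp, h1] with x hx hx'
      rw [hx, hx']
      rfl
    have e2 : inner ℝ ((hφ.memLp_smul y).toLp _) p.2 = ∫ x, fderiv ℝ ψ x y * φ x := by
      rw [L2.inner_def]
      refine Eq.trans ?_ (setIntegral_eq_integral_of_forall_compl_eq_zero (s := Ω)
        fun x hx => by rw [hφ.eq_zero_of_notMem hx, mul_zero])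
      refine integral_congr_ae ?_
      filter_upwards [(hφ.memLp_smul y).coeFn_toLp, h2] with x hx hx'
      rw [hx, hx', real_inner_smul_left, real_inner_comm, inner_gradient_left, mul_comm]
    rw [e1, e2, integral_mul_fderiv_eq_neg_fderiv_mul_of_integrable, neg_add_cancel]
    · exact hψ.integrable_fderiv_mul hφ.1.continuous y
    · exact hψ.integrable_mul (hφ.continuous_fderiv'.clm_apply continuous_const)
    · exact hψ.integrable_mul hφ.1.continuous
    · exact fun x _ => hψ.1.differentiable (by simp) x
    · exact fun x _ => hφ.1.differentiable (by simp) x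

/-- Integration by parts of `φ²` against the linear function `L`, whose derivative in the direction
`y` is `1`. -/
lemma IsTestFun.integral_sq_eq (hφ : IsTestFun Ω φ) (L : EuclideanSpace ℝ (Fin d) →L[ℝ] ℝ) {y :
    EuclideanSpace ℝ (Fin d)} (hy : L y = 1) :
    ∫ x, φ x ^ 2 = -∫ x, L x * (2 * φ x * fderiv ℝ φ x y) := by
  have hc := hφ.1.continuous
  have hc' : Continuous fun x => fderiv ℝ φ x y := hφ.continuous_fderiv'.clm_apply continuous_const
  have hsq : ∀ x, fderiv ℝ (fun x => φ x * φ x) x y = 2 * φ x * fderiv ℝ φ x y := by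
    intro x
    have h := (hφ.1.differentiable (by simp) x).hasFDerivAt
    have h2 : HasFDerivAt (fun x => φ x * φ x) _ x := h.mul h
    rw [h2.fderiv]
    simp only [_root_.add_apply, _root_.smul_apply, smul_eq_mul]
    ring
  have hLd : ∀ x, fderiv ℝ (fun x => L x) x y = 1 := fun x => by
    rw [L.fderiv, hy]
  have hI1 : Integrable fun x => φ x * φ x := hφ.integrable_mul hc
  have hI2 : Integrable fun x => L x * (2 * φ x * fderiv ℝ φ x y) := by
    have h := hφ.integrable_mul (ψ := fun x => 2 * L x * fderiv ℝ φ x y)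
      ((continuous_const.mul L.continuous).mul hc')
    have e : (fun x => L x * (2 * φ x * fderiv ℝ φ x y)) =
        fun x => φ x * (2 * L x * fderiv ℝ φ x y) := by
      funext x
      ring
    rw [e]
    exact h
  have hI3 : Integrable fun x => L x * (φ x * φ x) := by
    have h := hφ.integrable_mul (ψ := fun x => L x * φ x) (L.continuous.mul hc)
    have e : (fun x => L x * (φ x * φ x)) = fun x => φ x * (L x * φ x) := by
      funext x
      ring
    rw [e]
    exact h
  have hparts := integral_mul_fderiv_eq_neg_fderiv_mul_of_integrable (μ := volume)
    (f := fun x => L x) (g := fun x => φ x * φ x) (v := y)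
    (by simp only [hLd, one_mul]; exact hI1) (by simp only [hsq]; exact hI2) hI3
    (fun x _ => L.differentiableAt) (fun x _ =>
      (hφ.1.differentiable (by simp) x).mul (hφ.1.differentiable (by simp) x))
  simp only [hsq, hLd, one_mul] at hparts
  rw [hparts, neg_neg]
  simp only [sq]

lemma IsTestFun.abs_fderiv_le (x : EuclideanSpace ℝ (Fin d)) {y : EuclideanSpace ℝ (Fin d)} (hy :
    ‖y‖ ≤ 1) :
    |fderiv ℝ φ x y| ≤ ‖∇ φ x‖ := by
  rw [← inner_gradient_left]
  exact (abs_real_inner_le_norm _ _).trans (mul_le_of_le_one_right (norm_nonneg _) hy)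

/-- Young's inequality, from `(p + 2lf)² ≥ 0`. The coefficient `1/2` is what allows the `p²` term to
be absorbed in the Poincaré inequality. -/
lemma neg_mul_two_mul_le {l R f G : ℝ} (hl : |l| ≤ R) (hf : |f| ≤ G) (p : ℝ) :
    -(l * (2 * p * f)) ≤ (1 / 2) * p ^ 2 + 2 * R ^ 2 * G ^ 2 := by
  have h3 : |l * f| ≤ R * G := by
    rw [abs_mul]
    exact mul_le_mul hl hf (abs_nonneg _) ((abs_nonneg _).trans hl)
  have h4 : (l * f) ^ 2 ≤ (R * G) ^ 2 :=
    sq_le_sq' (by linarith [neg_abs_le (l * f)]) ((le_abs_self _).trans h3)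
  nlinarith [sq_nonneg (p + 2 * (l * f))]

/-- The Poincaré inequality for test functions. -/
lemma IsTestFun.poincare (hφ : IsTestFun Ω φ) (L : EuclideanSpace ℝ (Fin d) →L[ℝ] ℝ) {y :
    EuclideanSpace ℝ (Fin d)} (hy : L y = 1)
    (hy' : ‖y‖ ≤ 1) {R : ℝ} (hR : ∀ x ∈ Ω, |L x| ≤ R) :
    ∫ x, φ x ^ 2 ≤ 4 * R ^ 2 * ∫ x, ‖∇ φ x‖ ^ 2 := by
  have hI1 : Integrable fun x => φ x ^ 2 := by
    simp only [sq]
    exact hφ.integrable_mul hφ.1.continuous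
  have hI3 : Integrable fun x => ‖∇ φ x‖ ^ 2 :=
    memLp_one_iff_integrable.1 <| by
      refine Continuous.memLp_of_hasCompactSupport (hφ.continuous_gradient.norm.pow 2) ?_
      exact hφ.compactSupport_gradient.norm.comp_left (g := fun z : ℝ => z ^ 2) (by simp)
  have hpt : ∀ x, -(L x * (2 * φ x * fderiv ℝ φ x y)) ≤
      (1 / 2) * φ x ^ 2 + 2 * R ^ 2 * ‖∇ φ x‖ ^ 2 := by
    intro x
    by_cases hx : x ∈ Ω
    · exact neg_mul_two_mul_le (hR x hx) (IsTestFun.abs_fderiv_le x hy') (φ x)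
    · rw [hφ.eq_zero_of_notMem hx]
      simp only [mul_zero, zero_mul, neg_zero]
      positivity
  have hr : Integrable fun x => (1 / 2) * φ x ^ 2 + 2 * R ^ 2 * ‖∇ φ x‖ ^ 2 :=
    (hI1.const_mul (1 / 2)).add (hI3.const_mul (2 * R ^ 2))
  have hmono : ∫ x, φ x ^ 2 ≤ ∫ x, ((1 / 2) * φ x ^ 2 + 2 * R ^ 2 * ‖∇ φ x‖ ^ 2) := by
    rw [hφ.integral_sq_eq L hy, ← integral_neg]
    -- Without integrability the integral is `0` by convention, and the right-hand side is
    -- nonnegative anyway.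
    by_cases hi : Integrable fun x => -(L x * (2 * φ x * fderiv ℝ φ x y))
    · exact integral_mono hi hr hpt
    · rw [integral_undef hi]
      exact integral_nonneg fun x => by positivity
  rw [integral_add (hI1.const_mul _) (hI3.const_mul _), integral_const_mul,
    integral_const_mul] at hmono
  linarith

lemma H01.poincare (i : Fin d) {R : ℝ} (hR : ∀ x ∈ Ω, |x i| ≤ R) {p : L2 Ω × L2Vec Ω}
    (hp : p ∈ H01 Ω) : ‖p.1‖ ^ 2 ≤ 4 * R ^ 2 * ‖p.2‖ ^ 2 := by
  refine H01.induction (P := fun p => ‖p.1‖ ^ 2 ≤ 4 * R ^ 2 * ‖p.2‖ ^ 2) ?_ ?_ hp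
  · exact isClosed_le (by fun_prop) (by fun_prop)
  · intro p φ hφ h1 h2
    have e1 : ‖p.1‖ ^ 2 = ∫ x, φ x ^ 2 := by
      rw [← real_inner_self_eq_norm_sq, L2.inner_def]
      refine Eq.trans ?_ (setIntegral_eq_integral_of_forall_compl_eq_zero (s := Ω)
        fun x hx => by rw [hφ.eq_zero_of_notMem hx, sq, zero_mul])
      refine integral_congr_ae ?_
      filter_upwards [h1] with x hx
      rw [hx, real_inner_self_eq_norm_sq, Real.norm_eq_abs, sq_abs]
    have e2 : ‖p.2‖ ^ 2 = ∫ x, ‖∇ φ x‖ ^ 2 := by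
      rw [← real_inner_self_eq_norm_sq, L2.inner_def]
      refine Eq.trans ?_ (setIntegral_eq_integral_of_forall_compl_eq_zero (s := Ω) fun x hx => ?_)
      · refine integral_congr_ae ?_
        filter_upwards [h2] with x hx
        rw [hx, real_inner_self_eq_norm_sq]
      · have h3 : fderiv ℝ φ x = 0 := image_eq_zero_of_notMem_tsupport fun h =>
          hx (hφ.2.2 (tsupport_fderiv_subset ℝ h))
        simp [gradient, h3]
    rw [e1, e2]
    exact hφ.poincare (EuclideanSpace.proj i) (y := EuclideanSpace.single i 1) (by simp) (by simp)
        hR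

end WeakGrad

/-! ### Finite element spaces -/

section FiniteElement

variable {d : ℕ} {Ω : Set (EuclideanSpace ℝ (Fin d))}
  {𝒦 : Finset (Finset (EuclideanSpace ℝ (Fin d)))} {n : ℕ}

lemma isCompact_convexHull_finset (K : Finset (EuclideanSpace ℝ (Fin d))) :
    IsCompact (convexHull ℝ (K : Set (EuclideanSpace ℝ (Fin d)))) :=
  K.finite_toSet.isCompact_convexHull ℝ

lemma continuous_eval_coord (p : MvPolynomial (Fin d) ℝ) :
    Continuous fun x : EuclideanSpace ℝ (Fin d) => MvPolynomial.eval (fun i => x i) p :=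
  (MvPolynomial.continuous_eval p).comp (continuous_pi fun i => by fun_prop)

lemma memLp_eval_coord (p : MvPolynomial (Fin d) ℝ) {s : Set (EuclideanSpace ℝ (Fin d))}
    (hs : IsCompact s) : MemLp (fun x : EuclideanSpace ℝ (Fin d) =>
      MvPolynomial.eval (fun i => x i) p) 2 ((volume.restrict Ω).restrict s) := by
  refine MemLp.mono_measure (Measure.restrict_mono_measure Measure.restrict_le_self s) ?_
  have : IsFiniteMeasure (volume.restrict s) := ⟨by simpa using hs.measure_lt_top⟩
  obtain ⟨B, hB⟩ := hs.exists_bound_of_continuousOn (continuous_eval_coord p).continuousOn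
  refine MemLp.of_bound (continuous_eval_coord p).aestronglyMeasurable B ?_
  exact (ae_restrict_iff' hs.measurableSet).2 (Filter.Eventually.of_forall hB)

/-- Polynomials of degree `≤ n` as elements of `L²` of a compact set. -/
def polyToLp (Ω : Set (EuclideanSpace ℝ (Fin d))) (n : ℕ) {s : Set (EuclideanSpace ℝ (Fin d))}
    (hs : IsCompact s) : MvPolynomial.restrictTotalDegree (Fin d) ℝ n →ₗ[ℝ]
      Lp ℝ 2 ((volume.restrict Ω).restrict s) where
  toFun p := (memLp_eval_coord p.1 hs).toLp _
  map_add' p q := by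
    rw [← MemLp.toLp_add]
    congr 1
    funext x
    simp
  map_smul' c p := by
    rw [RingHom.id_apply, ← MemLp.toLp_const_smul]
    congr 1
    funext x
    simp [MvPolynomial.smul_eval]

/-- Restriction of functions in `L²(Ω)` to a subset. -/
def restrictLp (Ω s : Set (EuclideanSpace ℝ (Fin d))) :
    L2 Ω →ₗ[ℝ] Lp ℝ 2 ((volume.restrict Ω).restrict s) :=
  (LpToLpRestrictCLM _ ℝ ℝ (volume.restrict Ω) 2 s).toLinearMap

lemma coeFn_restrictLp (s : Set (EuclideanSpace ℝ (Fin d))) (v : L2 Ω) :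
    restrictLp Ω s v =ᵐ[(volume.restrict Ω).restrict s] v :=
  LpToLpRestrictCLM_coeFn ℝ s v

lemma restrict_mem_range_polyToLp {v : L2 Ω} (hv : v ∈ piecewisePoly Ω 𝒦 n)
    {K : Finset (EuclideanSpace ℝ (Fin d))} (hK : K ∈ 𝒦) :
    restrictLp Ω (convexHull ℝ (K : Set _)) v ∈
      LinearMap.range (polyToLp Ω n (isCompact_convexHull_finset K)) := by
  obtain ⟨p, hp, hp'⟩ := hv K hK
  refine ⟨⟨p, (MvPolynomial.mem_restrictTotalDegree _ _ _).2 hp⟩, ?_⟩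
  refine Lp.ext ?_
  refine (memLp_eval_coord p (isCompact_convexHull_finset K)).coeFn_toLp.trans
    (Filter.EventuallyEq.trans ?_ (coeFn_restrictLp _ v).symm)
  refine (ae_restrict_iff' (isCompact_convexHull_finset K).measurableSet).2 ?_
  filter_upwards [hp'] with x hx hxK
  exact (hx hxK).symm

/-- Restriction of a piecewise polynomial function to one of the simplices. -/
def restrictPoly {K : Finset (EuclideanSpace ℝ (Fin d))} (hK : K ∈ 𝒦) :
    piecewisePoly Ω 𝒦 n →ₗ[ℝ] LinearMap.range (polyToLp Ω n (isCompact_convexHull_finset K)) where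
  toFun v := ⟨restrictLp Ω (convexHull ℝ (K : Set _)) v.1, restrict_mem_range_polyToLp v.2 hK⟩
  map_add' v w := Subtype.ext (map_add _ v.1 w.1)
  map_smul' c v := Subtype.ext (map_smul _ c v.1)

lemma finite_of_jointly_injective {V ι : Type*} [Finite ι] {M : ι → Type*} [AddCommGroup V]
    [Module ℝ V] [∀ i, AddCommGroup (M i)] [∀ i, Module ℝ (M i)] [∀ i, Module.Finite ℝ (M i)]
    (L : ∀ i, V →ₗ[ℝ] M i) (hinj : ∀ v, (∀ i, L i v = 0) → v = 0) : Module.Finite ℝ V := by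
  refine Module.Finite.of_injective (LinearMap.pi L) ?_
  rw [← LinearMap.ker_eq_bot, LinearMap.ker_eq_bot']
  exact fun v hv => hinj v fun i => congrFun hv i

/-- Restriction to each simplex lands in the image of the polynomials of degree `≤ n`, which is
finite-dimensional. As the simplices cover `Ω`, the finitely many restrictions determine the
function. -/
lemma finite_piecewisePoly
    (hcov : Ω ⊆ ⋃ K ∈ 𝒦, convexHull ℝ (K : Set (EuclideanSpace ℝ (Fin d))))
    (hΩ : MeasurableSet Ω) :
    Module.Finite ℝ (piecewisePoly Ω 𝒦 n) := by
  refine finite_of_jointly_injective (fun K : 𝒦 => restrictPoly K.2) ?_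
  intro v hv
  have h1 : ∀ K ∈ 𝒦, ∀ᵐ x ∂(volume.restrict Ω),
      x ∈ convexHull ℝ (K : Set (EuclideanSpace ℝ (Fin d))) → v.1 x = 0 := by
    intro K hK
    have h2 : restrictLp Ω (convexHull ℝ (K : Set _)) v.1 = 0 :=
      congrArg Subtype.val (hv ⟨K, hK⟩)
    have h3 := coeFn_restrictLp (convexHull ℝ (K : Set _)) v.1
    rw [h2] at h3
    refine (ae_restrict_iff' (isCompact_convexHull_finset K).measurableSet).1 ?_
    filter_upwards [h3, Lp.coeFn_zero ℝ 2 ((volume.restrict Ω).restrict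
      (convexHull ℝ (K : Set (EuclideanSpace ℝ (Fin d)))))] with x hx hx'
    rw [← hx, hx']
    rfl
  refine Subtype.ext (Lp.ext ?_)
  have h4 := (Finset.eventually_all 𝒦).2 h1
  filter_upwards [h4, ae_restrict_mem hΩ, Lp.coeFn_zero ℝ 2 (volume.restrict Ω)] with x hx hxΩ h0
  obtain ⟨K, hK, hxK⟩ := mem_iUnion₂.1 (hcov hxΩ)
  rw [hx K hK hxK]
  exact h0.symm

/-- If the function vanishes, so does its weak gradient. Later this makes the `H^{γ₀}(L²)` norm of
`U'` definite on the discrete functions. -/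
lemma fn_injective (hΩ : IsOpen Ω) : Function.Injective (fn : Sh Ω 𝒦 n →ₗ[ℝ] L2 Ω) := by
  rw [← LinearMap.ker_eq_bot, LinearMap.ker_eq_bot']
  intro v hv
  have h1 : v.1.1 = 0 := hv
  have h2 := H01.hasWeakGrad v.2.1
  rw [h1] at h2
  exact Subtype.ext (Prod.ext h1 (h2.eq_zero hΩ))

lemma IsTriangulation.subset (h : IsTriangulation Ω 𝒦) :
    Ω ⊆ ⋃ K ∈ 𝒦, convexHull ℝ (K : Set (EuclideanSpace ℝ (Fin d))) :=
  h.cover ▸ subset_closure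

lemma IsTriangulation.isBounded (h : IsTriangulation Ω 𝒦) : Bornology.IsBounded Ω :=
  ((Bornology.isBounded_biUnion_finset 𝒦).2
    fun K _ => (isCompact_convexHull_finset K).isBounded).subset h.subset

lemma finite_Sh (hΩ : IsOpen Ω) (h : IsTriangulation Ω 𝒦) : Module.Finite ℝ (Sh Ω 𝒦 n) := by
  have := finite_piecewisePoly (n := n) h.subset hΩ.measurableSet
  refine Module.Finite.of_injective
    (LinearMap.codRestrict (piecewisePoly Ω 𝒦 n) (fn : Sh Ω 𝒦 n →ₗ[ℝ] L2 Ω) fun v => v.2.2) ?_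
  intro v w hvw
  exact fn_injective hΩ (congrArg Subtype.val hvw)

/-- Poincaré's inequality in the first coordinate direction on the bounded set `Ω`. It is what makes
the Ritz projection, and hence the initial value `U(0)`, unique. -/
lemma grad_injective (hΩ : IsOpen Ω) (h : IsTriangulation Ω 𝒦) (hd : 0 < d) :
    Function.Injective (grad : Sh Ω 𝒦 n →ₗ[ℝ] L2Vec Ω) := by
  rw [← LinearMap.ker_eq_bot, LinearMap.ker_eq_bot']
  intro v hv
  obtain ⟨R, hR⟩ := h.isBounded.exists_norm_le
  have h1 := H01.poincare (Ω := Ω) ⟨0, hd⟩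
    (fun x hx => (PiLp.norm_apply_le x ⟨0, hd⟩).trans (hR x hx)) v.2.1
  have h2 : v.1.2 = 0 := hv
  rw [h2, norm_zero] at h1
  have h3 : fn v = 0 := by
    rw [← norm_eq_zero, ← sq_eq_zero_iff]
    refine le_antisymm (h1.trans_eq ?_) (sq_nonneg _)
    ring
  exact fn_injective hΩ (h3.trans (map_zero _).symm)

/-! ### Orthogonality relations and the two projections -/

section Projection

variable {H : Type*} [NormedAddCommGroup H] [InnerProductSpace ℝ H]

lemma norm_le_of_inner_sub_eq_zero {v p : H} (h : inner ℝ (v - p) p = 0) : ‖p‖ ≤ ‖v‖ := by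
  rw [inner_sub_left, sub_eq_zero, real_inner_self_eq_norm_sq] at h
  have h1 := real_inner_le_norm v p
  by_contra! hlt
  nlinarith [norm_nonneg v]

lemma eq_of_inner_sub_eq_zero {v p q : H} (hp : inner ℝ (v - p) (p - q) = 0)
    (hq : inner ℝ (v - q) (p - q) = 0) : p = q := by
  rw [← sub_eq_zero, ← inner_self_eq_zero (𝕜 := ℝ)]
  have h : p - q = (v - q) - (v - p) := by abel
  nth_rewrite 1 [h]
  rw [inner_sub_left, hp, hq, sub_zero]

end Projection

lemma IsRitzProj.norm_le {v : H01 Ω} {r : Sh Ω 𝒦 n} (h : IsRitzProj v r) :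
    ‖grad r‖ ≤ ‖v.1.2‖ :=
  norm_le_of_inner_sub_eq_zero (h r)

lemma IsRitzProj.unique {v : H01 Ω} {r s : Sh Ω 𝒦 n}
    (hg : Function.Injective (grad : Sh Ω 𝒦 n →ₗ[ℝ] L2Vec Ω)) (h : IsRitzProj v r)
    (h' : IsRitzProj v s) : r = s := by
  refine hg (eq_of_inner_sub_eq_zero (v := v.1.2) ?_ ?_)
  · rw [← map_sub]
    exact h _
  · rw [← map_sub]
    exact h' _

/-- The gradients of `S_h` form a finite-dimensional subspace of `L²(Ω; ℝ^d)`; the orthogonal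
projection of `∇v` onto it is the gradient of the required element. -/
lemma exists_isRitzProj [Module.Finite ℝ (Sh Ω 𝒦 n)] (v : H01 Ω) :
    ∃ r : Sh Ω 𝒦 n, IsRitzProj v r := by
  let W := LinearMap.range (grad : Sh Ω 𝒦 n →ₗ[ℝ] L2Vec Ω)
  obtain ⟨r, hr⟩ : W.starProjection v.1.2 ∈ W := W.starProjection_apply_mem v.1.2
  refine ⟨r, fun w => ?_⟩
  rw [hr]
  exact Submodule.starProjection_inner_eq_zero _ _ ⟨w, rfl⟩

variable (Ω 𝒦 n) in
/-- The space `Σ_h` as a subspace of `L²(Ω)`. -/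
def sigmaSubmodule : Submodule ℝ (L2 Ω) where
  carrier := SigmaH Ω 𝒦 n
  zero_mem' := ⟨⟨0, hasWeakGrad_zero⟩, zero_mem _⟩
  add_mem' := fun ⟨⟨_, hg⟩, hv⟩ ⟨⟨_, hk⟩, hw⟩ => ⟨⟨_, hg.add hk⟩, add_mem hv hw⟩
  smul_mem' := fun c _ ⟨⟨_, hg⟩, hv⟩ => ⟨⟨_, hg.smul c⟩, Submodule.smul_mem _ c hv⟩

lemma IsL2Proj.norm_le {v p : L2 Ω} (h : IsL2Proj 𝒦 n v p) : ‖p‖ ≤ ‖v‖ :=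
  norm_le_of_inner_sub_eq_zero (h.2 p h.1)

lemma IsL2Proj.unique {v p q : L2 Ω} (h : IsL2Proj 𝒦 n v p) (h' : IsL2Proj 𝒦 n v q) : p = q := by
  have hm : p - q ∈ SigmaH Ω 𝒦 n := (sigmaSubmodule Ω 𝒦 n).sub_mem h.1 h'.1
  exact eq_of_inner_sub_eq_zero (h.2 _ hm) (h'.2 _ hm)

lemma exists_isL2Proj (hΩ : IsOpen Ω) (h : IsTriangulation Ω 𝒦) (v : L2 Ω) :
    ∃ p, IsL2Proj 𝒦 n v p := by
  have := finite_piecewisePoly (n := n) h.subset hΩ.measurableSet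
  have : Module.Finite ℝ (sigmaSubmodule Ω 𝒦 n) :=
    Submodule.finiteDimensional_of_le (S₂ := piecewisePoly Ω 𝒦 n) fun _ hv => hv.2
  exact ⟨(sigmaSubmodule Ω 𝒦 n).starProjection v,
    (sigmaSubmodule Ω 𝒦 n).starProjection_apply_mem v,
    fun w hw => Submodule.starProjection_inner_eq_zero _ _ hw⟩

end FiniteElement

/-! ### Piecewise polynomials -/

section Piecewise

variable {Y : Type*} [NormedAddCommGroup Y] [NormedSpace ℝ Y] {t : ℕ → ℝ} {J q : ℕ}

lemma intervalIntegrable_of_piecewise {Y : Type*} [NormedAddCommGroup Y] {t : ℕ → ℝ} {J : ℕ}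
    (ht : Monotone t) {f : ℝ → Y}
    (h : ∀ j < J, ∃ g : ℝ → Y, Continuous g ∧ EqOn f g (Ioo (t j) (t (j + 1)))) :
    IntervalIntegrable f volume (t 0) (t J) := by
  refine IntervalIntegrable.trans_iterate fun j hj => ?_
  obtain ⟨g, hg, hfg⟩ := h j hj
  refine (hg.intervalIntegrable _ _).congr_uIoo ?_
  rw [uIoo_of_le (ht (Nat.le_succ j))]
  exact hfg.symm

lemma continuous_poly (c : ℕ → Y) (q : ℕ) :
    Continuous fun s : ℝ => ∑ k ∈ Finset.range q, s ^ k • c k := by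
  fun_prop

lemma ae_eq_of_eqOn_grid {Z : Type*} {V W : ℝ → Z}
    (h : ∀ j < J, EqOn V W (Ioo (t j) (t (j + 1)))) :
    V =ᵐ[volume.restrict (Ioo (t 0) (t J))] W := by
  refine (ae_restrict_iff' measurableSet_Ioo).2 ?_
  filter_upwards [ae_notMem_range t] with s hs hsI
  obtain ⟨i, hi, hi'⟩ := exists_grid_interval hsI.1 hs J hsI.2
  exact h i hi hi'

namespace IsPiecewisePoly

lemma intervalIntegrable (ht : Monotone t) {V : ℝ → Y} (hV : IsPiecewisePoly t J q V) :
    IntervalIntegrable V volume (t 0) (t J) :=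
  intervalIntegrable_of_piecewise ht fun j hj => by
    obtain ⟨c, hc⟩ := hV j hj
    exact ⟨_, continuous_poly c q, hc⟩

lemma mono_left {V : ℝ → Y} (hV : IsPiecewisePoly t J q V) {i : ℕ} (hi : i ≤ J) :
    IsPiecewisePoly t i q V :=
  fun j hj => hV j (hj.trans_le hi)

lemma sub {V W : ℝ → Y} (hV : IsPiecewisePoly t J q V) (hW : IsPiecewisePoly t J q W) :
    IsPiecewisePoly t J q (V - W) := by
  intro j hj
  obtain ⟨c, hc⟩ := hV j hj
  obtain ⟨c', hc'⟩ := hW j hj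
  refine ⟨c - c', fun s hs => ?_⟩
  simp only [Pi.sub_apply, hc s hs, hc' s hs, smul_sub, Finset.sum_sub_distrib]

lemma indicator (ht : Monotone t) {V : ℝ → Y} (hV : IsPiecewisePoly t J q V) (i : ℕ) :
    IsPiecewisePoly t J q ((Ioo (t 0) (t i)).indicator V) := by
  intro j hj
  obtain ⟨c, hc⟩ := hV j hj
  rcases lt_or_ge j i with h | h
  · refine ⟨c, fun s hs => ?_⟩
    rw [indicator_of_mem (Ioo_subset_Ioo (ht (Nat.zero_le j)) (ht h) hs), hc s hs]
  · refine ⟨0, fun s hs => ?_⟩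
    rw [indicator_of_notMem fun h' => absurd (h'.2.trans_le (ht h)) hs.1.not_gt]
    simp

lemma exists_deriv {U : ℝ → Y} (hU : IsPiecewisePoly t J (q + 1) U) {j : ℕ} (hj : j < J) :
    ∃ c : ℕ → Y, ∀ s ∈ Ioo (t j) (t (j + 1)),
      HasDerivAt U (∑ k ∈ Finset.range q, s ^ k • c k) s := by
  obtain ⟨c, hc⟩ := hU j hj
  refine ⟨fun k => ((k : ℝ) + 1) • c (k + 1), fun s hs => ?_⟩
  have h1 : HasDerivAt (fun s : ℝ => ∑ k ∈ Finset.range (q + 1), s ^ k • c k)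
      (∑ k ∈ Finset.range (q + 1), ((k : ℝ) * s ^ (k - 1)) • c k) s :=
    HasDerivAt.fun_sum fun k _ => (hasDerivAt_pow k s).smul_const (c k)
  rw [Finset.sum_range_succ'] at h1
  simp only [Nat.cast_zero, zero_mul, zero_smul, add_zero, Nat.add_sub_cancel] at h1
  have h2 : ∑ k ∈ Finset.range q, s ^ k • ((k : ℝ) + 1) • c (k + 1) =
      ∑ k ∈ Finset.range q, (((k + 1 : ℕ) : ℝ) * s ^ k) • c (k + 1) := by
    refine Finset.sum_congr rfl fun k _ => ?_
    rw [smul_smul, mul_comm]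
    push_cast
    rfl
  rw [h2]
  refine h1.congr_of_eventuallyEq ?_
  filter_upwards [isOpen_Ioo.mem_nhds hs] with x hx using hc x hx

lemma hasDerivAt {U : ℝ → Y} (hU : IsPiecewisePoly t J (q + 1) U) {j : ℕ} (hj : j < J) {s : ℝ}
    (hs : s ∈ Ioo (t j) (t (j + 1))) : HasDerivAt U (deriv U s) s := by
  obtain ⟨c, hc⟩ := hU.exists_deriv hj
  exact (hc s hs).differentiableAt.hasDerivAt

lemma deriv {U : ℝ → Y} (hU : IsPiecewisePoly t J (q + 1) U) :
    IsPiecewisePoly t J q (deriv U) := by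
  intro j hj
  obtain ⟨c, hc⟩ := hU.exists_deriv hj
  exact ⟨c, fun s hs => (hc s hs).deriv⟩

lemma continuousAt {U : ℝ → Y} (hU : IsPiecewisePoly t J q U) {j : ℕ} (hj : j < J) {s : ℝ}
    (hs : s ∈ Ioo (t j) (t (j + 1))) : ContinuousAt U s := by
  obtain ⟨c, hc⟩ := hU j hj
  refine (continuous_poly c q).continuousAt.congr ?_
  filter_upwards [isOpen_Ioo.mem_nhds hs] with x hx using (hc x hx).symm

/-- The fundamental theorem of calculus. -/
lemma integral_deriv_eq_sub [CompleteSpace Y] (ht : Monotone t) {U : ℝ → Y}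
    (hU : IsPiecewisePoly t J (q + 1) U) (hc : ContinuousOn U (Icc (t 0) (t J))) {b : ℝ}
    (hb : b ∈ Icc (t 0) (t J)) : ∫ s in (t 0)..b, _root_.deriv U s = U b - U (t 0) := by
  refine integral_eq_of_hasDerivAt_off_countable_of_le U _ hb.1 (countable_range t)
    (hc.mono (Icc_subset_Icc_right hb.2)) (fun s hs => ?_) ?_
  · obtain ⟨i, hi, hi'⟩ := exists_grid_interval hs.1.1 hs.2 J (hs.1.2.trans_le hb.2)
    exact hU.hasDerivAt hi hi'
  · refine (hU.deriv.intervalIntegrable ht).mono_set ?_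
    rw [uIcc_of_le hb.1, uIcc_of_le (hb.1.trans hb.2)]
    exact Icc_subset_Icc_right hb.2

lemma primitive [CompleteSpace Y] (ht : Monotone t) {u : ℝ → Y} (hu : IsPiecewisePoly t J q u) :
    IsPiecewisePoly t J (q + 1) fun s => ∫ x in (t 0)..s, u x := by
  intro j hj
  obtain ⟨c, hc⟩ := hu j hj
  let P : ℝ → Y := fun s => ∑ k ∈ Finset.range q, s ^ (k + 1) • ((k : ℝ) + 1)⁻¹ • c k
  have hP : ∀ s, HasDerivAt P (∑ k ∈ Finset.range q, s ^ k • c k) s := by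
    intro s
    refine HasDerivAt.fun_sum fun k _ => ?_
    have h := (hasDerivAt_pow (k + 1) s).smul_const (((k : ℝ) + 1)⁻¹ • c k)
    have hk : (k : ℝ) + 1 ≠ 0 := by positivity
    convert h using 1
    rw [smul_smul, Nat.add_sub_cancel]
    push_cast
    rw [mul_right_comm, mul_inv_cancel₀ hk, one_mul]
  -- The degree-zero coefficient matches the value of the primitive at the left node; the other
  -- coefficients come from integrating term by term.
  refine ⟨fun k => Nat.casesOn k ((∫ x in (t 0)..(t j), u x) - P (t j))
    fun k => ((k : ℝ) + 1)⁻¹ • c k, fun s hs => ?_⟩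
  have hsub : ∀ a b, a ∈ Icc (t 0) (t J) → b ∈ Icc (t 0) (t J) →
      IntervalIntegrable u volume a b := by
    intro a b ha hb
    refine (hu.intervalIntegrable ht).mono_set ?_
    rw [uIcc_of_le (ha.1.trans ha.2)]
    exact uIcc_subset_Icc ha hb
  have h0 : t 0 ∈ Icc (t 0) (t J) := left_mem_Icc.2 (ht (Nat.zero_le J))
  have hj' : t j ∈ Icc (t 0) (t J) := ⟨ht (Nat.zero_le j), ht hj.le⟩
  have hs' : s ∈ Icc (t 0) (t J) := ⟨hj'.1.trans hs.1.le, hs.2.le.trans (ht hj)⟩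
  have h1 : ∫ x in (t j)..s, u x = P s - P (t j) := by
    rw [← intervalIntegral.integral_eq_sub_of_hasDerivAt (fun x _ => hP x)
      ((continuous_poly c q).intervalIntegrable _ _)]
    refine intervalIntegral.integral_congr_Ioo_of_le hs.1.le fun x hx => ?_
    exact hc x ⟨hx.1, hx.2.trans hs.2⟩
  beta_reduce
  rw [← intervalIntegral.integral_add_adjacent_intervals (hsub _ _ h0 hj') (hsub _ _ hj' hs'), h1,
    Finset.sum_range_succ']
  simp only [pow_zero, one_smul]
  change _ + (P s - P (t j)) = P s + (_ - P (t j))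
  abel

lemma continuousOn_primitive (ht : Monotone t) {u : ℝ → Y}
    (hu : IsPiecewisePoly t J q u) :
    ContinuousOn (fun s => ∫ x in (t 0)..s, u x) (Icc (t 0) (t J)) := by
  have h := intervalIntegral.continuousOn_primitive_interval' (hu.intervalIntegrable ht)
    left_mem_uIcc
  rwa [uIcc_of_le (ht (Nat.zero_le J))] at h

lemma deriv_primitive [CompleteSpace Y] (ht : Monotone t) {u : ℝ → Y}
    (hu : IsPiecewisePoly t J q u) (y : Y) {j : ℕ} (hj : j < J) :
    EqOn (_root_.deriv fun s => y + ∫ x in (t 0)..s, u x) u (Ioo (t j) (t (j + 1))) := by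
  intro s hs
  have hc := hu.continuousAt hj hs
  have hm : StronglyMeasurableAtFilter u (nhds s) volume := by
    obtain ⟨c, hc⟩ := hu j hj
    refine ⟨Ioo (t j) (t (j + 1)), isOpen_Ioo.mem_nhds hs, ?_⟩
    refine ((continuous_poly c q).aestronglyMeasurable.restrict).congr ?_
    exact (ae_restrict_iff' measurableSet_Ioo).2 (Filter.Eventually.of_forall fun x hx => (hc x
        hx).symm)
  have hi : IntervalIntegrable u volume (t 0) s := by
    refine (hu.intervalIntegrable ht).mono_set ?_
    rw [uIcc_of_le (ht (Nat.zero_le J)), uIcc_of_le ((ht (Nat.zero_le j)).trans hs.1.le)]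
    exact Icc_subset_Icc_right (hs.2.le.trans (ht hj))
  exact ((intervalIntegral.integral_hasDerivAt_right hi hm hc).const_add y).deriv

lemma const_add {U : ℝ → Y} (hU : IsPiecewisePoly t J (q + 1) U) (y : Y) :
    IsPiecewisePoly t J (q + 1) fun s => y + U s := by
  intro j hj
  obtain ⟨c, hc⟩ := hU j hj
  refine ⟨fun k => Nat.casesOn k (y + c 0) fun k => c (k + 1), fun s hs => ?_⟩
  beta_reduce
  rw [hc s hs, Finset.sum_range_succ', Finset.sum_range_succ']
  simp only [pow_zero, one_smul]
  rw [← add_assoc, add_comm y, add_assoc]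
  rfl

lemma intervalIntegrable_inner {Z : Type*} [NormedAddCommGroup Z] [InnerProductSpace ℝ Z]
    (ht : Monotone t) {V W : ℝ → Z} {r : ℕ} (hV : IsPiecewisePoly t J q V)
    (hW : IsPiecewisePoly t J r W) :
    IntervalIntegrable (fun s => inner ℝ (V s) (W s)) volume (t 0) (t J) := by
  refine intervalIntegrable_of_piecewise ht fun j hj => ?_
  obtain ⟨c, hc⟩ := hV j hj
  obtain ⟨c', hc'⟩ := hW j hj
  refine ⟨_, (continuous_poly c q).inner (continuous_poly c' r), fun s hs => ?_⟩
  simp only [hc s hs, hc' s hs]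

/-- The energy identity `∫ (BU, BU') = ½ ‖BU‖² |`. -/
lemma integral_inner_deriv {Z : Type*} [NormedAddCommGroup Z] [InnerProductSpace ℝ Z]
    (ht : Monotone t) {U : ℝ → Y} (hU : IsPiecewisePoly t J (q + 1) U)
    (hc : ContinuousOn U (Icc (t 0) (t J))) (B : Y →L[ℝ] Z) {b : ℝ} (hb : b ∈ Icc (t 0) (t J)) :
    ∫ s in (t 0)..b, inner ℝ (B (U s)) (B (_root_.deriv U s)) =
      (1 / 2) * ‖B (U b)‖ ^ 2 - (1 / 2) * ‖B (U (t 0))‖ ^ 2 := by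
  refine integral_eq_of_hasDerivAt_off_countable_of_le (fun s => (1 / 2) * ‖B (U s)‖ ^ 2) _ hb.1
    (countable_range t) (ContinuousOn.mono (by fun_prop) (Icc_subset_Icc_right hb.2))
    (fun s hs => ?_) ?_
  · obtain ⟨i, hi, hi'⟩ := exists_grid_interval hs.1.1 hs.2 J (hs.1.2.trans_le hb.2)
    have h := (B.hasFDerivAt.comp_hasDerivAt s (hU.hasDerivAt hi hi')).norm_sq.const_mul (1 / 2)
    rw [← mul_assoc, one_div_mul_cancel two_ne_zero, one_mul] at h
    exact h
  · have h := intervalIntegrable_inner ht (hU.map B.toLinearMap) (hU.deriv.map B.toLinearMap)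
    refine h.mono_set ?_
    rw [uIcc_of_le hb.1, uIcc_of_le (hb.1.trans hb.2)]
    exact Icc_subset_Icc_right hb.2

end IsPiecewisePoly

variable (Y t J q) in
/-- The piecewise polynomials with given coefficients, extended by zero. -/
def piecewiseEval : (Fin J → Fin q → Y) →ₗ[ℝ] ℝ → Y where
  toFun c s := ∑ j : Fin J, (Ioo (t j) (t (j + 1))).indicator
    (fun s => ∑ k : Fin q, s ^ (k : ℕ) • c j k) s
  map_add' c c' := by
    funext s
    rw [Pi.add_apply, ← Finset.sum_add_distrib]
    refine Finset.sum_congr rfl fun j _ => ?_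
    rw [← Pi.add_apply, ← indicator_add']
    congr 1
    funext s
    simp only [Pi.add_apply, smul_add, Finset.sum_add_distrib]
  map_smul' r c := by
    funext s
    rw [RingHom.id_apply, Pi.smul_apply, Finset.smul_sum]
    refine Finset.sum_congr rfl fun j _ => ?_
    rw [← indicator_const_smul_apply]
    simp only [Pi.smul_apply, Finset.smul_sum, smul_comm r]

lemma piecewiseEval_apply (c : Fin J → Fin q → Y) (s : ℝ) :
    piecewiseEval Y t J q c s = ∑ j : Fin J, (Ioo (t j) (t (j + 1))).indicator
      (fun s => ∑ k : Fin q, s ^ (k : ℕ) • c j k) s :=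
  rfl

lemma piecewiseEval_eqOn (ht : Monotone t) (c : Fin J → Fin q → Y) (j : Fin J) :
    EqOn (piecewiseEval Y t J q c) (fun s => ∑ k : Fin q, s ^ (k : ℕ) • c j k)
      (Ioo (t j) (t (j + 1))) := by
  intro s hs
  rw [piecewiseEval_apply, Finset.sum_eq_single j]
  · rw [indicator_of_mem hs]
  · intro i _ hij
    exact indicator_of_notMem (fun h => hij (Fin.ext (grid_interval_unique ht h hs))) _
  · intro h
    exact absurd (Finset.mem_univ j) h

variable (Y t J q) in
/-- The space of piecewise polynomials that vanish outside the grid intervals. -/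
def PiecewiseSpace : Submodule ℝ (ℝ → Y) := LinearMap.range (piecewiseEval Y t J q)

instance [Module.Finite ℝ Y] : Module.Finite ℝ (PiecewiseSpace Y t J q) :=
  inferInstanceAs (Module.Finite ℝ (LinearMap.range (piecewiseEval Y t J q)))

lemma PiecewiseSpace.isPiecewisePoly (ht : Monotone t) (u : PiecewiseSpace Y t J q) :
    IsPiecewisePoly t J q u.1 := by
  obtain ⟨_, c, rfl⟩ := u
  intro j hj
  refine ⟨fun k => if h : k < q then c ⟨j, hj⟩ ⟨k, h⟩ else 0, fun s hs => ?_⟩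
  refine (piecewiseEval_eqOn ht c ⟨j, hj⟩ hs).trans ?_
  rw [Finset.sum_range]
  simp

lemma PiecewiseSpace.eq_zero {u : PiecewiseSpace Y t J q}
    (h : ∀ j < J, ∀ s ∈ Ioo (t j) (t (j + 1)), u.1 s = 0) : u = 0 := by
  obtain ⟨_, c, rfl⟩ := u
  refine Subtype.ext (funext fun s => ?_)
  by_cases hs : ∃ j : Fin J, s ∈ Ioo (t j) (t (j + 1))
  · obtain ⟨j, hj⟩ := hs
    exact h j j.2 s hj
  · refine (piecewiseEval_apply c s).trans ?_
    exact Finset.sum_eq_zero fun j _ => indicator_of_notMem (fun h' => hs ⟨j, h'⟩) _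

lemma IsPiecewisePoly.exists_piecewiseSpace (ht : Monotone t) {V : ℝ → Y}
    (hV : IsPiecewisePoly t J q V) :
    ∃ u : PiecewiseSpace Y t J q, ∀ j < J, EqOn V u.1 (Ioo (t j) (t (j + 1))) := by
  choose! c hc using hV
  refine ⟨⟨_, fun j k => c j k, rfl⟩, fun j hj s hs => ?_⟩
  refine Eq.trans ?_ (piecewiseEval_eqOn ht _ ⟨j, hj⟩ hs).symm
  rw [hc j hj s hs, Finset.sum_range]

end Piecewise

/-! ### The abstract discrete problem -/

section Discrete

variable {X : Type*} [NormedAddCommGroup X] [InnerProductSpace ℝ X] {e : HilbertBasis ℕ ℝ X}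
  {α a b T : ℝ}

/-- The weight vanishes only at `ξ = 0`, so the continuous transform of each coordinate is
identically zero, and Fourier inversion gives the value at a point of continuity. -/
lemma FracSpace.eq_zero_of_fracNorm_eq_zero {v : ℝ → X} (hv : v ∈ FracSpace e α a b)
    (h : fracNorm e α a b v = 0) {s : ℝ} (hs : s ∈ Ioo a b) (hc : ContinuousAt v s) : v s = 0 := by
  have h1 : fracEnergy e α a b v = 0 := by
    have h2 := (Real.sqrt_eq_zero ENNReal.toReal_nonneg).1 h
    exact (ENNReal.toReal_eq_zero_iff _).1 h2 |>.resolve_right hv.2.ne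
  refine e.repr.injective ?_
  rw [map_zero]
  ext j
  rw [e.repr_apply_apply]
  have hi := coord_integrable e hv.1 j
  have hF := fourier_continuous hi
  have h3 : ∫⁻ ξ : ℝ, ENNReal.ofReal (|2 * Real.pi * ξ| ^ (2 * α)) *
      ‖𝓕 (coordFun e a b v j) ξ‖ₑ ^ 2 = 0 := (ENNReal.tsum_eq_zero.1 h1) j
  have hm : Measurable fun ξ : ℝ => ENNReal.ofReal (|2 * Real.pi * ξ| ^ (2 * α)) *
      ‖𝓕 (coordFun e a b v j) ξ‖ₑ ^ 2 := by
    have := hF.measurable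
    fun_prop
  rw [lintegral_eq_zero_iff hm] at h3
  have h4 : 𝓕 (coordFun e a b v j) = 0 := by
    refine (Continuous.ae_eq_iff_eq volume hF continuous_const).1 ?_
    filter_upwards [h3, Measure.ae_ne volume 0] with ξ h5 h6
    have h7 : (0 : ℝ) < |2 * Real.pi * ξ| ^ (2 * α) :=
      Real.rpow_pos_of_pos (abs_pos.2 (by have := Real.pi_pos.ne'; positivity)) _
    have h8 := (mul_eq_zero.1 h5).resolve_left (ENNReal.ofReal_pos.2 h7).ne'
    exact enorm_eq_zero.1 (pow_eq_zero_iff two_ne_zero |>.1 h8)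
  have h9 : ContinuousAt (coordFun e a b v j) s := by
    have h10 : ContinuousAt (fun t => ((inner ℝ (e j) (v t) : ℝ) : ℂ)) s :=
      Complex.continuous_ofReal.continuousAt.comp (continuousAt_const.inner hc)
    refine h10.congr ?_
    filter_upwards [isOpen_Ioo.mem_nhds hs] with x hx using
      (indicator_of_mem hx (fun t => ((inner ℝ (e j) (v t) : ℝ) : ℂ))).symm
  have h11 := hi.fourierInv_fourier_eq (by rw [h4]; exact integrable_zero _ _ _) h9
  rw [h4, coordFun, indicator_of_mem hs] at h11
  have h12 : FourierTransformInv.fourierInv (0 : ℝ → ℂ) s = 0 := by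
    rw [Real.fourierInv_eq]
    simp
  rw [h12] at h11
  exact_mod_cast h11.symm

lemma fracDualNorm_nonneg (F : FracDual e α a b) : 0 ≤ fracDualNorm F :=
  Real.sInf_nonneg fun _ hC => hC.1

/-- The infimum is itself an admissible bound: for positive norm one divides by it, and for zero
norm any one bound already forces `F v = 0`. -/
lemma abs_le_fracDualNorm_mul (F : FracDual e α a b) (v : FracSpace e α a b) :
    |F.1 v| ≤ fracDualNorm F * fracNorm e α a b v := by
  obtain ⟨C, hC⟩ := F.2
  have hne : {C | 0 ≤ C ∧ ∀ v : FracSpace e α a b, |F.1 v| ≤ C * fracNorm e α a b v}.Nonempty :=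
    ⟨max C 0, le_max_right _ _, fun v => (hC v).trans
      (mul_le_mul_of_nonneg_right (le_max_left _ _) (fracNorm_nonneg e α a b v))⟩
  rcases (fracNorm_nonneg e α a b v).eq_or_lt with h | h
  · have := hC v
    rw [← h, mul_zero] at this ⊢
    exact this
  · rw [← div_le_iff₀ h]
    exact le_csInf hne fun D hD => (div_le_iff₀ h).2 (hD.2 v)

lemma fracForm_congr_left {g k : FracSpace e α a b} (h : g.1 =ᵐ[volume.restrict (Ioo a b)] k.1)
    (v : FracSpace e α a b) : fracForm e α a b g v = fracForm e α a b k v := by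
  rw [← sub_eq_zero, ← LinearMap.sub_apply, ← map_sub, ← abs_nonpos_iff]
  refine (abs_fracForm_le _ _).trans_eq ?_
  have h0 : fracNorm e α a b (g - k : FracSpace e α a b).1 = 0 := by
    rw [← fracNorm_zero (e := e) (α := α) (a := a) (b := b)]
    refine fracNorm_congr ?_
    filter_upwards [h] with x hx
    exact sub_eq_zero.2 hx
  rw [h0, zero_mul]

lemma const_mem (e : HilbertBasis ℕ ℝ X) (hab : a ≤ b) (h0 : 0 < α) (h1 : α < 1 / 2) (p : X) :
    (fun _ => p) ∈ FracSpace e α a b := by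
  have h := smooth_smul_mem e (g := fun _ => (1 : ℝ)) contDiff_const p hab h0 h1
  simpa only [one_smul] using h

/-- The points `t_0 ≤ t_1 ≤ …` with `t_0 = 0` and `t_J = T`. -/
structure IsGrid (t : ℕ → ℝ) (J : ℕ) (T : ℝ) : Prop where
  mono : Monotone t
  zero : t 0 = 0
  last : t J = T

variable {Y Z : Type*} [NormedAddCommGroup Y] [NormedSpace ℝ Y] [NormedAddCommGroup Z]
  [InnerProductSpace ℝ Z] {t : ℕ → ℝ} {J m : ℕ} (A : Y →L[ℝ] X) (B : Y →L[ℝ] Z)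

lemma IsGrid.mem (hg : IsGrid t J T) {q : ℕ} {V : ℝ → Y} (hV : IsPiecewisePoly t J q V)
    (e : HilbertBasis ℕ ℝ X) (h0 : 0 < α) (h1 : α < 1 / 2) :
    (fun s => A (V s)) ∈ FracSpace e α 0 T := by
  have h := mem_of_piecewisePoly e hg.mono (hV.map A.toLinearMap) h0 h1
  rwa [hg.zero, hg.last] at h

lemma IsGrid.ae_eq {W : Type*} (hg : IsGrid t J T) {V V' : ℝ → W}
    (h : ∀ j < J, EqOn V V' (Ioo (t j) (t (j + 1)))) : V =ᵐ[volume.restrict (Ioo 0 T)] V' := by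
  have h' := ae_eq_of_eqOn_grid h
  rwa [hg.zero, hg.last] at h'

lemma IsGrid.nonneg (hg : IsGrid t J T) : 0 ≤ T := by
  rw [← hg.zero, ← hg.last]
  exact hg.mono (Nat.zero_le J)

lemma IsGrid.gridPoint_mem (hg : IsGrid t J T) {i : ℕ} (hi : i ≤ J) : t i ∈ Icc 0 T := by
  rw [← hg.zero, ← hg.last]
  exact ⟨hg.mono (Nat.zero_le i), hg.mono hi⟩

variable (t J m T) in
/-- The variational equation, with `g` in the role of `AU' - p`. -/
def IsWeakSolution (g : FracSpace e α 0 T) (U : ℝ → Y) (f : FracDual e α 0 T) : Prop :=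
  ∀ V : ℝ → Y, IsPiecewisePoly t J m V → ∀ v : FracSpace e α 0 T,
    v.1 =ᵐ[volume.restrict (Ioo 0 T)] (fun s => A (V s)) →
    fracForm e α 0 T g v + ∫ s in (0 : ℝ)..T, inner ℝ (B (U s)) (B (V s)) = f.1 v

lemma integral_inner_indicator {b : ℝ} (hb : b ∈ Icc 0 T) (U V : ℝ → Y) :
    ∫ s in (0 : ℝ)..T, inner ℝ (B (U s)) (B ((Ioo 0 b).indicator V s)) =
      ∫ s in (0 : ℝ)..b, inner ℝ (B (U s)) (B (V s)) := by
  have h : (fun s => inner ℝ (B (U s)) (B ((Ioo 0 b).indicator V s))) =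
      (Ioo 0 b).indicator fun s => (inner ℝ (B (U s)) (B (V s)) : ℝ) := by
    funext s
    by_cases hs : s ∈ Ioo 0 b <;> simp [hs]
  rw [h, intervalIntegral.integral_of_le (hb.1.trans hb.2), intervalIntegral.integral_of_le hb.1,
    setIntegral_indicator measurableSet_Ioo, integral_Ioc_eq_integral_Ioo,
    inter_eq_self_of_subset_right]
  exact fun s hs => ⟨hs.1, hs.2.le.trans hb.2⟩

lemma fracForm_eq_zero_of_support' [CompleteSpace X] (h0 : 0 < α) (h1 : α < 1 / 2) (hT : 0 < T)
    (ht : Monotone t) (ht0 : t 0 = 0) {N q : ℕ} (htN : t N ≤ T) {g : FracSpace e α 0 T}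
    (hg : ∀ s ∈ Ioo 0 (t N), g.1 s = 0) {V : ℝ → X} (hV : IsPiecewisePoly t N q V)
    {v : FracSpace e α 0 T} (hv : v.1 =ᵐ[volume.restrict (Ioo 0 T)] (Ioo 0 (t N)).indicator V) :
    fracForm e α 0 T g v = 0 := by
  obtain ⟨γ, rfl⟩ : ∃ γ, α = (γ - 1) / 2 := ⟨2 * α + 1, by ring⟩
  exact fracForm_eq_zero_of_support (by linarith) (by linarith) hT ht ht0 htN hg hV hv

/-- The energy estimate on `(0, t_i)`, obtained by testing with `χ_{(0, t_i)} U'`. -/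
lemma IsWeakSolution.energy_le [CompleteSpace X] (h0 : 0 < α) (h1 : α < 1 / 2) (hT : 0 < T)
    (hg : IsGrid t J T)
    {g : FracSpace e α 0 T} {U : ℝ → Y} {f : FracDual e α 0 T}
    (h : IsWeakSolution T t J m A B g U f) (hU : IsPiecewisePoly t J (m + 1) U)
    (hc : ContinuousOn U (Icc 0 T)) {p : X}
    (hgp : g.1 =ᵐ[volume.restrict (Ioo 0 T)] fun s => A (deriv U s) - p) {i : ℕ} (hi : i ≤ J) :
    Real.cos (Real.pi * α) *
        fracNorm e α 0 (t i) (fun s => A (deriv U s)) ^ 2 +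
      (1 / 2) * ‖B (U (t i))‖ ^ 2 ≤ (1 / 2) * ‖B (U 0)‖ ^ 2 +
        (fracDualNorm (restrictDual (hg.gridPoint_mem hi).2 f) +
          fracNorm e α 0 (t i) (fun _ => p)) *
          fracNorm e α 0 (t i) (fun s => A (deriv U s)) := by
  have hb := hg.gridPoint_mem hi
  have hsub : Ioo 0 (t i) ⊆ Ioo 0 T := Ioo_subset_Ioo_right hb.2
  have hres : ∀ {w : ℝ → X}, w ∈ FracSpace e α 0 T → fracEnergy e α 0 (t i) w < ⊤ → 
      w ∈ FracSpace e α 0 (t i) := fun hw h => ⟨hw.1.mono_measure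
        (Measure.restrict_mono hsub le_rfl), h⟩
  -- Differentiation lowers the time degree by one and truncation at a node respects the grid, so
  -- this is an admissible test function.
  have hV : IsPiecewisePoly t J m ((Ioo 0 (t i)).indicator (deriv U)) := by
    have := hU.deriv.indicator hg.mono i
    rwa [hg.zero] at this
  have hAV : (fun s => A ((Ioo 0 (t i)).indicator (deriv U) s)) =
      (Ioo 0 (t i)).indicator fun s => A (deriv U s) := by
    funext s
    by_cases hs : s ∈ Ioo 0 (t i) <;> simp [hs]
  have hmem := hg.mem A hV e h0 h1
  have hvb : (fun s => A (deriv U s)) ∈ FracSpace e α 0 (t i) := by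
    refine hres (hg.mem A hU.deriv e h0 h1) ?_
    rw [← fracEnergy_indicator e α hsub, ← hAV]
    exact hmem.2
  set vb : FracSpace e α 0 (t i) := ⟨_, hvb⟩ with hvb'
  set cb : FracSpace e α 0 (t i) := ⟨_, const_mem e hb.1 h0 h1 p⟩ with hcb'
  set v : FracSpace e α 0 T := zeroExt e α 0 hb.2 vb with hv
  set c : FracSpace e α 0 T := zeroExt e α 0 hb.2 cb with hcdef
  have hv1 : v.1 = (Ioo 0 (t i)).indicator fun s => A (deriv U s) := rfl
  have hc1 : c.1 = (Ioo 0 (t i)).indicator fun _ => p := rfl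
  set N := fracNorm e α 0 (t i) fun s => A (deriv U s) with hN
  have hvN : fracNorm e α 0 T v = N := by
    rw [hN, hv1, fracNorm, fracEnergy_indicator e α hsub, fracNorm]
  have hcN : fracNorm e α 0 T c = fracNorm e α 0 (t i) fun _ => p := by
    rw [hc1, fracNorm, fracEnergy_indicator e α hsub, fracNorm]
  have key := h _ hV v (by rw [hv1, hAV])
  rw [integral_inner_indicator B hb] at key
  have hFTC := IsPiecewisePoly.integral_inner_deriv hg.mono hU
    (by rw [hg.zero, hg.last]; exact hc) B (b := t i) (by rw [hg.zero, hg.last]; exact hb)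
  rw [hg.zero] at hFTC
  rw [hFTC] at key
  have hf : f.1 v ≤ fracDualNorm (restrictDual hb.2 f) * N :=
    (le_abs_self _).trans (abs_le_fracDualNorm_mul (restrictDual hb.2 f) vb)
  -- `g` and the truncated difference `v - c` agree on `(0, t_i)`. By causality they give the same
  -- value on `v`, so the diagonal term becomes coercive even though `g` itself is not truncated.
  have hform : fracForm e α 0 T g v = Real.cos (Real.pi * α) * N ^ 2 - fracForm e α 0 T c v := by
    set g' : FracSpace e α 0 T :=
      ⟨fun s => A (deriv U s), hg.mem A hU.deriv e h0 h1⟩ - ⟨_, const_mem e hT.le h0 h1 p⟩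
    have hgg' : fracForm e α 0 T g v = fracForm e α 0 T g' v := fracForm_congr_left hgp v
    have hz : fracForm e α 0 T (g' - (v - c)) v = 0 := by
      refine fracForm_eq_zero_of_support' h0 h1 hT hg.mono hg.zero hb.2 ?_
        (hU.deriv.map A.toLinearMap |>.mono_left hi) (Filter.EventuallyEq.of_eq hv1)
      intro s hs
      change (A (deriv U s) - p) - (v.1 s - c.1 s) = 0
      rw [hv1, hc1, indicator_of_mem hs, indicator_of_mem hs, sub_self]
    rw [hgg', ← sub_eq_zero]
    rw [LinearMap.map_sub₂] at hz
    have hvc : fracForm e α 0 T (v - c) v =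
        Real.cos (Real.pi * α) * N ^ 2 - fracForm e α 0 T c v := by
      rw [LinearMap.map_sub₂, fracForm_self, hvN]
    linarith
  have hcv : fracForm e α 0 T c v ≤ fracNorm e α 0 (t i) (fun _ => p) * N := by
    refine (le_abs_self _).trans ((abs_fracForm_le _ _).trans_eq ?_)
    rw [hvN, hcN]
  rw [hform] at key
  linarith

end Discrete

/-! ### Unique solvability of the abstract discrete problem -/

section DiscreteExistence

variable {X : Type*} [NormedAddCommGroup X] [InnerProductSpace ℝ X] {e : HilbertBasis ℕ ℝ X}
  {α T : ℝ} {Y Z : Type*} [NormedAddCommGroup Y] [NormedSpace ℝ Y] [NormedAddCommGroup Z]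
  [InnerProductSpace ℝ Z] {t : ℕ → ℝ} {J m : ℕ} {A : Y →L[ℝ] X} {B : Y →L[ℝ] Z}

lemma fracDualNorm_zero {a b : ℝ} : fracDualNorm (0 : FracDual e α a b) = 0 :=
  le_antisymm (csInf_le ⟨0, fun _ hC => hC.1⟩ ⟨le_rfl, by simp⟩) (fracDualNorm_nonneg _)

lemma restrictDual_zero {a b' b : ℝ} (h : b' ≤ b) :
    restrictDual h (0 : FracDual e α a b) = 0 :=
  Subtype.ext (LinearMap.zero_comp _)

lemma IsGrid.intervalIntegrable (hg : IsGrid t J T) {q : ℕ} {u : ℝ → Y}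
    (hu : IsPiecewisePoly t J q u) {s : ℝ} (hs : s ∈ Icc 0 T) : IntervalIntegrable u volume 0 s :=
      by
  have h := hu.intervalIntegrable hg.mono
  rw [hg.zero, hg.last] at h
  refine h.mono_set ?_
  rw [uIcc_of_le hs.1, uIcc_of_le hg.nonneg]
  exact Icc_subset_Icc_right hs.2

lemma IsGrid.intervalIntegrable_inner (hg : IsGrid t J T) {q r : ℕ} {V W : ℝ → Y}
    (hV : IsPiecewisePoly t J q V) (hW : IsPiecewisePoly t J r W) (B : Y →L[ℝ] Z) :
    IntervalIntegrable (fun s => inner ℝ (B (V s)) (B (W s))) volume 0 T := by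
  have h := (hV.map B.toLinearMap).intervalIntegrable_inner hg.mono (hW.map B.toLinearMap)
  rwa [hg.zero, hg.last] at h

lemma IsGrid.integral_deriv [CompleteSpace Y] (hg : IsGrid t J T) {U : ℝ → Y}
    (hU : IsPiecewisePoly t J (m + 1) U) (hc : ContinuousOn U (Icc 0 T)) {b : ℝ}
    (hb : b ∈ Icc 0 T) : ∫ s in (0 : ℝ)..b, deriv U s = U b - U 0 := by
  have h := hU.integral_deriv_eq_sub hg.mono (b := b)
  rw [hg.zero, hg.last] at h
  exact h hc hb

lemma intervalIntegral_congr_Ioo {E : Type*} [NormedAddCommGroup E]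
    [NormedSpace ℝ E] {V W : ℝ → E}
    (h : V =ᵐ[volume.restrict (Ioo 0 T)] W) {b : ℝ}
    (hb : b ∈ Icc 0 T) : ∫ s in (0 : ℝ)..b, V s = ∫ s in (0 : ℝ)..b, W s := by
  rw [intervalIntegral.integral_of_le hb.1, intervalIntegral.integral_of_le hb.1,
    integral_Ioc_eq_integral_Ioo, integral_Ioc_eq_integral_Ioo]
  exact integral_congr_ae (ae_restrict_of_ae_restrict_of_subset (Ioo_subset_Ioo_right hb.2) h)

lemma IsWeakSolution.sub (hg : IsGrid t J T) {g₁ g₂ : FracSpace e α 0 T} {U₁ U₂ : ℝ → Y}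
    {f : FracDual e α 0 T} (h₁ : IsWeakSolution T t J m A B g₁ U₁ f)
    (h₂ : IsWeakSolution T t J m A B g₂ U₂ f) {q : ℕ} (hU₁ : IsPiecewisePoly t J q U₁)
    (hU₂ : IsPiecewisePoly t J q U₂) :
    IsWeakSolution T t J m A B (g₁ - g₂) (U₁ - U₂) (0 : FracDual e α 0 T) := by
  intro V hV v hv
  have e1 : ∫ s in (0 : ℝ)..T, inner ℝ (B ((U₁ - U₂) s)) (B (V s)) =
      (∫ s in (0 : ℝ)..T, inner ℝ (B (U₁ s)) (B (V s))) -
        ∫ s in (0 : ℝ)..T, inner ℝ (B (U₂ s)) (B (V s)) := by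
    rw [← intervalIntegral.integral_sub (hg.intervalIntegrable_inner hU₁ hV B)
      (hg.intervalIntegrable_inner hU₂ hV B)]
    simp only [Pi.sub_apply, map_sub, inner_sub_left]
  rw [e1, LinearMap.map_sub₂]
  change _ = (0 : ℝ)
  linarith [h₁ V hV v hv, h₂ V hV v hv]

/-- With zero data the energy estimate at the last node forces `|AU'| = 0`. Injectivity of `A` then
gives `U' = 0` inside each interval, and continuity together with `U(0) = 0` does the rest. -/
lemma IsWeakSolution.eq_zero [CompleteSpace X] [CompleteSpace Y] (h0 : 0 < α) (h1 : α < 1 / 2)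
    (hT : 0 < T) (hg : IsGrid t J T) (hA : Function.Injective A) {g : FracSpace e α 0 T}
    {U : ℝ → Y} (h : IsWeakSolution T t J m A B g U 0) (hU : IsPiecewisePoly t J (m + 1) U)
    (hc : ContinuousOn U (Icc 0 T)) (hgU : g.1 =ᵐ[volume.restrict (Ioo 0 T)] fun s => A (deriv U s))
    (hU0 : U 0 = 0) : ∀ s ∈ Icc 0 T, U s = 0 := by
  have hE := h.energy_le A B h0 h1 hT hg hU hc (p := 0) (by simpa using hgU) le_rfl
  rw [restrictDual_zero, fracDualNorm_zero, hU0, map_zero, norm_zero] at hE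
  have hz : fracNorm e α 0 (t J) (fun _ => (0 : X)) = 0 := fracNorm_zero
  rw [hz] at hE
  have hcos : 0 < Real.cos (Real.pi * α) :=
    Real.cos_pos_of_mem_Ioo ⟨by nlinarith [Real.pi_pos], by nlinarith [Real.pi_pos]⟩
  rw [hg.last] at hE
  have hN : fracNorm e α 0 T (fun s => A (deriv U s)) = 0 := by
    rw [← sq_eq_zero_iff]
    refine le_antisymm ?_ (sq_nonneg _)
    by_contra! hlt
    nlinarith [mul_pos hcos hlt, sq_nonneg ‖B (U T)‖]
  have hd : ∀ j < J, EqOn (deriv U) 0 (Ioo (t j) (t (j + 1))) := by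
    intro j hj s hs
    refine hA ?_
    rw [Pi.zero_apply, map_zero]
    refine FracSpace.eq_zero_of_fracNorm_eq_zero (hg.mem A hU.deriv e h0 h1) hN ?_
      (A.continuous.continuousAt.comp (hU.deriv.continuousAt hj hs))
    exact ⟨(hg.gridPoint_mem hj.le).1.trans_lt hs.1,
      hs.2.trans_le (hg.gridPoint_mem (Nat.succ_le_of_lt hj)).2⟩
  intro s hs
  have h2 := hg.integral_deriv hU hc hs
  rw [intervalIntegral_congr_Ioo (hg.ae_eq hd) hs, hU0, sub_zero] at h2
  rw [← h2]
  simp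

lemma IsWeakSolution.unique [CompleteSpace X] [CompleteSpace Y] (h0 : 0 < α) (h1 : α < 1 / 2)
    (hT : 0 < T) (hg : IsGrid t J T) (hA : Function.Injective A) {g₁ g₂ : FracSpace e α 0 T}
    {U₁ U₂ : ℝ → Y} {f : FracDual e α 0 T} (h₁ : IsWeakSolution T t J m A B g₁ U₁ f)
    (h₂ : IsWeakSolution T t J m A B g₂ U₂ f) (hU₁ : IsPiecewisePoly t J (m + 1) U₁)
    (hU₂ : IsPiecewisePoly t J (m + 1) U₂) (hc₁ : ContinuousOn U₁ (Icc 0 T))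
    (hc₂ : ContinuousOn U₂ (Icc 0 T)) {p : X}
    (hg₁ : g₁.1 =ᵐ[volume.restrict (Ioo 0 T)] fun s => A (deriv U₁ s) - p)
    (hg₂ : g₂.1 =ᵐ[volume.restrict (Ioo 0 T)] fun s => A (deriv U₂ s) - p)
    (hi : U₁ 0 = U₂ 0) : EqOn U₁ U₂ (Icc 0 T) := by
  have hd : deriv (U₁ - U₂) =ᵐ[volume.restrict (Ioo 0 T)] fun s => deriv U₁ s - deriv U₂ s :=
    hg.ae_eq fun j hj s hs => ((hU₁.hasDerivAt hj hs).sub (hU₂.hasDerivAt hj hs)).deriv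
  have h := (h₁.sub hg h₂ hU₁ hU₂).eq_zero h0 h1 hT hg hA (hU₁.sub hU₂) (hc₁.sub hc₂) ?_
    (sub_eq_zero.2 hi)
  · exact fun s hs => sub_eq_zero.1 (h s hs)
  · filter_upwards [hd, hg₁, hg₂] with s h2 h3 h4
    rw [h2, map_sub]
    change g₁.1 s - g₂.1 s = _
    rw [h3, h4, sub_sub_sub_cancel_right]

variable (e A) in
/-- The piecewise polynomials as elements of the fractional Sobolev space. -/
def toFracSpace (hg : IsGrid t J T) (h0 : 0 < α) (h1 : α < 1 / 2) :
    PiecewiseSpace Y t J m →ₗ[ℝ] FracSpace e α 0 T where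
  toFun u := ⟨fun s => A (u.1 s), hg.mem A (PiecewiseSpace.isPiecewisePoly hg.mono u) e h0 h1⟩
  map_add' u v := Subtype.ext (funext fun s => map_add A (u.1 s) (v.1 s))
  map_smul' c u := Subtype.ext (funext fun s => map_smul A c (u.1 s))

lemma IsGrid.primitive [CompleteSpace Y] (hg : IsGrid t J T) {u : ℝ → Y} {q : ℕ}
    (hu : IsPiecewisePoly t J q u) :
    IsPiecewisePoly t J (q + 1) fun s => ∫ x in (0 : ℝ)..s, u x := by
  have h := hu.primitive hg.mono
  rwa [hg.zero] at h

variable (B) in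
/-- The functional `V ↦ ∫_0^T (B U, B V) ds`. -/
def gradFunctional (hg : IsGrid t J T) {q : ℕ} {U : ℝ → Y} (hU : IsPiecewisePoly t J q U) :
    Module.Dual ℝ (PiecewiseSpace Y t J m) where
  toFun V := ∫ s in (0 : ℝ)..T, inner ℝ (B (U s)) (B (V.1 s))
  map_add' V₁ V₂ := by
    rw [← intervalIntegral.integral_add
      (hg.intervalIntegrable_inner hU (PiecewiseSpace.isPiecewisePoly hg.mono V₁) B)
      (hg.intervalIntegrable_inner hU (PiecewiseSpace.isPiecewisePoly hg.mono V₂) B)]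
    refine intervalIntegral.integral_congr fun s _ => ?_
    rw [← inner_add_right, ← map_add]
    rfl
  map_smul' c V := by
    rw [smul_eq_mul, ← intervalIntegral.integral_const_mul]
    refine intervalIntegral.integral_congr fun s _ => ?_
    rw [← real_inner_smul_right, ← map_smul]
    rfl

variable (B m) in
/-- The form `∫_0^T (B ∫_0^s u, B V) ds`. -/
def primitiveForm [CompleteSpace Y] (hg : IsGrid t J T) :
    PiecewiseSpace Y t J m →ₗ[ℝ] Module.Dual ℝ (PiecewiseSpace Y t J m) where
  toFun u := gradFunctional B hg (hg.primitive (PiecewiseSpace.isPiecewisePoly hg.mono u))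
  map_add' u₁ u₂ := by
    have h1 := PiecewiseSpace.isPiecewisePoly hg.mono u₁
    have h2 := PiecewiseSpace.isPiecewisePoly hg.mono u₂
    refine LinearMap.ext fun V => ?_
    have hV := PiecewiseSpace.isPiecewisePoly hg.mono V
    refine Eq.trans ?_ (intervalIntegral.integral_add
      (hg.intervalIntegrable_inner (hg.primitive h1) hV B)
      (hg.intervalIntegrable_inner (hg.primitive h2) hV B))
    refine intervalIntegral.integral_congr fun s hs => ?_
    rw [uIcc_of_le hg.nonneg] at hs
    beta_reduce
    rw [← inner_add_left, ← map_add, ← intervalIntegral.integral_add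
      (hg.intervalIntegrable h1 hs) (hg.intervalIntegrable h2 hs)]
    rfl
  map_smul' c u := by
    refine LinearMap.ext fun V => ?_
    refine Eq.trans ?_ (intervalIntegral.integral_const_mul _ _)
    refine intervalIntegral.integral_congr fun s _ => ?_
    beta_reduce
    rw [← real_inner_smul_left, ← map_smul, ← intervalIntegral.integral_smul]
    rfl

lemma isPiecewisePoly_const (y : Y) : IsPiecewisePoly t J 1 fun _ => y :=
  fun _ _ => ⟨fun _ => y, by simp⟩

/-- It suffices to test with the elements of the space `PiecewiseSpace`. -/
lemma isWeakSolution_of_piecewiseSpace (hg : IsGrid t J T) (h0 : 0 < α) (h1 : α < 1 / 2)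
    {g : FracSpace e α 0 T} {U : ℝ → Y} {f : FracDual e α 0 T}
    (h : ∀ V : PiecewiseSpace Y t J m, fracForm e α 0 T g (toFracSpace e A hg h0 h1 V) +
      ∫ s in (0 : ℝ)..T, inner ℝ (B (U s)) (B (V.1 s)) = f.1 (toFracSpace e A hg h0 h1 V)) :
    IsWeakSolution T t J m A B g U f := by
  intro V hV v hv
  obtain ⟨V', hV'⟩ := hV.exists_piecewiseSpace hg.mono
  have hae := hg.ae_eq hV'
  have hv' : v.1 =ᵐ[volume.restrict (Ioo 0 T)] (toFracSpace e A hg h0 h1 V').1 := by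
    filter_upwards [hv, hae] with s h2 h3
    exact h2.trans (congrArg A h3)
  have e1 : fracForm e α 0 T g v = fracForm e α 0 T g (toFracSpace e A hg h0 h1 V') :=
    FracDual.congr (fracFunctional g) hv'
  rw [FracDual.congr f hv', e1, ← h V']
  congr 1
  refine intervalIntegral_congr_Ioo ?_ (right_mem_Icc.2 hg.nonneg)
  filter_upwards [hae] with s hs
  rw [hs]

/-- With `U = y + ∫_0^s u`, the unknown `u` ranges over the same finite-dimensional space as the
test functions; continuity and the initial value are built in, and existence is linear algebra. -/
lemma exists_isWeakSolution [CompleteSpace X] [Module.Finite ℝ Y] (h0 : 0 < α) (h1 : α < 1 / 2)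
    (hT : 0 < T) (hg : IsGrid t J T) (hA : Function.Injective A) (f : FracDual e α 0 T) (y : Y)
    (c : FracSpace e α 0 T) : ∃ U : ℝ → Y, IsPiecewisePoly t J (m + 1) U ∧
      ContinuousOn U (Icc 0 T) ∧ U 0 = y ∧ ∀ g : FracSpace e α 0 T,
        g.1 =ᵐ[volume.restrict (Ioo 0 T)] (fun s => A (deriv U s) - c.1 s) →
        IsWeakSolution T t J m A B g U f := by
  have : CompleteSpace Y := FiniteDimensional.complete ℝ Y
  let ι := toFracSpace e A (m := m) hg h0 h1
  let L : PiecewiseSpace Y t J m →ₗ[ℝ] Module.Dual ℝ (PiecewiseSpace Y t J m) :=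
    (fracForm e α 0 T).compl₁₂ ι ι + primitiveForm m B hg
  have hL : ∀ u V, L u V = fracForm e α 0 T (ι u) (ι V) +
      ∫ s in (0 : ℝ)..T, inner ℝ (B (∫ x in (0 : ℝ)..s, u.1 x)) (B (V.1 s)) := fun u V => rfl
  have hcont : ∀ u : PiecewiseSpace Y t J m,
      ContinuousOn (fun s => ∫ x in (0 : ℝ)..s, u.1 x) (Icc 0 T) := by
    intro u
    have h := (PiecewiseSpace.isPiecewisePoly hg.mono u).continuousOn_primitive hg.mono
    rwa [hg.zero, hg.last] at h
  have hder : ∀ (u : PiecewiseSpace Y t J m) (y : Y), ∀ j < J,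
      EqOn (deriv fun s => y + ∫ x in (0 : ℝ)..s, u.1 x) u.1 (Ioo (t j) (t (j + 1))) := by
    intro u y j hj
    have h := (PiecewiseSpace.isPiecewisePoly hg.mono u).deriv_primitive hg.mono y hj
    rwa [hg.zero] at h
  -- An element of the kernel is the derivative of a solution with zero data and zero initial value.
  have hinj : Function.Injective L := by
    rw [← LinearMap.ker_eq_bot, LinearMap.ker_eq_bot']
    intro u hu
    have hw : IsWeakSolution T t J m A B (ι u) (fun s => ∫ x in (0 : ℝ)..s, u.1 x)
        (0 : FracDual e α 0 T) :=
      isWeakSolution_of_piecewiseSpace hg h0 h1 fun V => by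
        rw [← hL, hu]
        rfl
    have hd := hder u 0
    simp only [zero_add] at hd
    have hz := hw.eq_zero h0 h1 hT hg hA (hg.primitive (PiecewiseSpace.isPiecewisePoly hg.mono u))
        (hcont u)
      (by
        filter_upwards [hg.ae_eq hd] with s hs
        rw [hs]
        rfl) (by simp)
    refine PiecewiseSpace.eq_zero fun j hj s hs => ?_
    rw [← hd j hj hs]
    have hloc : (fun s => ∫ x in (0 : ℝ)..s, u.1 x) =ᶠ[nhds s] fun _ => 0 := by
      filter_upwards [isOpen_Ioo.mem_nhds hs] with x hx
      exact hz x ⟨(hg.gridPoint_mem hj.le).1.trans hx.1.le,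
        hx.2.le.trans (hg.gridPoint_mem (Nat.succ_le_of_lt hj)).2⟩
    rw [hloc.deriv_eq, deriv_const]
  have hsurj : Function.Surjective L :=
    (LinearMap.injective_iff_surjective_of_finrank_eq_finrank
      Subspace.dual_finrank_eq.symm).1 hinj
  -- The load, with the known terms moved to the right: `c` from the fractional term and the
  -- constant `y` from the gradient term.
  let ℓ : Module.Dual ℝ (PiecewiseSpace Y t J m) :=
    (f.1 + fracForm e α 0 T c) ∘ₗ ι - gradFunctional B hg (isPiecewisePoly_const y)
  obtain ⟨u, hu⟩ := hsurj ℓ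
  have hup := PiecewiseSpace.isPiecewisePoly hg.mono u
  refine ⟨fun s => y + ∫ x in (0 : ℝ)..s, u.1 x, (hg.primitive hup).const_add y,
    (hcont u).const_add y, by simp, fun g hgU => ?_⟩
  refine isWeakSolution_of_piecewiseSpace hg h0 h1 fun V => ?_
  have hV := PiecewiseSpace.isPiecewisePoly hg.mono V
  have e1 : fracForm e α 0 T g (ι V) = fracForm e α 0 T (ι u) (ι V) - fracForm e α 0 T c (ι V) := by
    rw [← LinearMap.map_sub₂]
    refine fracForm_congr_left ?_ _
    filter_upwards [hgU, hg.ae_eq (hder u y)] with s h2 h3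
    rw [h2, h3]
    rfl
  have e2 : ∫ s in (0 : ℝ)..T, inner ℝ (B (y + ∫ x in (0 : ℝ)..s, u.1 x)) (B (V.1 s)) =
      (∫ s in (0 : ℝ)..T, inner ℝ (B y) (B (V.1 s))) +
        ∫ s in (0 : ℝ)..T, inner ℝ (B (∫ x in (0 : ℝ)..s, u.1 x)) (B (V.1 s)) := by
    rw [← intervalIntegral.integral_add
      (hg.intervalIntegrable_inner (isPiecewisePoly_const y) hV B)
      (hg.intervalIntegrable_inner (hg.primitive hup) hV B)]
    simp only [map_add, inner_add_left]
  have e3 := hL u V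
  rw [hu] at e3
  have e4 : ℓ V = f.1 (ι V) + fracForm e α 0 T c (ι V) -
    ∫ s in (0 : ℝ)..T, inner ℝ (B y) (B (V.1 s)) := rfl
  change fracForm e α 0 T g (ι V) + _ = f.1 (ι V)
  rw [e1, e2]
  linarith

end DiscreteExistence

/-! ### The discrete solution -/

section Solution

/-! ### The scalar inequality and the passage to the finite element spaces -/

section Abstract

variable {X : Type*} [NormedAddCommGroup X] [InnerProductSpace ℝ X] {e : HilbertBasis ℕ ℝ X}
  {α T : ℝ} {Y : Type*} [NormedAddCommGroup Y] [NormedSpace ℝ Y] {t : ℕ → ℝ} {J m : ℕ}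

variable (e) in
/-- The function `AU' - p` as an element of the fractional Sobolev space. -/
def derivSub (hg : IsGrid t J T) (A : Y →L[ℝ] X) (h0 : 0 < α) (h1 : α < 1 / 2) {U : ℝ → Y}
    (hU : IsPiecewisePoly t J (m + 1) U) (p : X) : FracSpace e α 0 T :=
  ⟨fun s => A (deriv U s) - p,
    sub_mem (hg.mem A hU.deriv e h0 h1) (const_mem e hg.nonneg h0 h1 p)⟩

lemma ae_eq_derivSub (hg : IsGrid t J T) (A : Y →L[ℝ] X) (h0 : 0 < α) (h1 : α < 1 / 2)
    {U : ℝ → Y} (hU : IsPiecewisePoly t J (m + 1) U) (p : X) :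
    (derivSub e hg A h0 h1 hU p).1 =ᵐ[volume.restrict (Ioo 0 T)] fun s => A (deriv U s) - p :=
  Filter.EventuallyEq.refl _ _

/-- By the fundamental theorem of calculus, the primitive of `AU' - p` from `0` is exactly the
function differentiated in the scheme. -/
lemma eqRLDeriv_derivSub [CompleteSpace X] [CompleteSpace Y] {γ : ℝ} (hγ : 1 < γ) (hγ' : γ < 2)
    (hT : 0 < T) (hg : IsGrid t J T) (A : Y →L[ℝ] X) {U : ℝ → Y}
    (hU : IsPiecewisePoly t J (m + 1) U) (hc : ContinuousOn U (Icc 0 T)) (p : X) :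
    EqRLDeriv (gamma0_pos hγ) (gamma0_lt hγ') hT
      (fracFunctional (derivSub e hg A (gamma0_pos hγ) (gamma0_lt hγ') hU p)) γ
      (fun s => A (U s) - A (U 0) - s • p) := by
  refine eqRLDeriv_fracFunctional hγ hγ' hT _ fun s hs => ?_
  have hi := hg.intervalIntegrable hU.deriv hs
  have hi' : IntervalIntegrable (fun x => A (deriv U x)) volume 0 s :=
    hg.intervalIntegrable (hU.deriv.map A.toLinearMap) hs
  change _ = ∫ x in (0 : ℝ)..s, (A (deriv U x) - p)
  rw [intervalIntegral.integral_sub hi' intervalIntegrable_const,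
    A.intervalIntegral_comp_comm hi, hg.integral_deriv hU hc hs, map_sub,
    intervalIntegral.integral_const, sub_zero]

/-- The real inequality that turns the energy estimate into the stability estimate. -/
lemma add_le_of_energy {c K N G G₀ P D : ℝ} (hc : 0 < c) (hc' : c ≤ 1) (hK : 0 ≤ K)
    (hN : 0 ≤ N) (hG₀ : 0 ≤ G₀) (hP : 0 ≤ P) (hD : 0 ≤ D)
    (h : c * N ^ 2 + (1 / 2) * G ^ 2 ≤ (1 / 2) * G₀ ^ 2 + (D + K * P) * N) :
    N + G ≤ 2 * ((1 + (1 + K) ^ 2 / c) / c) * (G₀ + P + D) := by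
  obtain ⟨S, hS⟩ : ∃ S, S = G₀ + P + D := ⟨_, rfl⟩
  rw [← hS]
  have hS0 : 0 ≤ S := by rw [hS]; positivity
  set R := (1 + K) ^ 2 / c with hR
  have hR0 : 0 ≤ R := by positivity
  have h1 : (D + K * P) * N ≤ (1 + K) * S * N := by
    refine mul_le_mul_of_nonneg_right ?_ hN
    nlinarith [mul_nonneg hK hG₀, mul_nonneg hK hD]
  -- Young's inequality weighted by `c`, so that half of `c N²` survives on the left of the energy
  -- estimate.
  have h2 : (1 + K) * S * N ≤ c / 2 * N ^ 2 + R / 2 * S ^ 2 := by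
    have hRc : R * c = (1 + K) ^ 2 := div_mul_cancel₀ _ hc.ne'
    have h3 : 0 ≤ (c * N - (1 + K) * S) ^ 2 := sq_nonneg _
    have h4 : c * ((1 + K) * S * N) ≤ c * (c / 2 * N ^ 2 + R / 2 * S ^ 2) := by
      have : c * (R / 2 * S ^ 2) = (1 + K) ^ 2 * S ^ 2 / 2 := by rw [← hRc]; ring
      rw [mul_add c (_ * _), this]
      nlinarith
    exact le_of_mul_le_mul_left h4 hc
  have h3 : G₀ ^ 2 ≤ S ^ 2 := by
    gcongr
    linarith
  -- Here `c ≤ 1` is used to give both squares the same coefficient.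
  have h4 : c * (N ^ 2 + G ^ 2) ≤ (1 + R) * S ^ 2 := by
    nlinarith [mul_nonneg (sub_nonneg.2 hc') (sq_nonneg G)]
  set Q := (1 + R) / c with hQ
  have hQc : Q * c = 1 + R := div_mul_cancel₀ _ hc.ne'
  have hQ1 : 1 ≤ Q := by
    rw [hQ, le_div_iff₀ hc]
    linarith
  have h5 : N ^ 2 + G ^ 2 ≤ Q * S ^ 2 := by
    have : c * (N ^ 2 + G ^ 2) ≤ c * (Q * S ^ 2) := by
      rw [← mul_assoc, mul_comm c Q, hQc]
      exact h4
    exact le_of_mul_le_mul_left this hc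
  -- `(N + G)² ≤ 2(N² + G²) ≤ 2Q S² ≤ (2Q S)²`; the last step uses `Q ≥ 1` and avoids a square root
  -- in the constant.
  refine abs_le_of_sq_le_sq' ?_ (by positivity) |>.2
  nlinarith [sq_nonneg (N - G), mul_nonneg (mul_nonneg (sub_nonneg.2 hQ1)
    (by linarith : (0 : ℝ) ≤ Q)) (sq_nonneg S)]

end Abstract

variable {d : ℕ} {Ω : Set (EuclideanSpace ℝ (Fin d))}
  {𝒦 : Finset (Finset (EuclideanSpace ℝ (Fin d)))} {n : ℕ} {γ T σ : ℝ} {J m : ℕ}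

lemma isGrid_gridPoint (hT : 0 < T) (hσ : 1 ≤ σ) (hJ : 1 ≤ J) : IsGrid (gridPoint T σ J) J T :=
  ⟨gridPoint_mono hT hσ J, gridPoint_zero hσ J, gridPoint_last hJ⟩

lemma gridPoint_pos (hT : 0 < T) (hJ : 1 ≤ J) {j : ℕ} (hj : 1 ≤ j) : 0 < gridPoint T σ J j := by
  have h1 : (0 : ℝ) < j := by exact_mod_cast hj
  have h2 : (0 : ℝ) < J := by exact_mod_cast hJ
  unfold gridPoint
  positivity

variable (Ω 𝒦 n) in
/-- The map `fn` as a continuous linear map. -/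
def fnL : Sh Ω 𝒦 n →L[ℝ] L2 Ω :=
  (ContinuousLinearMap.fst ℝ (L2 Ω) (L2Vec Ω)).comp (Sh Ω 𝒦 n).subtypeL

variable (Ω 𝒦 n) in
/-- The map `grad` as a continuous linear map. -/
def gradL : Sh Ω 𝒦 n →L[ℝ] L2Vec Ω :=
  (ContinuousLinearMap.snd ℝ (L2 Ω) (L2Vec Ω)).comp (Sh Ω 𝒦 n).subtypeL

/-- A solution comes with some functional `F` representing the derivative. By density it agrees with
the explicit form on piecewise polynomials, and uniqueness of the projection identifies its `p` with
the given one. -/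
lemma IsDiscreteSolution.isWeakSolution [CompleteSpace (Sh Ω 𝒦 n)] {e : HilbertBasis ℕ ℝ (L2 Ω)}
    {hγ : 1 < γ} {hγ' : γ < 2} {hT : 0 < T} {hσ : 1 ≤ σ} {hJ : 1 ≤ J} {u₀ : H01 Ω} {u₁ : L2 Ω}
    {f : FracDual e ((γ - 1) / 2) 0 T} {U : ℝ → Sh Ω 𝒦 n}
    (h : IsDiscreteSolution hγ hγ' hT hσ hJ m u₀ u₁ f U) {p : L2 Ω} (hp : IsL2Proj 𝒦 n u₁ p) :
    IsWeakSolution T (gridPoint T σ J) J m (fnL Ω 𝒦 n) (gradL Ω 𝒦 n)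
      (derivSub e (isGrid_gridPoint hT hσ hJ) (fnL Ω 𝒦 n) (gamma0_pos hγ) (gamma0_lt hγ') h.1.2 p)
      U f := by
  refine Exists.elim h.2.2 fun q hq => Exists.elim hq fun F hF => ?_
  have hpq := hp.unique hF.1
  subst hpq
  intro V hV v hv
  have hg := isGrid_gridPoint hT hσ hJ
  have hG := eqRLDeriv_derivSub (e := e) hγ hγ' hT hg (fnL Ω 𝒦 n) h.1.2 h.1.1 p
  have h1 := hF.2.1.eq_on_piecewisePoly hG hg.mono hg.zero hg.last (hV.map (fnL Ω 𝒦 n).toLinearMap)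
      hv
  have h2 := hF.2.2 V hV
  rw [FracDual.congr F (w := v) hv.symm, FracDual.congr f (w := v) hv.symm, h1] at h2
  exact h2

lemma exists_isDiscreteSolution (hΩ : IsOpen Ω) (h𝒦 : IsTriangulation Ω 𝒦)
    {e : HilbertBasis ℕ ℝ (L2 Ω)} (hγ : 1 < γ) (hγ' : γ < 2) (hT : 0 < T) (hσ : 1 ≤ σ)
    (hJ : 1 ≤ J) (u₀ : H01 Ω) (u₁ : L2 Ω) (f : FracDual e ((γ - 1) / 2) 0 T) :
    ∃ U : ℝ → Sh Ω 𝒦 n, IsDiscreteSolution hγ hγ' hT hσ hJ m u₀ u₁ f U := by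
  have hfin : Module.Finite ℝ (Sh Ω 𝒦 n) := finite_Sh hΩ h𝒦
  have hcomp : CompleteSpace (Sh Ω 𝒦 n) := FiniteDimensional.complete ℝ _
  have h0 := gamma0_pos hγ
  have h1 := gamma0_lt hγ'
  have hg := isGrid_gridPoint hT hσ hJ
  refine Exists.elim (exists_isL2Proj (n := n) hΩ h𝒦 u₁) fun p hp => ?_
  refine Exists.elim (exists_isRitzProj (𝒦 := 𝒦) (n := n) u₀) fun r hr => ?_
  refine Exists.elim (exists_isWeakSolution (m := m) (A := fnL Ω 𝒦 n) (B := gradL Ω 𝒦 n) h0 h1 hT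
    hg (fn_injective hΩ) f r ⟨_, const_mem e hT.le h0 h1 p⟩) fun U hU => ?_
  have hw := hU.2.2.2 (derivSub e hg (fnL Ω 𝒦 n) h0 h1 hU.1 p) (Filter.EventuallyEq.of_eq rfl)
  refine ⟨U, ⟨hU.2.1, hU.1⟩, ?_, p, fracFunctional _, hp,
    eqRLDeriv_derivSub hγ hγ' hT hg (fnL Ω 𝒦 n) hU.1 hU.2.1 p, fun V hV => ?_⟩
  · rw [hU.2.2.1]
    exact hr
  · exact hw V hV _ (Filter.EventuallyEq.of_eq rfl)

/-- Uniqueness of the Ritz projection gives equal initial values and that of the `L²` projection a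
common `p`, so abstract uniqueness applies. -/
lemma IsDiscreteSolution.eqOn (hΩ : IsOpen Ω) (h𝒦 : IsTriangulation Ω 𝒦) (hd : 0 < d)
    {e : HilbertBasis ℕ ℝ (L2 Ω)}
    {hγ : 1 < γ} {hγ' : γ < 2} {hT : 0 < T} {hσ : 1 ≤ σ} {hJ : 1 ≤ J} {u₀ : H01 Ω} {u₁ : L2 Ω}
    {f : FracDual e ((γ - 1) / 2) 0 T} {U V : ℝ → Sh Ω 𝒦 n}
    (hU : IsDiscreteSolution hγ hγ' hT hσ hJ m u₀ u₁ f U)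
    (hV : IsDiscreteSolution hγ hγ' hT hσ hJ m u₀ u₁ f V) : EqOn U V (Icc 0 T) := by
  have hfin : Module.Finite ℝ (Sh Ω 𝒦 n) := finite_Sh hΩ h𝒦
  have hcomp : CompleteSpace (Sh Ω 𝒦 n) := FiniteDimensional.complete ℝ _
  refine Exists.elim (exists_isL2Proj (n := n) hΩ h𝒦 u₁) fun p hp => ?_
  have hwU := hU.isWeakSolution hp
  have hwV := hV.isWeakSolution hp
  have hi : U 0 = V 0 := hU.2.1.unique (grad_injective hΩ h𝒦 hd) hV.2.1
  have hA : Function.Injective (fnL Ω 𝒦 n) := fn_injective hΩ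
  exact hwU.unique (gamma0_pos hγ) (gamma0_lt hγ') hT (isGrid_gridPoint hT hσ hJ) hA hwV hU.1.2
    hV.1.2 hU.1.1 hV.1.1 (p := p) (ae_eq_derivSub _ _ _ _ _ _) (ae_eq_derivSub _ _ _ _ _ _) hi

lemma IsTrial.mem_fracSpace (hT : 0 < T) (hσ : 1 ≤ σ) {U : ℝ → Sh Ω 𝒦 n}
    (hU : IsTrial T σ J m U) (e : HilbertBasis ℕ ℝ (L2 Ω)) {α : ℝ} (h0 : 0 < α) (h1 : α < 1 / 2)
    {j : ℕ} (hj : j ≤ J) :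
    (fun t => fn (deriv U t)) ∈ FracSpace e α 0 (gridPoint T σ J j) := by
  have h := mem_of_piecewisePoly e (gridPoint_mono hT hσ J)
    ((IsPiecewisePoly.deriv hU.2).mono_left hj |>.map fn) h0 h1
  rwa [gridPoint_zero hσ] at h

/-- The abstract estimate, with `R_h u₀` and `Π_h u₁` replaced by the data because both projections
are contractions, and with the norm of the constant evaluated by scaling. -/
lemma IsDiscreteSolution.energy_le (hΩ : IsOpen Ω) (h𝒦 : IsTriangulation Ω 𝒦)
    {e : HilbertBasis ℕ ℝ (L2 Ω)}
    {hγ : 1 < γ} {hγ' : γ < 2} {hT : 0 < T} {hσ : 1 ≤ σ} {hJ : 1 ≤ J} {u₀ : H01 Ω} {u₁ : L2 Ω}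
    {f : FracDual e ((γ - 1) / 2) 0 T} {U : ℝ → Sh Ω 𝒦 n}
    (hU : IsDiscreteSolution hγ hγ' hT hσ hJ m u₀ u₁ f U) {K : ℝ} (hK : 0 ≤ K)
    (hconst : ∀ b, 0 < b → ∀ x : L2 Ω,
      fracNorm e ((γ - 1) / 2) 0 b (fun _ => x) = K * b ^ (1 / 2 - (γ - 1) / 2) * ‖x‖)
    {j : ℕ} (hj1 : 1 ≤ j) (hj : j ≤ J) :
    Real.cos (Real.pi * ((γ - 1) / 2)) *
        fracNorm e ((γ - 1) / 2) 0 (gridPoint T σ J j) (fun t => fn (deriv U t)) ^ 2 +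
      (1 / 2) * ‖grad (U (gridPoint T σ J j))‖ ^ 2 ≤ (1 / 2) * ‖u₀.1.2‖ ^ 2 +
        (fracDualNorm (restrictDual (gridPoint_le hT hσ hJ hj) f) +
          K * (gridPoint T σ J j ^ (1 / 2 - (γ - 1) / 2) * ‖u₁‖)) *
          fracNorm e ((γ - 1) / 2) 0 (gridPoint T σ J j) (fun t => fn (deriv U t)) := by
  have hfin : Module.Finite ℝ (Sh Ω 𝒦 n) := finite_Sh hΩ h𝒦
  have hcomp : CompleteSpace (Sh Ω 𝒦 n) := FiniteDimensional.complete ℝ _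
  refine Exists.elim (exists_isL2Proj (n := n) hΩ h𝒦 u₁) fun p hp => ?_
  have hpos := gridPoint_pos (σ := σ) hT hJ hj1
  have hE := (hU.isWeakSolution hp).energy_le _ _ (gamma0_pos hγ) (gamma0_lt hγ') hT
    (isGrid_gridPoint hT hσ hJ) hU.1.2 hU.1.1 (p := p) (ae_eq_derivSub _ _ _ _ _ _) hj
  have hp' : fracNorm e ((γ - 1) / 2) 0 (gridPoint T σ J j) (fun _ => p) ≤
      K * (gridPoint T σ J j ^ (1 / 2 - (γ - 1) / 2) * ‖u₁‖) := by
    rw [hconst _ hpos p, mul_assoc]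
    exact mul_le_mul_of_nonneg_left (mul_le_mul_of_nonneg_left hp.norm_le
      (Real.rpow_nonneg hpos.le _)) hK
  have h1 : ‖gradL Ω 𝒦 n (U 0)‖ ≤ ‖u₀.1.2‖ := hU.2.1.norm_le
  refine le_trans hE (add_le_add ?_ (mul_le_mul_of_nonneg_right ?_ (fracNorm_nonneg _ _ _ _ _)))
  · exact mul_le_mul_of_nonneg_left (pow_le_pow_left₀ (norm_nonneg _) h1 2) (by norm_num)
  · exact add_le_add_right hp' _

end Solution

end FracWave

end

/-! ### Unique solvability and stability of the scheme -/

theorem theorem4p1 (γ T : ℝ) (m n : ℕ) (hγ : 1 < γ) (hγ' : γ < 2) (hT : 0 < T) (hm : 1 ≤ m)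
    (hn : 1 ≤ n) :
    ∃ C : ℝ, 0 < C ∧
      ∀ (d : ℕ) (Ω : Set (EuclideanSpace ℝ (Fin d)))
        (𝒦 : Finset (Finset (EuclideanSpace ℝ (Fin d)))) (σ : ℝ) (J : ℕ)
        (e : HilbertBasis ℕ ℝ (FracWave.L2 Ω)),
        d = 2 ∨ d = 3 → IsOpen Ω → FracWave.IsTriangulation Ω 𝒦 →
        ∀ (hσ : 1 ≤ σ) (hJ : 1 ≤ J) (u₀ : FracWave.H01 Ω) (u₁ : FracWave.L2 Ω)
          (f : FracWave.FracDual e ((γ - 1) / 2) 0 T),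
          (∃ U : ℝ → FracWave.Sh Ω 𝒦 n,
            FracWave.IsDiscreteSolution hγ hγ' hT hσ hJ m u₀ u₁ f U ∧
            ∀ V : ℝ → FracWave.Sh Ω 𝒦 n,
              FracWave.IsDiscreteSolution hγ hγ' hT hσ hJ m u₀ u₁ f V → EqOn V U (Icc 0 T)) ∧
          ∀ U : ℝ → FracWave.Sh Ω 𝒦 n,
            FracWave.IsDiscreteSolution hγ hγ' hT hσ hJ m u₀ u₁ f U →
            ∀ j : ℕ, 1 ≤ j → ∀ hj : j ≤ J,
              (fun t => FracWave.fn (deriv U t)) ∈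
                FracWave.FracSpace e ((γ - 1) / 2) 0 (FracWave.gridPoint T σ J j) ∧
              FracWave.fracNorm e ((γ - 1) / 2) 0 (FracWave.gridPoint T σ J j)
                  (fun t => FracWave.fn (deriv U t)) +
                ‖FracWave.grad (U (FracWave.gridPoint T σ J j))‖ ≤
              C * (‖u₀.1.2‖ +
                FracWave.gridPoint T σ J j ^ (1 / 2 - (γ - 1) / 2) * ‖u₁‖ +
                FracWave.fracDualNorm
                  (FracWave.restrictDual (FracWave.gridPoint_le hT hσ hJ hj) f)) := by
  obtain ⟨K, hK, hconst⟩ := FracWave.exists_fracNorm_const_eq ((γ - 1) / 2)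
  have hc : 0 < Real.cos (Real.pi * ((γ - 1) / 2)) :=
    Real.cos_pos_of_mem_Ioo ⟨by nlinarith [Real.pi_pos], by nlinarith [Real.pi_pos]⟩
  -- The constant of `add_le_of_energy` with `c = cos(πγ₀)`; since `K` depends only on `γ₀`, the
  -- constant depends on `γ` alone.
  refine ⟨2 * ((1 + (1 + K) ^ 2 / Real.cos (Real.pi * ((γ - 1) / 2))) /
    Real.cos (Real.pi * ((γ - 1) / 2))), by positivity, ?_⟩
  intro d Ω 𝒦 σ J e hd hΩ h𝒦 hσ hJ u₀ u₁ f
  have hd0 : 0 < d := by omega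
  refine ⟨?_, fun U hU j hj1 hj => ⟨?_, ?_⟩⟩
  · refine Exists.elim (FracWave.exists_isDiscreteSolution (n := n) (m := m) hΩ h𝒦 hγ hγ' hT hσ hJ
      u₀ u₁ f) fun U hU => ?_
    exact ⟨U, hU, fun V hV => hV.eqOn hΩ h𝒦 hd0 hU⟩
  · exact hU.1.mem_fracSpace hT hσ e (FracWave.gamma0_pos hγ) (FracWave.gamma0_lt hγ') hj
  · exact FracWave.add_le_of_energy hc (Real.cos_le_one _) hK
      (FracWave.fracNorm_nonneg _ _ _ _ _) (norm_nonneg _)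
      (mul_nonneg (Real.rpow_nonneg (FracWave.gridPoint_pos hT hJ hj1).le _) (norm_nonneg _))
      (FracWave.fracDualNorm_nonneg _) (hU.energy_le hΩ h𝒦 hK (hconst e) hj1 hj)
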